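/- **Setting.** Let $d\in\{2,3\}$ and let $\Omega\subset\mathbb R^d$ be a bounded open set that is partitioned by a mesh $\mathcal G_H$ of closed axis-parallel cubes of side length $H$ from one lattice ($\Omega$ is the interior of $\cup\mathcal G_H$). Let $\mathfrak A\in L^\infty(\Omega;\mathbb R^{d\times d})$ be symmetric with $\theta|z|^2\le z^T\mathfrak A(x)z\le\Theta|z|^2$ for a.e. $x\in\Omega$ and all $z\in\mathbb R^d$, where $0<\theta\le\Theta$, and put $a(v,w)=\int_\Omega \mathfrak A\nabla v\cdot\nabla w\,dx$. Let $\mathcal N_H$ be the set of mesh vertices not on $\partial\Omega$, $\Lambda_i$ the nodal $Q_1$ basis function of the vertex $i$, $\omega_i$ the union of the cubes containing $i$, $\mathsf N(\omega)$ the interior of the union of the cubes that meet $\overline\omega$, and $\mathsf N^\ell$ its $\ell$-fold iterate, $\ell\ge1$. Let $q_k(v)=(\Lambda_k,v)_{L^2(\mathsf N^\ell(\omega_k))}/(\Lambda_k,1)_{L^2(\mathsf N^\ell(\omega_k))}$. For $j\in\mathcal N_H$ let $\mathcal N_H^{(j)}$ be the set of $k\in\mathcal N_H$ with $\omega_k\cap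 \mathsf N^\ell(\omega_j)\ne\emptyset$, and for $k\in\mathcal N_H^{(j)}$ let $u_k^{j,\ell}\in H^1_0(\mathsf N^\ell(\omega_j))$ solve $a(v,u_k^{j,\ell})=q_k(v)$ for all $v\in H^1_0(\mathsf N^\ell(\omega_j))$. Put, for $i,k\in\mathcal N_H^{(j)}$, $$\mathfrak M^{(j)}_{ik}=q_i(u_k^{j,\ell}),\qquad \mathfrak a^{(j)}_{ik}=a(\Lambda_i,u_k^{j,\ell}),\qquad \mathfrak M^{(j)}\mu^{(j)}=-e_j,\qquad \mathcal A_{ij}=-\sum_{k\in\mathcal N_H^{(j)}}\mu^{(j)}_k\mathfrak a^{(j)}_{ik},$$ and $\mathcal A_{ij}=0$ for $i\notin\mathcal N_H^{(j)}$. Let $\widehat{\mathcal A}$ be the matrix obtained in the same way from the noisy values $\widehat{\mathfrak M}^{(j)}=\mathfrak M^{(j)}+\mathcal N_{\mathfrak M}^{(j)}$ and $\widehat{\mathfrak a}^{(j)}_{ik}=\mathfrak a^{(j)}_{ik}+\mathcal N^{(j)}_{\mathfrak a_{ik}}$, with $\widehat{\mathfrak M}^{(j)}\widehat\mu^{(j)}=-e_j$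 and $\delta\mu^{(j)}=\widehat\mu^{(j)}-\mu^{(j)}$, and let $$\mathcal E_{\mathfrak a}=\max_{j}\max_{i,k\in\mathcal N_H^{(j)}}|\mathcal N^{(j)}_{\mathfrak a_{ik}}|,\qquad \mathcal E_{\mathfrak M}=\max_j\|\mathcal N^{(j)}_{\mathfrak M}\|_{\max}.$$ *Variant with domain extension.* For $\Omega=(0,1)^d$, $H=1/m$ with $m\in\mathbb N$, $m\ge 1$, and $1\le\ell\le m$, the mesh may instead be extended by $\ell$ layers of cubes. Then patches, local problems and quantities of interest are formed in the extended mesh, with $\mathfrak A$ mirrored at the faces of the unit cube; the local index set of $\mathfrak M^{(j)}$, and of the index $k$, consists of all vertices $k$ of the extended mesh with $\omega_k\cap\mathsf N^\ell(\omega_j)\neq\emptyset$, while $i$ still ranges over such vertices in $\mathcal N_H$; and $\Lambda_i$ is replaced in $\mathfrak a_{ik}^{(j)}$ by $\Lambda_i^{\rm ext}(x)=\prod_{s=1}^d\big(\eta(x_s-i_s)-\eta(x_s+i_s)-\eta(x_s-2+i_s)\big)$, where $\eta(t)=\max(0,1-|t|/H)$ and $i_s$ are the coordinates of the vertex $i$.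 **Claim.** For every $\rho<1$ there is a constant $C>0$, depending only on $d$, $\Omega$ and $\rho$ (not on $H$, the mesh, $\ell$, $\mathfrak A$, $\theta$, $\Theta$ or the noise), such that the following holds in both variants. The local problems are uniquely solvable and every $\mathfrak M^{(j)}$ is invertible. If the noise is so small that $\|(\mathfrak M^{(j)})^{-1}\|_2\|\mathcal N^{(j)}_{\mathfrak M}\|_2\le\rho$ for all $j$, then every $\widehat{\mathfrak M}^{(j)}$ is invertible and $\widehat{\mathcal A}=\mathcal A+\delta\mathcal A$, where, up to a term of second order in the noise, $$\delta\mathcal A_{ij}\approx\delta^{(1)}\!\mathcal A_{ij}:=-\sum_{k}\big(\mu^{(j)}_k\mathcal N^{(j)}_{\mathfrak a_{ik}}+\delta\mu^{(j)}_k\mathfrak a^{(j)}_{ik}\big)$$ (the sum over the local index set of $j$, and the entry being $0$ if row $i$ is not assembled for $j$), namely $$|\delta\mathcal A_{ij}-\delta^{(1)}\!\mathcal A_{ij}|\le C\,\Theta^2(2\ell+3)^{2d}\,\mathcal E_{\mathfrak M}\mathcal E_{\mathfrak a},$$ and both $\delta\mathcal A$ and its first-order part $\delta^{(1)}\!\mathcal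 A$ have spectral norm at most $$C\,H^{-d/2}(2\ell+3)^d\,\Theta\Big(\mathcal E_{\mathfrak a}+\frac{\Theta^2}{\theta}\,2(\ell+1)(2\ell+3)^d\,\mathcal E_{\mathfrak M}\Big).$$ -/

import Mathlib

open MeasureTheory
open scoped Matrix

noncomputable section

/-- Euclidean space `ℝ^d`. -/
abbrev RSpace (d : ℕ) : Type := EuclideanSpace ℝ (Fin d)

/-! ### Cartesian coarse meshes -/

/-- A finite mesh of closed axis-parallel cubes of side length `H`, all taken from one lattice
`origin + H ℤ^d`; a cube is encoded by the integer coordinates of its lowest corner. -/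
structure CubeMesh (d : ℕ) where
  origin : RSpace d
  H : ℝ
  H_pos : 0 < H
  cells : Finset (Fin d → ℤ)

namespace CubeMesh

variable {d : ℕ} (G : CubeMesh d)

/-- The lattice point with integer coordinates `i`. -/
def point (i : Fin d → ℤ) : RSpace d :=
  WithLp.toLp 2 (fun s => G.origin s + G.H * (i s : ℝ))

/-- The closed cube with lowest corner `z`. -/
def cell (z : Fin d → ℤ) : Set (RSpace d) :=
  {x | ∀ s, G.point z s ≤ x s ∧ x s ≤ G.point z s + G.H}

/-- The open set that is partitioned by the mesh. -/
def domain : Set (RSpace d) := interior (⋃ z ∈ G.cells, G.cell z)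

/-- All vertices of the mesh. -/
def vertices : Finset (Fin d → ℤ) := G.cells.biUnion (fun z => Finset.Icc z (z + 1))

open Classical in
/-- The free vertices: those that are not on the boundary of the domain. -/
def freeVertices : Finset (Fin d → ℤ) :=
  G.vertices.filter (fun i => G.point i ∉ frontier G.domain)

/-- The one-dimensional hat of width `H` centred at `0`. -/
def hat1 (t : ℝ) : ℝ := max 0 (1 - |t| / G.H)

/-- The nodal `Q₁` basis function `Λ_i` of the vertex `i`. -/
def hat (i : Fin d → ℤ) (x : RSpace d) : ℝ := ∏ s, G.hat1 (x s - G.point i s)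

/-- `ω_i`, the union of the mesh cubes that contain the vertex `i`. -/
def star (i : Fin d → ℤ) : Set (RSpace d) :=
  ⋃ z ∈ {z | z ∈ G.cells ∧ G.point i ∈ G.cell z}, G.cell z

/-- The neighbourhood `N(ω)`: the interior of the union of the mesh cubes that meet `closure ω`. -/
def nbhd (ω : Set (RSpace d)) : Set (RSpace d) :=
  interior (⋃ z ∈ {z | z ∈ G.cells ∧ (G.cell z ∩ closure ω).Nonempty}, G.cell z)

/-- The patch `N^ℓ(ω_i)`. -/
def patch (ℓ : ℕ) (i : Fin d → ℤ) : Set (RSpace d) := G.nbhd^[ℓ] (G.star i)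

/-- The quantity of interest `q_k(v) = (Λ_k, v) / (Λ_k, 1)`, with the `L²` products taken over
the patch `N^ℓ(ω_k)`. -/
def qoi (ℓ : ℕ) (k : Fin d → ℤ) (v : RSpace d → ℝ) : ℝ :=
  (∫ x in G.patch ℓ k, G.hat k x * v x) / (∫ x in G.patch ℓ k, G.hat k x)

end CubeMesh

/-! ### The space `H¹₀(ω)` and the bilinear form -/

/-- Pairs of an `L²` function and an `L²` vector field on `ℝ^d`. -/
abbrev L2Pair (d : ℕ) : Type :=
  WithLp 2 (Lp ℝ 2 (volume : Measure (RSpace d)) × Lp (RSpace d) 2 (volume : Measure (RSpace d)))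

/-- The pairs `(φ, ∇φ)` with `φ` smooth and compactly supported in `ω`. -/
def testPairs {d : ℕ} (ω : Set (RSpace d)) : Set (L2Pair d) :=
  {p | ∃ φ : RSpace d → ℝ, ContDiff ℝ (⊤ : ℕ∞) φ ∧ HasCompactSupport φ ∧ tsupport φ ⊆ ω ∧
    (p.fst : RSpace d → ℝ) =ᵐ[volume] φ ∧
    (p.snd : RSpace d → RSpace d) =ᵐ[volume] gradient φ}

/-- `H¹₀(ω)`, the `H¹` closure of the smooth functions with compact support in `ω`. An element `v`
is stored together with its weak gradient: `v.fst` is the function (extended by zero) and `v.snd`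
its gradient. The test pairs form a linear space, so the span is there only for convenience. -/
def H10 {d : ℕ} (ω : Set (RSpace d)) : Submodule ℝ (L2Pair d) :=
  (Submodule.span ℝ (testPairs ω)).topologicalClosure

/-- `∫_D (A g) · h`, which is `a(v, w)` for `g = ∇v` and `h = ∇w`. -/
def energyForm {d : ℕ} (D : Set (RSpace d)) (A : RSpace d → Matrix (Fin d) (Fin d) ℝ)
    (g h : RSpace d → RSpace d) : ℝ :=
  ∫ x in D, (A x *ᵥ (g x).ofLp) ⬝ᵥ (h x).ofLp

/-- A measurable field of symmetric matrices on `Ω` with spectral bounds `θ` and `Θ`. -/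
structure UniformlyElliptic {d : ℕ} (Ω : Set (RSpace d)) (A : RSpace d → Matrix (Fin d) (Fin d) ℝ)
    (θ Θ : ℝ) : Prop where
  pos : 0 < θ
  le : θ ≤ Θ
  aemeasurable : ∀ s t, AEMeasurable (fun x => A x s t) (volume.restrict Ω)
  symm : ∀ᵐ x ∂(volume.restrict Ω), (A x).IsSymm
  lower : ∀ᵐ x ∂(volume.restrict Ω), ∀ z : Fin d → ℝ, θ * (z ⬝ᵥ z) ≤ z ⬝ᵥ (A x *ᵥ z)
  upper : ∀ᵐ x ∂(volume.restrict Ω), ∀ z : Fin d → ℝ, z ⬝ᵥ (A x *ᵥ z) ≤ Θ * (z ⬝ᵥ z)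

/-! ### The localized method and its assembly -/

/-- The input of the assembly: a mesh, the oversampling parameter `ℓ`, the nodes that index the
stiffness matrix, the nodes that carry a quantity of interest, the coefficient, and the coarse
function attached to each node. Only the instances singled out in `IsLODSetting` are used. -/
structure LODData (d : ℕ) where
  mesh : CubeMesh d
  ell : ℕ
  basisNodes : Finset (Fin d → ℤ)
  qoiNodes : Finset (Fin d → ℤ)
  coeff : RSpace d → Matrix (Fin d) (Fin d) ℝ
  shape : (Fin d → ℤ) → RSpace d → ℝ

namespace LODData

/-- The method on a mesh of `Ω`, with the patches formed in `Ω`. -/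
def standard {d : ℕ} (G : CubeMesh d) (ℓ : ℕ) (A : RSpace d → Matrix (Fin d) (Fin d) ℝ) :
    LODData d where
  mesh := G
  ell := ℓ
  basisNodes := G.freeVertices
  qoiNodes := G.freeVertices
  coeff := A
  shape := G.hat

/-- The Cartesian mesh of side length `1/m` of the unit cube, extended by `r` layers of cubes. -/
def unitMesh (d m : ℕ) (hm : 0 < m) (r : ℕ) : CubeMesh d where
  origin := 0
  H := 1 / (m : ℝ)
  H_pos := by positivity
  cells := Finset.Icc (fun _ => -(r : ℤ)) (fun _ => (m : ℤ) + (r : ℤ) - 1)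

/-- Reflection of the real line into `[0,1]` (for arguments in `[-1,2]`). -/
def fold (t : ℝ) : ℝ := if t < 0 then -t else if 1 < t then 2 - t else t

/-- The coefficient mirrored at the boundary of the unit cube. -/
def mirror {d : ℕ} (A : RSpace d → Matrix (Fin d) (Fin d) ℝ) (x : RSpace d) :
    Matrix (Fin d) (Fin d) ℝ :=
  A (WithLp.toLp 2 (fun s => fold (x s)))

/-- The extended nodal function `Λ_i^ext`: the signed sum of the hats at `i` and at its mirror
images, in product form. -/
def hatExt {d : ℕ} (G : CubeMesh d) (i : Fin d → ℤ) (x : RSpace d) : ℝ :=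
  ∏ s, (G.hat1 (x s - G.point i s) - G.hat1 (x s + G.point i s) - G.hat1 (x s - (2 - G.point i s)))

/-- The method on the unit cube with domain extension by `ℓ` layers: local problems live on full
cubic patches of the extended mesh, with the mirrored coefficient and all local vertices. -/
def extended {d : ℕ} (m : ℕ) (hm : 0 < m) (ℓ : ℕ) (A : RSpace d → Matrix (Fin d) (Fin d) ℝ) :
    LODData d where
  mesh := unitMesh d m hm ℓ
  ell := ℓ
  basisNodes := (unitMesh d m hm 0).freeVertices
  qoiNodes := (unitMesh d m hm ℓ).vertices
  coeff := mirror A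
  shape := hatExt (unitMesh d m hm ℓ)

variable {d : ℕ} (S : LODData d)

open Classical in
/-- The nodes of `K` whose star `ω_k` meets the patch `N^ℓ(ω_j)`. -/
def near (K : Finset (Fin d → ℤ)) (j : Fin d → ℤ) : Finset (Fin d → ℤ) :=
  K.filter (fun k => (S.mesh.star k ∩ S.mesh.patch S.ell j).Nonempty)

/-- The index set of the stiffness matrix. -/
abbrev Node : Type := {j : Fin d → ℤ // j ∈ S.basisNodes}

/-- The rows `i` of column `j` that are assembled. -/
abbrev Row (j : S.Node) : Type := {i : Fin d → ℤ // i ∈ S.near S.basisNodes j.1}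

/-- The local index set of the patch of `j`. -/
abbrev Loc (j : S.Node) : Type := {k : Fin d → ℤ // k ∈ S.near S.qoiNodes j.1}

/-- `u ∈ H¹₀(N^ℓ(ω_j))` solves `a(v, u) = q_k(v)` for all `v ∈ H¹₀(N^ℓ(ω_j))`. -/
def IsLocalSolution (j : S.Node) (k : S.Loc j) (u : L2Pair d) : Prop :=
  u ∈ H10 (S.mesh.patch S.ell j.1) ∧
    ∀ v ∈ H10 (S.mesh.patch S.ell j.1),
      energyForm S.mesh.domain S.coeff v.snd u.snd = S.mesh.qoi S.ell k.1 v.fst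

/-- The matrices `[M^(j)]_{nm} = q_n(u_m^{j,ℓ})`. -/
def measM (u : ∀ j : S.Node, S.Loc j → L2Pair d) (j : S.Node) : Matrix (S.Loc j) (S.Loc j) ℝ :=
  fun n m => S.mesh.qoi S.ell n.1 (u j m).fst

/-- The scalars `a_{ik}^(j) = a(Λ_i, u_k^{j,ℓ})`. -/
def measA (u : ∀ j : S.Node, S.Loc j → L2Pair d) (j : S.Node) : Matrix (S.Row j) (S.Loc j) ℝ :=
  fun i k => energyForm S.mesh.domain S.coeff (gradient (S.shape i.1)) (u j k).snd

/-- The solution `μ^(j)` of `M^(j) μ^(j) = -e_j` (for invertible `M^(j)`). -/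
def multiplier (M : ∀ j : S.Node, Matrix (S.Loc j) (S.Loc j) ℝ) (j : S.Node) : S.Loc j → ℝ :=
  -((M j)⁻¹ *ᵥ (fun n => if n.1 = j.1 then 1 else 0))

/-- The assembly of the stiffness matrix from the matrices `M^(j)` and the scalars `a_{ik}^(j)`,
exact or measured: `A_{ij} = -∑_k μ_k^(j) a_{ik}^(j)`. -/
def assemble (M : ∀ j : S.Node, Matrix (S.Loc j) (S.Loc j) ℝ)
    (a : ∀ j : S.Node, Matrix (S.Row j) (S.Loc j) ℝ) : Matrix S.Node S.Node ℝ :=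
  fun i j => if h : i.1 ∈ S.near S.basisNodes j.1 then
    -∑ k, S.multiplier M j k * a j ⟨i.1, h⟩ k else 0

/-- The first order part of the perturbation,
`-∑_k (μ_k^(j) N_{a_ik}^(j) + δμ_k^(j) a_{ik}^(j))`, where `μ^(j) + δμ^(j)` solves the system with
the matrix `M^(j) + N_M^(j)`. -/
def firstOrder (M : ∀ j : S.Node, Matrix (S.Loc j) (S.Loc j) ℝ)
    (a : ∀ j : S.Node, Matrix (S.Row j) (S.Loc j) ℝ)
    (noiseM : ∀ j : S.Node, Matrix (S.Loc j) (S.Loc j) ℝ)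
    (noiseA : ∀ j : S.Node, Matrix (S.Row j) (S.Loc j) ℝ) : Matrix S.Node S.Node ℝ :=
  fun i j => if h : i.1 ∈ S.near S.basisNodes j.1 then
    -∑ k, (S.multiplier M j k * noiseA j ⟨i.1, h⟩ k +
      (S.multiplier (M + noiseM) j k - S.multiplier M j k) * a j ⟨i.1, h⟩ k) else 0

/-- The largest absolute value of the entries of a family of matrices. -/
def maxEntry {ι : Type*} {R C : ι → Type*} (X : ∀ j, Matrix (R j) (C j) ℝ) : ℝ :=
  ⨆ j, ⨆ i, ⨆ k, |X j i k|

end LODData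

/-- The two ways in which the method is set up for a coefficient on `Ω` with spectral bounds
`θ, Θ`: on an arbitrary mesh of cubes of `Ω`, or on the open unit cube with domain extension. -/
inductive IsLODSetting {d : ℕ} (Ω : Set (RSpace d)) (θ Θ : ℝ) : LODData d → Prop
  | standard (G : CubeMesh d) (hG : G.domain = Ω) (ℓ : ℕ) (hℓ : 1 ≤ ℓ)
      (A : RSpace d → Matrix (Fin d) (Fin d) ℝ) (hA : UniformlyElliptic Ω A θ Θ) :
      IsLODSetting Ω θ Θ (LODData.standard G ℓ A)
  | extended (hΩ : Ω = {x | ∀ s, 0 < x s ∧ x s < 1}) (m : ℕ) (hm : 0 < m) (ℓ : ℕ) (hℓ : 1 ≤ ℓ)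
      (hℓm : ℓ ≤ m) (A : RSpace d → Matrix (Fin d) (Fin d) ℝ) (hA : UniformlyElliptic Ω A θ Θ) :
      IsLODSetting Ω θ Θ (LODData.extended m hm ℓ A)

/-- The spectral norm of a square matrix. -/
def specNorm {n : Type*} [Fintype n] [DecidableEq n] (X : Matrix n n ℝ) : ℝ :=
  ‖Matrix.toEuclideanCLM (n := n) (𝕜 := ℝ) X‖

end

/-! The matrix $M^{(j)}$ is a Gram matrix: for $w=\sum_k c_k u_k$ one has $c\cdot M^{(j)}c=a(w,w)$
and $a(v,w)=\sum_k c_k q_k(v)$ for $v\in H^1_0$ of the patch. Everything rests on two bounds for the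
noise-free data, followed by finite-dimensional linear algebra.

Inverse of $M^{(j)}$ (`euclNorm_le_measM`). For each local index $k$ there is a cube with vertex $k$
inside the patch, and in it a smooth bubble that is $L^2$-orthogonal to all nodal functions except
$\Lambda_k$. The combination $p$ of bubbles with coefficients $c$ satisfies $q_k(p)\ge 2^{-d}c_k$ up
to sign, so $a(p,w)\ge 2^{-d}|c|^2$, while $a(p,p)\lesssim\Theta H^{d-2}|c|^2$. By Cauchy–Schwarz,
$|c|^4\lesssim\Theta|c|^2\,a(w,w)\le\Theta|c|^3\,|M^{(j)}c|$, hence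
$\|(M^{(j)})^{-1}\|\lesssim\Theta$. Since $d\ge2$, the power $H^{d-2}$ is bounded in terms of
$\Omega$.

Rows of scalars (`euclNorm_measA_le`). Let $N$ be the norm of the row $(a(\Lambda_i,u_k))_k$ and
take this row itself as the coefficient vector of $w$. Then $N^2=a(\Lambda_i,w)$ and $a(w,w)\le
N\,|q(w)|$. Jensen's inequality and the finite overlap of the hats give
$H^d|q(w)|^2\lesssim\|w\|^2$, the Friedrichs inequality in a slab of half-width $(\ell+1)H$ gives
$\|w\|\lesssim(\ell+1)H\|\nabla w\|$, and $a(\Lambda_i,\Lambda_i)\lesssim\Theta H^{d-2}$. All powers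
of $H$ cancel and $N\lesssim(\ell+1)\Theta/\theta$ remains.

Perturbation (`perturbation_bounds`). A Neumann argument bounds $(M^{(j)}+N_M)^{-1}$ by $\Theta
p/(1-\rho)$, where $\Theta p$ bounds the exact inverse, and
$\delta\mu=(M^{(j)}+N_M)^{-1}N_M(M^{(j)})^{-1}e_j$. An entry of $\delta A$ is exactly
$-\sum(\hat\mu_kN_{a_{ik}}+\delta\mu_k a_{ik})$; replacing $\hat\mu$ by $\mu$ gives the first-order
part, so the remainder is the quadratic term $\sum\delta\mu_kN_{a_{ik}}$. Local index sets lie in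
integer boxes of radius $\ell+1$, so the entrywise bounds become spectral ones by the Schur test
with $(2\ell+3)^d$ entries per row and column. The factor $H^{-d/2}$ comes from $\sqrt{\text{number
of local vertices}}$.

Both variants are reduced to one interface, `Admissible`. For the extended variant the point is that
folding into the unit cube pulls null sets back to null sets, so the mirrored coefficient keeps its
a.e. bounds. -/

noncomputable section

/-! ### Geometry and counting of cubes, patches and vertices -/

namespace CubeMesh

variable {d : ℕ} (G : CubeMesh d)

/-- The open cube with lowest corner `z`. -/
def openCell (z : Fin d → ℤ) : Set (RSpace d) :=
  {x | ∀ s, G.point z s < x s ∧ x s < G.point z s + G.H}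

theorem point_apply (i : Fin d → ℤ) (s : Fin d) : G.point i s = G.origin s + G.H * (i s : ℝ) := rfl

theorem openCell_eq_preimage (z : Fin d → ℤ) :
    G.openCell z = WithLp.ofLp ⁻¹'
      (Set.univ.pi fun s => Set.Ioo (G.point z s) (G.point z s + G.H)) := by
  ext x; simp [openCell]

theorem cell_eq_preimage (z : Fin d → ℤ) :
    G.cell z = WithLp.ofLp ⁻¹'
      (Set.univ.pi fun s => Set.Icc (G.point z s) (G.point z s + G.H)) := by
  ext x; simp [cell, Pi.le_def, forall_and]

theorem isOpen_openCell (z : Fin d → ℤ) : IsOpen (G.openCell z) := by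
  rw [openCell_eq_preimage]
  exact (isOpen_set_pi Set.finite_univ fun s _ => isOpen_Ioo).preimage (PiLp.continuous_ofLp 2 _)

theorem volume_openCell (z : Fin d → ℤ) : volume (G.openCell z) = ENNReal.ofReal (G.H ^ d) := by
  rw [openCell_eq_preimage, (PiLp.volume_preserving_ofLp (Fin d)).measure_preimage
    (MeasurableSet.univ_pi fun s => measurableSet_Ioo).nullMeasurableSet, Real.volume_pi_Ioo]
  simp [ENNReal.ofReal_pow G.H_pos.le]

theorem openCell_subset_cell (z : Fin d → ℤ) : G.openCell z ⊆ G.cell z :=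
  fun _ hx s => ⟨(hx s).1.le, (hx s).2.le⟩

/-- The midpoint of a cube. -/
def center (z : Fin d → ℤ) : RSpace d := WithLp.toLp 2 (fun s => G.point z s + G.H / 2)

theorem center_mem (z : Fin d → ℤ) : G.center z ∈ G.openCell z := by
  intro s
  have := G.H_pos
  simp only [center]
  constructor <;> linarith

/-- Moving from any point of the cube towards its midpoint enters the open cube at once. -/
theorem cell_subset_closure (z : Fin d → ℤ) : G.cell z ⊆ closure (G.openCell z) := by
  intro x hx
  have hlim : Filter.Tendsto (fun t : ℝ => x + t • (G.center z - x)) (nhdsWithin 0 (Set.Ioo 0 1))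
      (nhds x) := by
    have : Continuous fun t : ℝ => x + t • (G.center z - x) := by fun_prop
    have h := this.tendsto 0
    simp only [zero_smul, add_zero] at h
    exact h.mono_left nhdsWithin_le_nhds
  have hne : (nhdsWithin (0 : ℝ) (Set.Ioo 0 1)).NeBot := by
    rw [← mem_closure_iff_nhdsWithin_neBot, closure_Ioo (by norm_num)]
    simp
  refine mem_closure_of_tendsto hlim ?_
  filter_upwards [self_mem_nhdsWithin] with t ht s
  have hH := G.H_pos
  have h1 := hx s
  have hc : (x + t • (G.center z - x)) s = x s + t * (G.point z s + G.H / 2 - x s) := by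
    simp [center]
  rw [hc]
  obtain ⟨h0, h1'⟩ := ht
  constructor <;> nlinarith [mul_pos h0 hH]

/-- In each coordinate the two lattice indices differ by less than one. This makes distinct open
cubes disjoint and lets a point of an open cube identify the unique closed cube containing it. -/
theorem eq_of_mem_openCell_of_mem_cell {z z' : Fin d → ℤ} {x : RSpace d} (hx : x ∈ G.openCell z)
    (hx' : x ∈ G.cell z') : z = z' := by
  funext s
  have hH := G.H_pos
  have h1 := hx s
  have h2 := hx' s
  rw [point_apply] at h1 h2
  have e1 : G.H * (z s : ℝ) < G.H * ((z' s : ℝ) + 1) := by linarith [h1.1, h2.2]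
  have e2 : G.H * (z' s : ℝ) < G.H * ((z s : ℝ) + 1) := by linarith [h1.2, h2.1]
  have e1' := lt_of_mul_lt_mul_left e1 hH.le
  have e2' := lt_of_mul_lt_mul_left e2 hH.le
  have e1'' : z s < z' s + 1 := by exact_mod_cast e1'
  have e2'' : z' s < z s + 1 := by exact_mod_cast e2'
  omega

theorem openCell_subset_nbhd {z : Fin d → ℤ} (hz : z ∈ G.cells) {ω : Set (RSpace d)}
    (h : (G.cell z ∩ closure ω).Nonempty) : G.openCell z ⊆ G.nbhd ω := by
  refine interior_maximal ?_ (G.isOpen_openCell z)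
  exact (G.openCell_subset_cell z).trans
    (Set.subset_biUnion_of_mem (u := G.cell) (show z ∈ {z | z ∈ G.cells ∧ _} from ⟨hz, h⟩))

theorem openCell_subset_patch {z k : Fin d → ℤ} (hz : z ∈ G.cells) (hk : G.point k ∈ G.cell z)
    (ℓ : ℕ) : G.openCell z ⊆ G.patch ℓ k := by
  induction ℓ with
  | zero =>
    exact (G.openCell_subset_cell z).trans
      (Set.subset_biUnion_of_mem (u := G.cell) (show z ∈ {z | z ∈ G.cells ∧ _} from ⟨hz, hk⟩))
  | succ n ih =>
    rw [patch, Function.iterate_succ_apply']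
    exact G.openCell_subset_nbhd hz ⟨G.center z, G.openCell_subset_cell z (G.center_mem z),
      subset_closure (ih (G.center_mem z))⟩

theorem nbhd_subset_domain (ω : Set (RSpace d)) : G.nbhd ω ⊆ G.domain :=
  interior_mono (Set.iUnion₂_subset fun _ hz => Set.subset_biUnion_of_mem (u := G.cell) hz.1)

theorem exists_patch_eq_nbhd {ℓ : ℕ} (hℓ : 1 ≤ ℓ) (j : Fin d → ℤ) :
    ∃ ω, G.patch ℓ j = G.nbhd ω := by
  obtain ⟨n, rfl⟩ : ∃ n, ℓ = n + 1 := ⟨ℓ - 1, by omega⟩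
  exact ⟨_, by rw [patch, Function.iterate_succ_apply']⟩

theorem patch_subset_domain {ℓ : ℕ} (hℓ : 1 ≤ ℓ) (j : Fin d → ℤ) : G.patch ℓ j ⊆ G.domain := by
  obtain ⟨ω, h⟩ := G.exists_patch_eq_nbhd hℓ j
  exact h ▸ G.nbhd_subset_domain ω

theorem isOpen_patch {ℓ : ℕ} (hℓ : 1 ≤ ℓ) (j : Fin d → ℤ) : IsOpen (G.patch ℓ j) := by
  obtain ⟨ω, h⟩ := G.exists_patch_eq_nbhd hℓ j
  exact h ▸ isOpen_interior

/-- If the star of `k` meets a patch, then the patch contains a cube with vertex `k`. -/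
theorem exists_openCell_subset_patch {ℓ : ℕ} (hℓ : 1 ≤ ℓ) {k j : Fin d → ℤ}
    (h : (G.star k ∩ G.patch ℓ j).Nonempty) :
    ∃ z ∈ G.cells, G.point k ∈ G.cell z ∧ G.openCell z ⊆ G.patch ℓ j := by
  obtain ⟨ω, hω⟩ := G.exists_patch_eq_nbhd hℓ j
  obtain ⟨x, hxs, hxp⟩ := h
  simp only [star, Set.mem_iUnion, Set.mem_ofPred_eq, exists_prop] at hxs
  obtain ⟨z, ⟨hz, hk⟩, hx⟩ := hxs
  -- The patch is open, so it meets not only the closed cube but also its interior. An interior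
  -- point belongs to no other cube, so this cube is among those whose union defines the patch.
  obtain ⟨y, hyp, hyz⟩ := mem_closure_iff.1 (G.cell_subset_closure z hx) _ (G.isOpen_patch hℓ j) hxp
  rw [hω] at hyp ⊢
  have := interior_subset hyp
  simp only [Set.mem_iUnion, Set.mem_ofPred_eq, exists_prop] at this
  obtain ⟨z', ⟨hz', hne⟩, hy'⟩ := this
  obtain rfl := G.eq_of_mem_openCell_of_mem_cell hyz hy'
  exact ⟨z, hz, hk, G.openCell_subset_nbhd hz hne⟩

/-- The closed box of radius `r` around the vertex `j`. -/
def box (r : ℝ) (j : Fin d → ℤ) : Set (RSpace d) := {x | ∀ s, |x s - G.point j s| ≤ r}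

theorem isClosed_box (r : ℝ) (j : Fin d → ℤ) : IsClosed (G.box r j) := by
  simp only [box, Set.ofPred_forall]
  exact isClosed_iInter fun s => isClosed_le (by fun_prop) continuous_const

theorem abs_sub_le_of_mem_cell {z : Fin d → ℤ} {x y : RSpace d} (hx : x ∈ G.cell z)
    (hy : y ∈ G.cell z) (s : Fin d) : |x s - y s| ≤ G.H := by
  have h1 := hx s
  have h2 := hy s
  rw [abs_le]
  constructor <;> linarith [h1.1, h1.2, h2.1, h2.2]

theorem star_subset_box (j : Fin d → ℤ) : G.star j ⊆ G.box G.H j :=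
  Set.iUnion₂_subset fun _ hz _ hx s => G.abs_sub_le_of_mem_cell hx hz.2 s

theorem nbhd_subset_box {r : ℝ} {j : Fin d → ℤ} {ω : Set (RSpace d)} (h : ω ⊆ G.box r j) :
    G.nbhd ω ⊆ G.box (r + G.H) j := by
  refine interior_subset.trans (Set.iUnion₂_subset fun z hz x hx s => ?_)
  obtain ⟨y, hyz, hy⟩ := hz.2
  have h1 := closure_minimal h (G.isClosed_box r j) hy s
  have h2 := G.abs_sub_le_of_mem_cell hx hyz s
  calc |x s - G.point j s| ≤ |x s - y s| + |y s - G.point j s| := abs_sub_le _ _ _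
    _ ≤ r + G.H := by linarith

theorem patch_subset_box (ℓ : ℕ) (j : Fin d → ℤ) :
    G.patch ℓ j ⊆ G.box (((ℓ : ℝ) + 1) * G.H) j := by
  induction ℓ with
  | zero => simpa [patch] using G.star_subset_box j
  | succ n ih =>
    rw [patch, Function.iterate_succ_apply']
    convert! G.nbhd_subset_box ih using 1
    push_cast
    ring_nf

/-- A cube with vertex `k` lies in the patch, and its midpoint is within `(ℓ + 1) H` of the vertex
`j`. Going to the vertex `k` costs another `H / 2`, so the integer distance is below `ℓ + 2`. This
is the origin of all factors `(2ℓ + 3) ^ d`. -/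
theorem abs_sub_le_of_star_inter_patch {ℓ : ℕ} (hℓ : 1 ≤ ℓ) {k j : Fin d → ℤ}
    (h : (G.star k ∩ G.patch ℓ j).Nonempty) (s : Fin d) : |k s - j s| ≤ (ℓ : ℤ) + 1 := by
  obtain ⟨z, -, hk, hz⟩ := G.exists_openCell_subset_patch hℓ h
  have hH := G.H_pos
  have h1 := abs_le.1 (G.patch_subset_box ℓ j (hz (G.center_mem z)) s)
  have h2 := hk s
  simp only [center, point_apply] at h1 h2
  have e1 : G.H * (k s : ℝ) < G.H * (j s + (ℓ : ℝ) + 2) := by linarith [h1.2, h2.2]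
  have e2 : G.H * (j s : ℝ) < G.H * (k s + (ℓ : ℝ) + 2) := by linarith [h1.1, h2.1]
  have e1' : k s < j s + ℓ + 2 := by exact_mod_cast lt_of_mul_lt_mul_left e1 hH.le
  have e2' : j s < k s + ℓ + 2 := by exact_mod_cast lt_of_mul_lt_mul_left e2 hH.le
  rw [abs_le]
  omega

theorem point_mem_cell_iff {k z : Fin d → ℤ} : G.point k ∈ G.cell z ↔ k ∈ Finset.Icc z (z + 1) := by
  have hH := G.H_pos
  simp only [cell, Set.mem_ofPred_eq, Finset.mem_Icc, Pi.le_def, ← forall_and, point_apply]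
  refine forall_congr' fun s => and_congr ?_ ?_
  · rw [add_le_add_iff_left, mul_le_mul_iff_right₀ hH, Int.cast_le]
  · rw [add_assoc, add_le_add_iff_left, ← mul_add_one, mul_le_mul_iff_right₀ hH]
    simp only [Pi.add_apply, Pi.one_apply]
    exact_mod_cast Iff.rfl

theorem exists_cell_of_mem_vertices {k : Fin d → ℤ} (hk : k ∈ G.vertices) :
    ∃ z ∈ G.cells, G.point k ∈ G.cell z := by
  simp only [vertices, Finset.mem_biUnion] at hk
  obtain ⟨z, hz, h⟩ := hk
  exact ⟨z, hz, G.point_mem_cell_iff.2 h⟩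

theorem card_Icc_add_one (z : Fin d → ℤ) : (Finset.Icc z (z + 1)).card = 2 ^ d := by
  rw [Pi.card_Icc]
  simp [add_assoc, add_sub_cancel_left]

theorem card_vertices_le : G.vertices.card ≤ 2 ^ d * G.cells.card := by
  refine Finset.card_biUnion_le.trans ?_
  simp [card_Icc_add_one, mul_comm]

/-- The open cubes are disjoint subsets of the domain, each of volume `H ^ d`. -/
theorem card_cells_mul_le_volume :
    (G.cells.card : ENNReal) * ENNReal.ofReal (G.H ^ d) ≤ volume G.domain := by
  have hdisj : Set.PairwiseDisjoint (G.cells : Set (Fin d → ℤ)) G.openCell := by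
    intro z _ z' _ hne
    refine Set.disjoint_left.2 fun x hx hx' => hne ?_
    exact G.eq_of_mem_openCell_of_mem_cell hx (G.openCell_subset_cell _ hx')
  have h := measure_biUnion_finset (μ := volume) hdisj
    (fun z _ => (G.isOpen_openCell z).measurableSet)
  simp only [volume_openCell, Finset.sum_const, nsmul_eq_mul] at h
  rw [← h]
  refine measure_mono (interior_maximal ?_ (isOpen_biUnion fun z _ => G.isOpen_openCell z))
  exact Set.iUnion₂_mono fun z _ => G.openCell_subset_cell z

theorem isBounded_cell (z : Fin d → ℤ) : Bornology.IsBounded (G.cell z) := by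
  rw [cell_eq_preimage]
  exact (PiLp.antilipschitzWith_ofLp 2 _).isBounded_preimage
    (Bornology.IsBounded.pi fun s => Metric.isBounded_Icc _ _)

theorem volume_domain_lt_top : volume G.domain < ⊤ := by
  refine Bornology.IsBounded.measure_lt_top ?_
  refine Bornology.IsBounded.subset ?_ interior_subset
  exact (Bornology.isBounded_biUnion G.cells.finite_toSet).2 fun z _ => G.isBounded_cell z

/-- At most `2 ^ d` vertices are closer than `H` to a given point, in every coordinate. -/
theorem card_filter_lt_le (F : Finset (Fin d → ℤ)) (x : RSpace d) (P : (Fin d → ℤ) → Prop)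
    [DecidablePred P] (hP : ∀ k, P k → ∀ s, |x s - G.point k s| < G.H) :
    (F.filter P).card ≤ 2 ^ d := by
  -- Every such vertex has each coordinate equal to this floor or to its successor.
  obtain ⟨f, hf⟩ : ∃ f : Fin d → ℤ, ∀ s, f s = ⌊(x s - G.origin s) / G.H⌋ := ⟨_, fun _ => rfl⟩
  rw [← card_Icc_add_one f]
  refine Finset.card_le_card fun k hk => ?_
  have hk := hP k (Finset.mem_filter.1 hk).2
  have hH := G.H_pos
  have key : ∀ s, f s ≤ k s ∧ k s ≤ f s + 1 := fun s => by
    have h := abs_lt.1 (hk s)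
    rw [point_apply] at h
    have h1 : (x s - G.origin s) / G.H < k s + 1 := by
      rw [div_lt_iff₀ hH]; linarith [h.2]
    have h2 : (k s : ℝ) - 1 < (x s - G.origin s) / G.H := by
      rw [lt_div_iff₀ hH]; linarith [h.1]
    have h3 := Int.floor_le ((x s - G.origin s) / G.H)
    have h4 := Int.lt_floor_add_one ((x s - G.origin s) / G.H)
    rw [← hf] at h3 h4
    have e1 : f s < k s + 1 := by
      have : (f s : ℝ) < (k s : ℝ) + 1 := h3.trans_lt h1
      exact_mod_cast this
    have e2 : k s < f s + 2 := by
      have : (k s : ℝ) < (f s : ℝ) + 2 := by linarith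
      exact_mod_cast this
    omega
  exact Finset.mem_Icc.2 ⟨fun s => (key s).1, fun s => (key s).2⟩

theorem abs_sub_lt_of_mem_openCell {z k : Fin d → ℤ} {x : RSpace d} (hx : x ∈ G.openCell z)
    (hk : G.point k ∈ G.cell z) (s : Fin d) : |x s - G.point k s| < G.H := by
  have h1 := hx s
  have hH := G.H_pos
  have h2 := Finset.mem_Icc.1 (G.point_mem_cell_iff.1 hk)
  have h3 : k s = z s ∨ k s = z s + 1 := by
    have h4 : z s ≤ k s := h2.1 s
    have h5 : k s ≤ z s + 1 := h2.2 s
    omega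
  rw [point_apply] at h1
  rw [point_apply, abs_lt]
  rcases h3 with h | h <;> rw [h] <;> push_cast <;> constructor <;> linarith [h1.1, h1.2]

/-- A vertex that is closer than `H` to a point of an open cube is a vertex of that cube. -/
theorem point_mem_cell_of_abs_sub_lt {z k : Fin d → ℤ} {x : RSpace d} (hx : x ∈ G.openCell z)
    (hk : ∀ s, |x s - G.point k s| < G.H) : G.point k ∈ G.cell z := by
  have hH := G.H_pos
  rw [point_mem_cell_iff, Finset.mem_Icc]
  have key : ∀ s, z s ≤ k s ∧ k s ≤ z s + 1 := fun s => by
    have h1 := hx s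
    have h := abs_lt.1 (hk s)
    rw [point_apply] at h h1
    have e1 : G.H * (z s : ℝ) < G.H * (k s + 1) := by linarith [h.2]
    have e2 : G.H * (k s : ℝ) < G.H * (z s + 2) := by linarith [h.1]
    have e1' : z s < k s + 1 := by exact_mod_cast lt_of_mul_lt_mul_left e1 hH.le
    have e2' : k s < z s + 2 := by exact_mod_cast lt_of_mul_lt_mul_left e2 hH.le
    omega
  exact ⟨fun s => (key s).1, fun s => (key s).2⟩

end CubeMesh

/-! ### Square integrable functions and fields -/

/-- The space of square integrable vector fields on `ℝ^d`. -/
abbrev L2Field (d : ℕ) : Type := Lp (RSpace d) 2 (volume : Measure (RSpace d))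

theorem norm_sq_eq_integral {α F : Type*} [MeasurableSpace α] {μ : Measure α}
    [NormedAddCommGroup F] [InnerProductSpace ℝ F] (f : Lp F 2 μ) :
    ‖f‖ ^ 2 = ∫ x, ‖f x‖ ^ 2 ∂μ := by
  rw [← real_inner_self_eq_norm_sq, L2.inner_def]
  simp

theorem integrable_norm_sq {α F : Type*} [MeasurableSpace α] {μ : Measure α}
    [NormedAddCommGroup F] [InnerProductSpace ℝ F] (f : Lp F 2 μ) :
    Integrable (fun x => ‖f x‖ ^ 2) μ := by
  simpa using L2.integrable_inner (𝕜 := ℝ) f f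

theorem integrable_norm_mul_norm {α F F' : Type*} [MeasurableSpace α] {μ : Measure α}
    [NormedAddCommGroup F] [NormedAddCommGroup F'] (f : Lp F 2 μ) (g : Lp F' 2 μ) :
    Integrable (fun x => ‖f x‖ * ‖g x‖) μ :=
  MemLp.integrable_mul (Lp.memLp f).norm (Lp.memLp g).norm

/-! ### The bilinear form -/

/-- Cauchy–Schwarz for the semidefinite form of `A`. Symmetry is what turns the bound on the
quadratic form into a bound on the bilinear one with the same constant. -/
theorem abs_mulVec_dotProduct_le {d : ℕ} {A : Matrix (Fin d) (Fin d) ℝ} {Θ : ℝ} (hs : A.IsSymm)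
    (hl : ∀ z : Fin d → ℝ, 0 ≤ z ⬝ᵥ (A *ᵥ z)) (hu : ∀ z : Fin d → ℝ, z ⬝ᵥ (A *ᵥ z) ≤ Θ * (z ⬝ᵥ z))
    (hΘ : 0 ≤ Θ) (z w : RSpace d) : |(A *ᵥ z.ofLp) ⬝ᵥ w.ofLp| ≤ Θ * (‖z‖ * ‖w‖) := by
  have hsq : ∀ y : RSpace d, y.ofLp ⬝ᵥ y.ofLp = ‖y‖ ^ 2 := fun y => by
    rw [EuclideanSpace.real_norm_sq_eq]; simp [dotProduct, sq]
  have h := LinearMap.BilinForm.apply_sq_le_of_symm (Matrix.toBilin' A)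
    (fun x => by rw [Matrix.toBilin'_apply']; exact hl x)
    ⟨fun x y => by
      simp only [Matrix.toBilin'_apply', RingHom.id_apply]
      rw [Matrix.dotProduct_mulVec, ← Matrix.mulVec_transpose, hs.eq, dotProduct_comm]⟩ w.ofLp z.ofLp
  simp only [Matrix.toBilin'_apply'] at h
  rw [dotProduct_comm]
  refine abs_le_of_sq_le_sq ?_ (mul_nonneg hΘ (by positivity))
  calc _ ≤ _ := h
    _ ≤ (Θ * ‖w‖ ^ 2) * (Θ * ‖z‖ ^ 2) := by
      have h1 := hu w.ofLp
      have h2 := hu z.ofLp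
      rw [hsq] at h1 h2
      exact mul_le_mul h1 h2 (hl _) (by positivity)
    _ = _ := by ring

namespace UniformlyElliptic

variable {d : ℕ} {D : Set (RSpace d)} {A : RSpace d → Matrix (Fin d) (Fin d) ℝ} {θ Θ : ℝ}

theorem upper_pos (hA : UniformlyElliptic D A θ Θ) : 0 < Θ := hA.pos.trans_le hA.le

theorem ae_bound (hA : UniformlyElliptic D A θ Θ) : ∀ᵐ x ∂(volume.restrict D), ∀ z w : RSpace d,
    |(A x *ᵥ z.ofLp) ⬝ᵥ w.ofLp| ≤ Θ * (‖z‖ * ‖w‖) := by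
  filter_upwards [hA.symm, hA.lower, hA.upper] with x h1 h2 h3
  refine abs_mulVec_dotProduct_le h1 (fun z => (mul_nonneg hA.pos.le ?_).trans (h2 z)) h3
    hA.upper_pos.le
  exact Finset.sum_nonneg fun s _ => mul_self_nonneg _

theorem integrable (hA : UniformlyElliptic D A θ Θ) (g h : L2Field d) :
    Integrable (fun x => (A x *ᵥ (g x).ofLp) ⬝ᵥ (h x).ofLp) (volume.restrict D) := by
  have hcoord : ∀ (g : L2Field d) (s : Fin d),
      AEMeasurable (fun x => (g x) s) (volume.restrict D) := fun g s => by
    have h1 : AEMeasurable g (volume.restrict D) :=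
      (Lp.aestronglyMeasurable g).aemeasurable.mono_measure Measure.restrict_le_self
    exact (by fun_prop : Continuous fun y : RSpace d => y s).measurable.comp_aemeasurable h1
  refine Integrable.mono' (((integrable_norm_mul_norm g h).const_mul Θ).restrict) ?_ ?_
  · refine AEMeasurable.aestronglyMeasurable ?_
    simp only [dotProduct, Matrix.mulVec]
    refine Finset.aemeasurable_fun_sum _ fun s _ => AEMeasurable.mul ?_ (hcoord h s)
    exact Finset.aemeasurable_fun_sum _ fun t _ => (hA.aemeasurable s t).mul (hcoord g t)
  · filter_upwards [hA.ae_bound] with x hx using hx _ _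

theorem energyForm_add_left (hA : UniformlyElliptic D A θ Θ) (g g' h : L2Field d) :
    energyForm D A (g + g' : L2Field d) h = energyForm D A g h + energyForm D A g' h := by
  rw [energyForm, energyForm, energyForm, ← integral_add (hA.integrable _ _) (hA.integrable _ _)]
  refine integral_congr_ae (ae_restrict_of_ae ?_)
  filter_upwards [Lp.coeFn_add g g'] with x hx
  rw [hx, Pi.add_apply, WithLp.ofLp_add, Matrix.mulVec_add, add_dotProduct]

theorem energyForm_smul_left (c : ℝ) (g h : L2Field d) :
    energyForm D A (c • g : L2Field d) h = c * energyForm D A g h := by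
  rw [energyForm, energyForm, ← integral_const_mul]
  refine integral_congr_ae (ae_restrict_of_ae ?_)
  filter_upwards [Lp.coeFn_smul c g] with x hx
  simp [hx, Matrix.mulVec_smul, smul_dotProduct]

theorem energyForm_comm (hA : UniformlyElliptic D A θ Θ) (g h : RSpace d → RSpace d) :
    energyForm D A g h = energyForm D A h g := by
  refine integral_congr_ae ?_
  filter_upwards [hA.symm] with x hx
  rw [dotProduct_comm, Matrix.dotProduct_mulVec, ← Matrix.mulVec_transpose, hx.eq]

/-- The energy form as a bounded bilinear form on square integrable vector fields. -/
theorem exists_energyCLM (hA : UniformlyElliptic D A θ Θ) :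
    ∃ B : L2Field d →L[ℝ] L2Field d →L[ℝ] ℝ, ∀ g h, B g h = energyForm D A g h := by
  refine ⟨LinearMap.mkContinuous₂ (LinearMap.mk₂ ℝ (fun g h : L2Field d => energyForm D A g h)
    hA.energyForm_add_left energyForm_smul_left
    (fun g h h' => ?_) (fun c g h => ?_)) (Θ * 1) ?_, fun g h => rfl⟩
  · rw [hA.energyForm_comm, hA.energyForm_add_left, hA.energyForm_comm, hA.energyForm_comm h']
  · rw [hA.energyForm_comm, energyForm_smul_left, hA.energyForm_comm, smul_eq_mul]
  · intro g h
    have hΘ := hA.upper_pos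
    simp only [LinearMap.mk₂_apply, energyForm, mul_one]
    calc ‖∫ x in D, (A x *ᵥ (g x).ofLp) ⬝ᵥ (h x).ofLp‖
        ≤ ∫ x in D, Θ * (‖g x‖ * ‖h x‖) := norm_integral_le_of_norm_le
          ((integrable_norm_mul_norm g h).const_mul Θ).restrict (by
            filter_upwards [hA.ae_bound] with x hx using hx _ _)
      _ ≤ ∫ x, Θ * (‖g x‖ * ‖h x‖) := setIntegral_le_integral
          ((integrable_norm_mul_norm g h).const_mul Θ) (ae_of_all _ fun x => by positivity)
      _ = Θ * ∫ x, ‖g x‖ * ‖h x‖ := integral_const_mul _ _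
      _ ≤ Θ * (‖g‖ * ‖h‖) := by
        refine mul_le_mul_of_nonneg_left ?_ hΘ.le
        have hh := integral_mul_le_Lp_mul_Lq_of_nonneg (μ := (volume : Measure (RSpace d)))
          Real.HolderConjugate.two_two (f := fun x => ‖g x‖) (g := fun x => ‖h x‖)
          (ae_of_all _ fun x => norm_nonneg _) (ae_of_all _ fun x => norm_nonneg _)
          (by simpa using (Lp.memLp g).norm) (by simpa using (Lp.memLp h).norm)
        refine hh.trans_eq ?_
        simp only [Real.rpow_two, ← norm_sq_eq_integral, ← Real.sqrt_eq_rpow]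
        rw [Real.sqrt_sq (norm_nonneg _), Real.sqrt_sq (norm_nonneg _)]
      _ = Θ * ‖g‖ * ‖h‖ := by ring

theorem energyForm_self_nonneg (hA : UniformlyElliptic D A θ Θ) (g : RSpace d → RSpace d) :
    0 ≤ energyForm D A g g := by
  refine integral_nonneg_of_ae ?_
  filter_upwards [hA.lower] with x hx
  rw [dotProduct_comm]
  exact (mul_nonneg hA.pos.le (Finset.sum_nonneg fun s _ => mul_self_nonneg _)).trans (hx _)

/-- On fields over all of `ℝ^d` the form ignores what happens off `D` and is only semidefinite, so
the semidefinite Cauchy–Schwarz inequality is used. -/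
theorem energyForm_sq_le (hA : UniformlyElliptic D A θ Θ) (g h : L2Field d) :
    energyForm D A g h ^ 2 ≤ energyForm D A g g * energyForm D A h h := by
  obtain ⟨B, hB⟩ := hA.exists_energyCLM
  have := LinearMap.BilinForm.apply_sq_le_of_symm
    (LinearMap.mk₂ ℝ (fun g h => B g h) (by simp) (by simp) (by simp) (by simp))
    (fun g => by simpa [hB] using hA.energyForm_self_nonneg g)
    ⟨fun g h => by simpa [hB] using hA.energyForm_comm _ _⟩ g h
  simpa [hB] using this

theorem energyForm_self_le (hA : UniformlyElliptic D A θ Θ) (g : L2Field d) :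
    energyForm D A g g ≤ Θ * ‖g‖ ^ 2 := by
  have hΘ := hA.upper_pos
  rw [norm_sq_eq_integral, ← integral_const_mul]
  calc energyForm D A g g ≤ ∫ x in D, Θ * ‖g x‖ ^ 2 :=
        integral_mono_ae (hA.integrable g g) ((integrable_norm_sq g).const_mul Θ).restrict (by
          filter_upwards [hA.ae_bound] with x hx
          exact (le_abs_self _).trans ((hx _ _).trans_eq (by ring)))
    _ ≤ _ := setIntegral_le_integral ((integrable_norm_sq g).const_mul Θ)
        (ae_of_all _ fun x => by positivity)

/-- Vanishing off `D` is needed because the norm is taken over the whole space while the form sees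
only `D`. -/
theorem le_energyForm_self (hA : UniformlyElliptic D A θ Θ) (g : L2Field d)
    (hg : ∀ᵐ x, x ∉ D → g x = 0) : θ * ‖g‖ ^ 2 ≤ energyForm D A g g := by
  rw [norm_sq_eq_integral, ← integral_const_mul]
  have : ∫ x, θ * ‖g x‖ ^ 2 = ∫ x in D, θ * ‖g x‖ ^ 2 := by
    symm
    refine setIntegral_eq_integral_of_ae_compl_eq_zero ?_
    filter_upwards [hg] with x hx hxD
    simp [hx hxD]
  rw [this]
  refine integral_mono_ae ((integrable_norm_sq g).const_mul θ).restrict (hA.integrable g g) ?_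
  filter_upwards [hA.lower] with x hx
  have := hx (g x).ofLp
  rw [dotProduct_comm (A x *ᵥ _)]
  refine le_trans (le_of_eq ?_) this
  rw [EuclideanSpace.real_norm_sq_eq]
  simp [dotProduct, sq]

end UniformlyElliptic

theorem energyForm_congr {d : ℕ} {D : Set (RSpace d)} {A : RSpace d → Matrix (Fin d) (Fin d) ℝ}
    {g g' h h' : RSpace d → RSpace d} (hg : g =ᵐ[volume] g') (hh : h =ᵐ[volume] h') :
    energyForm D A g h = energyForm D A g' h' := by
  refine integral_congr_ae (ae_restrict_of_ae ?_)
  filter_upwards [hg, hh] with x h1 h2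
  rw [h1, h2]

/-! ### The space `H¹₀` -/

section H10

variable {d : ℕ} {ω : Set (RSpace d)}

theorem gradient_fun_add {φ ψ : RSpace d → ℝ} {x : RSpace d} (hφ : DifferentiableAt ℝ φ x)
    (hψ : DifferentiableAt ℝ ψ x) :
    gradient (fun y => φ y + ψ y) x = gradient φ x + gradient ψ x := by
  simp only [gradient, ← map_add]
  congr 1
  exact fderiv_add hφ hψ

theorem gradient_fun_const_mul {φ : RSpace d → ℝ} {x : RSpace d} (hφ : DifferentiableAt ℝ φ x)
    (c : ℝ) : gradient (fun y => c * φ y) x = c • gradient φ x := by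
  rw [gradient, gradient, fderiv_const_mul hφ c]
  simp

/-- The test pairs are already a linear space, so `H10` is their closure and closed conditions need
only be checked on smooth functions. -/
theorem span_testPairs_subset : (Submodule.span ℝ (testPairs ω) : Set (L2Pair d)) ⊆ testPairs ω := by
  intro p hp
  induction hp using Submodule.span_induction with
  | mem p hp => exact hp
  | zero =>
    refine ⟨fun _ => 0, contDiff_const, HasCompactSupport.zero, ?_, ?_, ?_⟩
    · simp [tsupport, Function.support]
    · exact Lp.coeFn_zero ..
    · rw [gradient_fun_const']
      exact Lp.coeFn_zero ..
  | add p q _ _ hp hq =>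
    obtain ⟨φ, h1, h2, h3, h4, h5⟩ := hp
    obtain ⟨ψ, k1, k2, k3, k4, k5⟩ := hq
    refine ⟨fun x => φ x + ψ x, h1.add k1, h2.add k2,
      (tsupport_add φ ψ).trans (Set.union_subset h3 k3), ?_, ?_⟩
    · filter_upwards [Lp.coeFn_add p.fst q.fst, h4, k4] with x e1 e2 e3
      rw [WithLp.add_fst, e1, Pi.add_apply, e2, e3]
    · filter_upwards [Lp.coeFn_add p.snd q.snd, h5, k5] with x e1 e2 e3
      rw [WithLp.add_snd, e1, Pi.add_apply, e2, e3, gradient_fun_add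
        (h1.differentiable (by simp) x) (k1.differentiable (by simp) x)]
  | smul c p _ hp =>
    obtain ⟨φ, h1, h2, h3, h4, h5⟩ := hp
    refine ⟨fun x => c * φ x, contDiff_const.mul h1, h2.mul_left,
      (closure_mono (Function.support_const_smul_subset c φ)).trans h3, ?_, ?_⟩
    · filter_upwards [Lp.coeFn_smul c p.fst, h4] with x e1 e2
      rw [WithLp.smul_fst, e1, Pi.smul_apply, e2, smul_eq_mul]
    · filter_upwards [Lp.coeFn_smul c p.snd, h5] with x e1 e2
      rw [WithLp.smul_snd, e1, Pi.smul_apply, e2, gradient_fun_const_mul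
        (h1.differentiable (by simp) x)]

/-- A closed condition that holds for the test functions holds on all of `H¹₀`. -/
theorem H10_induction {P : L2Pair d → Prop} (hc : IsClosed {p | P p})
    (h : ∀ p ∈ testPairs ω, P p) {p : L2Pair d} (hp : p ∈ H10 ω) : P p :=
  closure_minimal (span_testPairs_subset.trans h) hc hp

theorem testPairs_subset_H10 : testPairs ω ⊆ H10 ω :=
  Submodule.subset_span.trans (Submodule.le_topologicalClosure _)

theorem continuous_L2Pair_fst : Continuous fun p : L2Pair d => p.fst :=
  (WithLp.fstL 2 ℝ _ _).continuous

theorem continuous_L2Pair_snd : Continuous fun p : L2Pair d => p.snd :=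
  (WithLp.sndL 2 ℝ _ _).continuous

theorem gradient_eq_zero_of_notMem_tsupport {φ : RSpace d → ℝ} {x : RSpace d}
    (hx : x ∉ tsupport φ) : gradient φ x = 0 := by
  have := fderiv_of_notMem_tsupport (𝕜 := ℝ) hx
  simp [gradient, this]

theorem norm_gradient {φ : RSpace d → ℝ} {x : RSpace d} : ‖gradient φ x‖ = ‖fderiv ℝ φ x‖ := by
  simp [gradient]

theorem continuous_gradient {φ : RSpace d → ℝ} (hφ : ContDiff ℝ (⊤ : ℕ∞) φ) :
    Continuous (gradient φ) :=
  (LinearIsometryEquiv.continuous _).comp (hφ.continuous_fderiv (by simp))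

theorem hasCompactSupport_gradient {φ : RSpace d → ℝ} (hφ : HasCompactSupport φ) :
    HasCompactSupport (gradient φ) :=
  hφ.mono' fun x hx => by
    by_contra h
    exact hx (gradient_eq_zero_of_notMem_tsupport h)

/-- The Friedrichs inequality in a slab, for smooth functions. -/
theorem integral_sq_le_of_tsupport_subset {φ : RSpace d → ℝ} (h1 : ContDiff ℝ (⊤ : ℕ∞) φ)
    (h2 : HasCompactSupport φ) (s : Fin d) (c r : ℝ) (h3 : ∀ x ∈ tsupport φ, |x s - c| ≤ r) :
    ∫ x, φ x ^ 2 ≤ (2 * r) ^ 2 * ∫ x, ‖gradient φ x‖ ^ 2 := by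
  have hd : Differentiable ℝ φ := h1.differentiable (by simp)
  set v : RSpace d := EuclideanSpace.single s 1 with hv
  have hvn : ‖v‖ = 1 := by simp [hv]
  let f : RSpace d → ℝ := fun x => x s - c
  have hf : ∀ x, HasFDerivAt f (EuclideanSpace.proj s : RSpace d →L[ℝ] ℝ) x := fun x =>
    (EuclideanSpace.proj s : RSpace d →L[ℝ] ℝ).hasFDerivAt.sub_const c
  have hfc : Continuous f := by fun_prop
  have hfv : ∀ x, fderiv ℝ f x v = 1 := fun x => by rw [(hf x).fderiv]; simp [hv]
  have hg : ∀ x, fderiv ℝ (fun y => φ y ^ 2) x v = 2 * φ x * fderiv ℝ φ x v := fun x => by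
    rw [((hd x).hasFDerivAt.pow 2).fderiv]; simp
  have hcd : Continuous fun x => fderiv ℝ φ x v :=
    (h1.continuous_fderiv (by simp)).clm_apply continuous_const
  have hsq : HasCompactSupport fun x => φ x ^ 2 := by
    rw [show (fun x => φ x ^ 2) = φ * φ from funext fun x => sq _]
    exact h2.mul_right
  have I1 : Integrable fun x => φ x ^ 2 :=
    (h1.continuous.pow 2).integrable_of_hasCompactSupport hsq
  have I2 : Integrable fun x => f x * (2 * φ x * fderiv ℝ φ x v) := by
    refine Continuous.integrable_of_hasCompactSupport
      (hfc.mul ((continuous_const.mul h1.continuous).mul hcd)) ?_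
    exact (h2.mul_left (f := fun _ => (2 : ℝ))).mul_right.mul_left
  have I3 : Integrable fun x => f x * φ x ^ 2 :=
    (hfc.mul (h1.continuous.pow 2)).integrable_of_hasCompactSupport hsq.mul_left
  have I4 : Integrable fun x => ‖gradient φ x‖ ^ 2 := by
    refine ((continuous_gradient h1).norm.pow 2).integrable_of_hasCompactSupport ?_
    have := (hasCompactSupport_gradient h2).norm
    simpa only [sq] using this.mul_right
  -- Integration by parts against `f = x_s - c`, whose derivative in direction `v` is one: `∫ φ² =
  -- -∫ 2 f φ ∂φ`.
  have key := integral_mul_fderiv_eq_neg_fderiv_mul_of_integrable (μ := volume) (f := f)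
    (g := fun y => φ y ^ 2) (v := v) (by simpa [hfv] using I1) (by simpa only [hg] using I2) I3
    (fun x _ => (hf x).differentiableAt) (fun x _ => (hd x).pow 2)
  simp only [hg, hfv, one_mul] at key
  -- Young's inequality with weight one half on `φ²`, so that this half can be absorbed on the left.
  -- What remains is the factor `4 r²`.
  have hle : ∫ x, -(f x * (2 * φ x * fderiv ℝ φ x v)) ≤
      ∫ x, (1 / 2 * φ x ^ 2 + 2 * r ^ 2 * ‖gradient φ x‖ ^ 2) := by
    refine integral_mono I2.neg ((I1.const_mul _).add (I4.const_mul _)) fun x => ?_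
    by_cases hx : x ∈ tsupport φ
    · have h4 : |fderiv ℝ φ x v| ≤ ‖gradient φ x‖ := by
        rw [norm_gradient]
        simpa [hvn] using (fderiv ℝ φ x).le_opNorm v
      have h5 : |f x| ≤ r := h3 x hx
      have h6 : |f x * fderiv ℝ φ x v| ≤ r * ‖gradient φ x‖ := by
        rw [abs_mul]
        exact mul_le_mul h5 h4 (abs_nonneg _) ((abs_nonneg _).trans h5)
      have h7 : (f x * fderiv ℝ φ x v) ^ 2 ≤ (r * ‖gradient φ x‖) ^ 2 := by
        rw [← sq_abs (f x * _)]
        exact pow_le_pow_left₀ (abs_nonneg _) h6 2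
      simp only
      nlinarith [sq_nonneg (φ x + 2 * (f x * fderiv ℝ φ x v))]
    · simp only [image_eq_zero_of_notMem_tsupport hx]
      simp only [mul_zero, zero_mul, neg_zero]
      positivity
  rw [integral_neg, key, neg_neg, integral_add (I1.const_mul _) (I4.const_mul _),
    integral_const_mul, integral_const_mul] at hle
  linarith

theorem norm_fst_sq_le_of_mem_H10 (s : Fin d) (c r : ℝ) (hω : ∀ x ∈ ω, |x s - c| ≤ r)
    {p : L2Pair d} (hp : p ∈ H10 ω) : ‖p.fst‖ ^ 2 ≤ (2 * r) ^ 2 * ‖p.snd‖ ^ 2 := by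
  refine H10_induction (P := fun p => ‖p.fst‖ ^ 2 ≤ (2 * r) ^ 2 * ‖p.snd‖ ^ 2) ?_ ?_ hp
  · exact isClosed_le (continuous_L2Pair_fst.norm.pow 2)
      (continuous_const.mul (continuous_L2Pair_snd.norm.pow 2))
  · rintro p ⟨φ, h1, h2, h3, h4, h5⟩
    have e1 : ‖p.fst‖ ^ 2 = ∫ x, φ x ^ 2 := by
      rw [norm_sq_eq_integral]
      refine integral_congr_ae ?_
      filter_upwards [h4] with x hx
      simp [hx]
    have e2 : ‖p.snd‖ ^ 2 = ∫ x, ‖gradient φ x‖ ^ 2 := by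
      rw [norm_sq_eq_integral]
      refine integral_congr_ae ?_
      filter_upwards [h5] with x hx
      simp [hx]
    rw [e1, e2]
    exact integral_sq_le_of_tsupport_subset h1 h2 s c r fun x hx => hω x (h3 hx)

theorem UniformlyElliptic.coercive {D : Set (RSpace d)} {A : RSpace d → Matrix (Fin d) (Fin d) ℝ}
    {θ Θ : ℝ} (hA : UniformlyElliptic D A θ Θ) (hω : ω ⊆ D) {p : L2Pair d} (hp : p ∈ H10 ω) :
    θ * ‖p.snd‖ ^ 2 ≤ energyForm D A p.snd p.snd := by
  obtain ⟨B, hB⟩ := hA.exists_energyCLM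
  rw [← hB]
  refine H10_induction (P := fun p => θ * ‖p.snd‖ ^ 2 ≤ B p.snd p.snd) ?_ ?_ hp
  · exact isClosed_le (continuous_const.mul (continuous_L2Pair_snd.norm.pow 2))
      ((B.continuous.comp continuous_L2Pair_snd).clm_apply continuous_L2Pair_snd)
  · rintro p ⟨φ, h1, h2, h3, h4, h5⟩
    rw [hB]
    refine hA.le_energyForm_self _ ?_
    filter_upwards [h5] with x hx hxD
    rw [hx, gradient_eq_zero_of_notMem_tsupport fun h => hxD (hω (h3 h))]

instance : CompleteSpace (H10 ω) :=
  (Submodule.isClosed_topologicalClosure _).completeSpace_coe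

/-- Unique solvability of the variational problem on `H¹₀`. -/
theorem existsUnique_variational {D : Set (RSpace d)} {A : RSpace d → Matrix (Fin d) (Fin d) ℝ}
    {θ Θ : ℝ} (hA : UniformlyElliptic D A θ Θ) (hωD : ω ⊆ D) (s : Fin d) (c r : ℝ)
    (hω : ∀ x ∈ ω, |x s - c| ≤ r) (F : L2Pair d →L[ℝ] ℝ) :
    ∃! u : L2Pair d, u ∈ H10 ω ∧ ∀ v ∈ H10 ω, energyForm D A v.snd u.snd = F v := by
  obtain ⟨B, hB⟩ := hA.exists_energyCLM
  have hθ := hA.pos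
  let T : H10 ω →L[ℝ] L2Field d := (WithLp.sndL 2 ℝ _ _).comp (H10 ω).subtypeL
  let B' : H10 ω →L[ℝ] H10 ω →L[ℝ] ℝ := B.bilinearComp T T
  have hB' : ∀ u v : H10 ω, B' u v = energyForm D A (u : L2Pair d).snd (v : L2Pair d).snd :=
    fun u v => hB _ _
  have hco : IsCoercive B' := by
    -- By Friedrichs the full `H¹` norm squared is at most `(2r)² + 1` times the gradient norm
    -- squared. Lax–Milgram then applies.
    refine ⟨θ / ((2 * r) ^ 2 + 1), by positivity, fun u => ?_⟩
    have h1 := norm_fst_sq_le_of_mem_H10 s c r hω u.2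
    have h2 := hA.coercive hωD u.2
    have h3 := WithLp.prod_norm_sq_eq_of_L2 (u : L2Pair d)
    rw [hB', mul_assoc, ← sq, div_mul_eq_mul_div, div_le_iff₀ (by positivity)]
    have h4 : ‖u‖ ^ 2 = ‖(u : L2Pair d)‖ ^ 2 := rfl
    rw [h4, h3]
    calc θ * (‖(u : L2Pair d).fst‖ ^ 2 + ‖(u : L2Pair d).snd‖ ^ 2)
        ≤ θ * (((2 * r) ^ 2 + 1) * ‖(u : L2Pair d).snd‖ ^ 2) := by
          refine mul_le_mul_of_nonneg_left ?_ hθ.le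
          linarith
      _ = θ * ‖(u : L2Pair d).snd‖ ^ 2 * ((2 * r) ^ 2 + 1) := by ring
      _ ≤ _ := mul_le_mul_of_nonneg_right h2 (by positivity)
  let f : H10 ω := (InnerProductSpace.toDual ℝ (H10 ω)).symm (F.comp (H10 ω).subtypeL)
  let u : H10 ω := hco.continuousLinearEquivOfBilin.symm f
  have hu : ∀ v : H10 ω, B' u v = F v := fun v => by
    rw [← hco.continuousLinearEquivOfBilin_apply]
    simp only [u, ContinuousLinearEquiv.apply_symm_apply, f,
      InnerProductSpace.toDual_symm_apply]
    rfl
  refine ⟨u, ⟨u.2, fun v hv => ?_⟩, ?_⟩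
  · rw [hA.energyForm_comm, ← hu ⟨v, hv⟩, hB']
  · rintro w ⟨hw, hwF⟩
    have hd : w - u ∈ H10 ω := (H10 ω).sub_mem hw u.2
    have h0 : energyForm D A (w - u).snd (w - u).snd = 0 := by
      have e1 := hwF _ hd
      have e2 := hu ⟨_, hd⟩
      rw [hB', hA.energyForm_comm] at e2
      rw [← hB] at e1 e2 ⊢
      rw [WithLp.sub_snd, map_sub (B _), ← WithLp.sub_snd, e1]
      simp only at e2
      rw [e2, sub_self]
    have h1 := hA.coercive hωD hd
    have h2 := norm_fst_sq_le_of_mem_H10 s c r hω hd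
    have h3 : ‖(w - u).snd‖ ^ 2 = 0 := le_antisymm (by nlinarith) (sq_nonneg _)
    have h4 := WithLp.prod_norm_sq_eq_of_L2 (w - (u : L2Pair d))
    rw [h3] at h2 h4
    have h5 : ‖w - (u : L2Pair d)‖ ^ 2 = 0 := le_antisymm (by rw [h4]; linarith) (sq_nonneg _)
    exact sub_eq_zero.1 (norm_eq_zero.1 (pow_eq_zero_iff (by norm_num) |>.1 h5))

end H10

/-! ### Tensor products of one-dimensional functions -/

section TensorProduct

variable {d : ℕ}

theorem abs_prod_sub_prod_le {ι : Type*} (S : Finset ι) {f g : ι → ℝ} {B δ : ℝ} (hB : 1 ≤ B)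
    (hδ : 0 ≤ δ) (hf : ∀ s, |f s| ≤ B) (hg : ∀ s, |g s| ≤ B) (hfg : ∀ s, |f s - g s| ≤ δ) :
    |∏ s ∈ S, f s - ∏ s ∈ S, g s| ≤ S.card * B ^ S.card * δ := by
  classical
  induction S using Finset.induction_on with
  | empty => simp
  | insert a S ha ih =>
    rw [Finset.prod_insert ha, Finset.prod_insert ha, Finset.card_insert_of_notMem ha]
    have hgS : |∏ s ∈ S, g s| ≤ B ^ S.card := by
      rw [Finset.abs_prod]
      exact (Finset.prod_le_prod (fun _ _ => abs_nonneg _) fun s _ => hg s).trans_eq (by simp)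
    have e : f a * ∏ s ∈ S, f s - g a * ∏ s ∈ S, g s =
        f a * (∏ s ∈ S, f s - ∏ s ∈ S, g s) + (f a - g a) * ∏ s ∈ S, g s := by ring
    have hB0 : 0 ≤ B := by linarith
    calc _ ≤ |f a| * |∏ s ∈ S, f s - ∏ s ∈ S, g s| + |f a - g a| * |∏ s ∈ S, g s| := by
          rw [e, ← abs_mul, ← abs_mul]; exact abs_add_le _ _
      _ ≤ B * (S.card * B ^ S.card * δ) + δ * B ^ S.card := by
          gcongr
          · exact hf a
          · exact hfg a
      _ ≤ B * (S.card * B ^ S.card * δ) + δ * B ^ (S.card + 1) := by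
          gcongr
          omega
      _ = _ := by push_cast; ring

/-- A Lipschitz constant of the product bounds its derivative at every point. No smoothness of the
factors is required: at the kinks of the hats `fderiv` is either a true derivative or the default
value zero. -/
theorem norm_gradient_prod_le {f : Fin d → ℝ → ℝ} {B K : ℝ} (hB : 1 ≤ B) (hK : 0 ≤ K)
    (hf : ∀ s t, |f s t| ≤ B) (hL : ∀ s t t', |f s t - f s t'| ≤ K * |t - t'|) (x : RSpace d) :
    ‖gradient (fun y : RSpace d => ∏ s, f s (y s)) x‖ ≤ d * B ^ d * K := by
  have hC : 0 ≤ d * B ^ d * K := by positivity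
  rw [norm_gradient]
  have hLip : LipschitzWith (d * B ^ d * K).toNNReal (fun y : RSpace d => ∏ s, f s (y s)) := by
    refine LipschitzWith.of_dist_le_mul fun y y' => ?_
    rw [Real.dist_eq, dist_eq_norm]
    refine (abs_prod_sub_prod_le Finset.univ hB (δ := K * ‖y - y'‖) (by positivity)
      (fun s => hf s _) (fun s => hf s _) fun s => (hL s _ _).trans ?_).trans_eq ?_
    · gcongr
      exact PiLp.norm_apply_le (y - y') s
    · rw [Finset.card_univ, Fintype.card_fin, Real.coe_toNNReal _ hC]
      ring
  simpa only [Real.coe_toNNReal _ hC] using norm_fderiv_le_of_lipschitz ℝ (x₀ := x) hLip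

theorem volume_setOf_forall_mem (T : Fin d → Set ℝ) (hT : ∀ s, MeasurableSet (T s)) :
    volume {x : RSpace d | ∀ s, x s ∈ T s} = ∏ s, volume (T s) := by
  have : {x : RSpace d | ∀ s, x s ∈ T s} = WithLp.ofLp ⁻¹' (Set.univ.pi T) := by ext x; simp
  rw [this, (PiLp.volume_preserving_ofLp (Fin d)).measure_preimage
    (MeasurableSet.univ_pi hT).nullMeasurableSet, volume_pi_pi]

theorem isClosed_setOf_forall_mem (T : Fin d → Set ℝ) (hT : ∀ s, IsClosed (T s)) :
    IsClosed {x : RSpace d | ∀ s, x s ∈ T s} := by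
  rw [Set.ofPred_forall]
  exact isClosed_iInter fun s => (hT s).preimage (by fun_prop)

theorem tsupport_prod_subset {f : Fin d → ℝ → ℝ} {T : Fin d → Set ℝ} (hT : ∀ s, IsClosed (T s))
    (hf : ∀ s t, t ∉ T s → f s t = 0) :
    tsupport (fun y : RSpace d => ∏ s, f s (y s)) ⊆ {x | ∀ s, x s ∈ T s} := by
  refine closure_minimal (fun x hx s => ?_) (isClosed_setOf_forall_mem T hT)
  by_contra h
  exact hx (Finset.prod_eq_zero (Finset.mem_univ s) (hf s _ h))

theorem integral_prod (f : Fin d → ℝ → ℝ) :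
    ∫ x : RSpace d, ∏ s, f s (x s) = ∏ s, ∫ t, f s t := by
  rw [← integral_fintype_prod_volume_eq_prod,
    ← (PiLp.volume_preserving_ofLp (Fin d)).integral_comp
      (MeasurableEquiv.toLp 2 (Fin d → ℝ)).symm.measurableEmbedding]

theorem measurable_gradient (φ : RSpace d → ℝ) : Measurable (gradient φ) :=
  (LinearIsometryEquiv.continuous _).measurable.comp (measurable_fderiv ℝ φ)

/-- A field that is bounded by `C` and vanishes off a set `S` has an `L²` norm controlled by the
volume of `S`. -/
theorem memLp_and_integral_norm_sq_le {g : RSpace d → RSpace d} (hg : Measurable g)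
    {S : Set (RSpace d)} (hS : MeasurableSet S) {C V : ℝ} (hV : 0 ≤ V)
    (hvol : volume S ≤ ENNReal.ofReal V) (hC : ∀ x, ‖g x‖ ≤ C) (h0 : ∀ x ∉ S, g x = 0) :
    MemLp g 2 volume ∧ ∫ x, ‖g x‖ ^ 2 ≤ C ^ 2 * V := by
  have hfin : volume S < ⊤ := hvol.trans_lt ENNReal.ofReal_lt_top
  have hind : Integrable (S.indicator fun _ => C ^ 2) (volume : Measure (RSpace d)) :=
    (integrable_indicator_iff hS).2 (integrableOn_const hfin.ne)
  have hle : ∀ x, ‖g x‖ ^ 2 ≤ S.indicator (fun _ => C ^ 2) x := fun x => by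
    by_cases hx : x ∈ S
    · rw [Set.indicator_of_mem hx]
      exact pow_le_pow_left₀ (norm_nonneg _) (hC x) 2
    · simp [hx, h0 x hx]
  have hint : Integrable (fun x => ‖g x‖ ^ 2) volume :=
    hind.mono' (hg.norm.pow_const 2).aestronglyMeasurable (ae_of_all _ fun x => by
      rw [Real.norm_of_nonneg (by positivity)]; exact hle x)
  refine ⟨(memLp_two_iff_integrable_sq_norm hg.aestronglyMeasurable).2 hint, ?_⟩
  calc ∫ x, ‖g x‖ ^ 2 ≤ ∫ x, S.indicator (fun _ => C ^ 2) x := integral_mono hint hind hle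
    _ = C ^ 2 * (volume S).toReal := by
      rw [integral_indicator hS, setIntegral_const, smul_eq_mul, mul_comm]; rfl
    _ ≤ C ^ 2 * V := by
      gcongr
      exact ENNReal.toReal_le_of_le_ofReal hV hvol

/-- The energy of the gradient of a tensor product of bounded Lipschitz functions. -/
theorem gradient_prod_memLp {f : Fin d → ℝ → ℝ} {B K V : ℝ} (hB : 1 ≤ B) (hK : 0 ≤ K) (hV : 0 ≤ V)
    (hf : ∀ s t, |f s t| ≤ B) (hL : ∀ s t t', |f s t - f s t'| ≤ K * |t - t'|)
    {T : Fin d → Set ℝ} (hT : ∀ s, IsClosed (T s)) (hvol : ∀ s, volume (T s) ≤ ENNReal.ofReal V)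
    (h0 : ∀ s t, t ∉ T s → f s t = 0) :
    MemLp (gradient (fun y : RSpace d => ∏ s, f s (y s))) 2 volume ∧
      ∫ x, ‖gradient (fun y : RSpace d => ∏ s, f s (y s)) x‖ ^ 2 ≤ (d * B ^ d * K) ^ 2 * V ^ d := by
  refine memLp_and_integral_norm_sq_le (measurable_gradient _)
    (isClosed_setOf_forall_mem T hT).measurableSet (by positivity) ?_
    (norm_gradient_prod_le hB hK hf hL)
    fun x hx => gradient_eq_zero_of_notMem_tsupport fun h => hx (tsupport_prod_subset hT h0 h)
  rw [volume_setOf_forall_mem T fun s => (hT s).measurableSet, ENNReal.ofReal_pow hV]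
  exact (Finset.prod_le_pow_card _ _ _ fun s _ => hvol s).trans_eq (by simp)

end TensorProduct

/-! ### The nodal functions and the quantities of interest -/

namespace CubeMesh

variable {d : ℕ} (G : CubeMesh d)

theorem hat1_nonneg (t : ℝ) : 0 ≤ G.hat1 t := le_max_left _ _

theorem hat1_le_one (t : ℝ) : G.hat1 t ≤ 1 := by
  have := G.H_pos
  refine max_le zero_le_one ?_
  have : 0 ≤ |t| / G.H := by positivity
  linarith

theorem hat1_eq_zero {t : ℝ} (h : G.H ≤ |t|) : G.hat1 t = 0 := by
  refine max_eq_left ?_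
  have := (one_le_div G.H_pos).2 h
  linarith

theorem abs_hat1_sub_le (t t' : ℝ) : |G.hat1 t - G.hat1 t'| ≤ 1 / G.H * |t - t'| := by
  have hH := G.H_pos
  rw [hat1, hat1, max_comm, max_comm 0]
  refine (abs_max_sub_max_le_abs _ _ _).trans ?_
  have e : 1 - |t| / G.H - (1 - |t'| / G.H) = (|t'| - |t|) / G.H := by ring
  rw [e, abs_div, abs_of_pos hH, div_eq_inv_mul, one_div]
  rw [abs_sub_comm t t']
  exact mul_le_mul_of_nonneg_left (abs_abs_sub_abs_le _ _) (by positivity)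

theorem continuous_hat1 : Continuous G.hat1 := by unfold hat1; fun_prop

theorem continuous_hat (i : Fin d → ℤ) : Continuous (G.hat i) := by
  unfold hat
  refine continuous_finsetProd _ fun s _ => G.continuous_hat1.comp ?_
  fun_prop

theorem hat_nonneg (i : Fin d → ℤ) (x : RSpace d) : 0 ≤ G.hat i x :=
  Finset.prod_nonneg fun _ _ => G.hat1_nonneg _

theorem hat_le_one (i : Fin d → ℤ) (x : RSpace d) : G.hat i x ≤ 1 :=
  Finset.prod_le_one (fun _ _ => G.hat1_nonneg _) fun _ _ => G.hat1_le_one _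

theorem abs_sub_lt_of_hat_ne_zero {i : Fin d → ℤ} {x : RSpace d} (h : G.hat i x ≠ 0) (s : Fin d) :
    |x s - G.point i s| < G.H := by
  by_contra h'
  exact h (Finset.prod_eq_zero (Finset.mem_univ s) (G.hat1_eq_zero (not_lt.1 h')))

theorem hat1_sub_eq_zero {a t : ℝ} (h : t ∉ Set.Icc (a - G.H) (a + G.H)) :
    G.hat1 (t - a) = 0 := by
  refine G.hat1_eq_zero ?_
  by_contra h'
  rw [not_le, abs_lt] at h'
  exact h ⟨by linarith, by linarith⟩

/-- The bounding box of the support of a nodal function. -/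
def hatBox (i : Fin d → ℤ) : Set (RSpace d) :=
  {x | ∀ s, x s ∈ Set.Icc (G.point i s - G.H) (G.point i s + G.H)}

theorem isClosed_hatBox (i : Fin d → ℤ) : IsClosed (G.hatBox i) :=
  isClosed_setOf_forall_mem _ fun _ => isClosed_Icc

theorem volume_hatBox (i : Fin d → ℤ) : volume (G.hatBox i) = ENNReal.ofReal ((2 * G.H) ^ d) := by
  rw [hatBox, volume_setOf_forall_mem _ fun _ => measurableSet_Icc]
  have hH := G.H_pos
  rw [ENNReal.ofReal_pow (by positivity)]
  simp [Real.volume_Icc, two_mul]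

theorem hat_eq_zero_of_notMem_hatBox {i : Fin d → ℤ} {x : RSpace d} (hx : x ∉ G.hatBox i) :
    G.hat i x = 0 := by
  simp only [hatBox, Set.mem_ofPred_eq, not_forall] at hx
  obtain ⟨s, hs⟩ := hx
  exact Finset.prod_eq_zero (Finset.mem_univ s) (G.hat1_sub_eq_zero hs)

theorem integrable_indicator_hatBox (i : Fin d → ℤ) :
    Integrable ((G.hatBox i).indicator fun _ => (1 : ℝ)) (volume : Measure (RSpace d)) :=
  (integrable_indicator_iff (G.isClosed_hatBox i).measurableSet).2
    (integrableOn_const (by rw [G.volume_hatBox i]; exact ENNReal.ofReal_ne_top))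

theorem hat_le_indicator (i : Fin d → ℤ) (x : RSpace d) :
    G.hat i x ≤ (G.hatBox i).indicator (fun _ => (1 : ℝ)) x := by
  by_cases hx : x ∈ G.hatBox i
  · rw [Set.indicator_of_mem hx]; exact G.hat_le_one i x
  · rw [Set.indicator_of_notMem hx, G.hat_eq_zero_of_notMem_hatBox hx]

theorem integrable_hat (i : Fin d → ℤ) : Integrable (G.hat i) :=
  (G.integrable_indicator_hatBox i).mono' (G.continuous_hat i).aestronglyMeasurable
    (ae_of_all _ fun x => by
      rw [Real.norm_of_nonneg (G.hat_nonneg i x)]; exact G.hat_le_indicator i x)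

theorem memLp_hat (i : Fin d → ℤ) : MemLp (G.hat i) 2 (volume : Measure (RSpace d)) := by
  refine (memLp_two_iff_integrable_sq (G.continuous_hat i).aestronglyMeasurable).2 ?_
  refine (G.integrable_hat i).mono' ((G.continuous_hat i).pow 2).aestronglyMeasurable
    (ae_of_all _ fun x => ?_)
  rw [Real.norm_of_nonneg (by positivity)]
  nlinarith [G.hat_nonneg i x, G.hat_le_one i x]

/-- The weight `(Λ_k, 1)` of a quantity of interest. -/
def weight (ℓ : ℕ) (k : Fin d → ℤ) : ℝ := ∫ x in G.patch ℓ k, G.hat k x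

theorem weight_le (ℓ : ℕ) (k : Fin d → ℤ) : G.weight ℓ k ≤ (2 * G.H) ^ d := by
  have hH := G.H_pos
  calc G.weight ℓ k ≤ ∫ x, G.hat k x :=
        setIntegral_le_integral (G.integrable_hat k) (ae_of_all _ (G.hat_nonneg k))
    _ ≤ ∫ x, (G.hatBox k).indicator (fun _ => (1 : ℝ)) x :=
        integral_mono (G.integrable_hat k) (G.integrable_indicator_hatBox k) (G.hat_le_indicator k)
    _ = (2 * G.H) ^ d := by
      rw [integral_indicator (G.isClosed_hatBox k).measurableSet, setIntegral_const, smul_eq_mul,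
        mul_one, Measure.real, G.volume_hatBox, ENNReal.toReal_ofReal (by positivity)]

/-- On the subcube of side `H / 2` of the cube `z` at the corner `k`, each hat factor is at least
one half. This gives `(1/2) ^ d * (H/2) ^ d`. -/
theorem le_weight {ℓ : ℕ} {k z : Fin d → ℤ} (hz : z ∈ G.cells)
    (hk : G.point k ∈ G.cell z) : (G.H / 4) ^ d ≤ G.weight ℓ k := by
  have hH := G.H_pos
  let a : Fin d → ℝ := fun s => G.point z s + G.H / 2 * ((k s : ℝ) - z s)
  let S : Set (RSpace d) := {x | ∀ s, x s ∈ Set.Ioo (a s) (a s + G.H / 2)}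
  have hkz : ∀ s, k s = z s ∨ k s = z s + 1 := fun s => by
    have h2 := Finset.mem_Icc.1 (G.point_mem_cell_iff.1 hk)
    have h4 : z s ≤ k s := h2.1 s
    have h5 : k s ≤ z s + 1 := h2.2 s
    omega
  have hSz : S ⊆ G.openCell z := fun x hx s => by
    have h := hx s
    simp only [a, Set.mem_Ioo] at h
    rcases hkz s with e | e <;> rw [e] at h <;> push_cast at h <;> constructor <;> linarith [h.1, h.2]
  have hSm : MeasurableSet S := by
    simp only [S, Set.ofPred_forall]
    exact MeasurableSet.iInter fun s => measurableSet_Ioo.preimage (by fun_prop)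
  have hSv : volume S = ENNReal.ofReal ((G.H / 2) ^ d) := by
    rw [volume_setOf_forall_mem _ fun _ => measurableSet_Ioo, ENNReal.ofReal_pow (by positivity)]
    simp [Real.volume_Ioo]
  have hSh : ∀ x ∈ S, (1 / 2 : ℝ) ^ d ≤ G.hat k x := fun x hx => by
    rw [hat]
    have : (1 / 2 : ℝ) ^ d = ∏ _s : Fin d, (1 / 2 : ℝ) := by simp
    rw [this]
    refine Finset.prod_le_prod (fun _ _ => by norm_num) fun s _ => ?_
    refine le_max_of_le_right ?_
    have h := hx s
    simp only [a, Set.mem_Ioo, point_apply] at h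
    have h1 : |x s - G.point k s| ≤ G.H / 2 := by
      rw [point_apply, abs_le]
      rcases hkz s with e | e <;> rw [e] at h ⊢ <;> push_cast at h ⊢ <;> constructor <;>
        linarith [h.1, h.2]
    have h2 : |x s - G.point k s| / G.H ≤ 1 / 2 := by
      rw [div_le_iff₀ hH]; linarith
    linarith
  calc (G.H / 4) ^ d = (1 / 2) ^ d * (volume S).toReal := by
        rw [hSv, ENNReal.toReal_ofReal (by positivity), ← mul_pow]; congr 1; ring
    _ = ∫ x in S, (1 / 2 : ℝ) ^ d := by rw [setIntegral_const, smul_eq_mul, mul_comm]; rfl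
    _ ≤ ∫ x in S, G.hat k x := setIntegral_mono_on
        (integrableOn_const (by rw [hSv]; exact ENNReal.ofReal_ne_top))
        (G.integrable_hat k).integrableOn hSm hSh
    _ ≤ G.weight ℓ k := setIntegral_mono_set (G.integrable_hat k).integrableOn
        (ae_of_all _ (G.hat_nonneg k))
        (hSz.trans (G.openCell_subset_patch hz hk ℓ)).eventuallyLE

theorem integrable_hat_mul (k : Fin d → ℤ) (v : Lp ℝ 2 (volume : Measure (RSpace d))) :
    Integrable fun x => G.hat k x * v x :=
  MemLp.integrable_mul (G.memLp_hat k) (Lp.memLp v)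

theorem integrable_sq (v : Lp ℝ 2 (volume : Measure (RSpace d))) : Integrable fun x => v x ^ 2 := by
  simpa using integrable_norm_sq v

theorem integrable_hat_mul_sq (k : Fin d → ℤ) (v : Lp ℝ 2 (volume : Measure (RSpace d))) :
    Integrable fun x => G.hat k x * v x ^ 2 := by
  refine (integrable_sq v).mono' ((G.continuous_hat k).aestronglyMeasurable.mul
    (integrable_sq v).aestronglyMeasurable) (ae_of_all _ fun x => ?_)
  rw [Real.norm_of_nonneg (mul_nonneg (G.hat_nonneg k x) (sq_nonneg _))]
  exact mul_le_of_le_one_left (sq_nonneg _) (G.hat_le_one k x)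

/-- Jensen's inequality for a quantity of interest. -/
theorem qoi_sq_mul_weight_le {ℓ : ℕ} {k : Fin d → ℤ} (hw : 0 < G.weight ℓ k)
    (v : Lp ℝ 2 (volume : Measure (RSpace d))) :
    G.qoi ℓ k v ^ 2 * G.weight ℓ k ≤ ∫ x, G.hat k x * v x ^ 2 := by
  set q := G.qoi ℓ k v with hq
  have hqw : ∫ x in G.patch ℓ k, G.hat k x * v x = q * G.weight ℓ k := by
    rw [hq, qoi, ← weight, div_mul_cancel₀ _ hw.ne']
  -- Expanding this weighted variance of `v` about its mean `q` yields the inequality.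
  have h0 : 0 ≤ ∫ x in G.patch ℓ k, G.hat k x * (v x - q) ^ 2 :=
    integral_nonneg fun x => mul_nonneg (G.hat_nonneg k x) (sq_nonneg _)
  have I1 := (G.integrable_hat_mul_sq k v).restrict (s := G.patch ℓ k)
  have I2 := ((G.integrable_hat_mul k v).const_mul (2 * q)).restrict (s := G.patch ℓ k)
  have I3 := ((G.integrable_hat k).const_mul (q ^ 2)).restrict (s := G.patch ℓ k)
  have e : ∫ x in G.patch ℓ k, G.hat k x * (v x - q) ^ 2 =
      ∫ x in G.patch ℓ k, (G.hat k x * v x ^ 2 - 2 * q * (G.hat k x * v x) + q ^ 2 * G.hat k x) :=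
    integral_congr_ae (ae_of_all _ fun x => by ring)
  rw [e, integral_add (by exact I1.sub I2) I3, integral_sub I1 I2, integral_const_mul,
    integral_const_mul, hqw, ← weight] at h0
  have := setIntegral_le_integral (s := G.patch ℓ k) (G.integrable_hat_mul_sq k v)
    (ae_of_all _ fun x => mul_nonneg (G.hat_nonneg k x) (sq_nonneg _))
  nlinarith

theorem weight_pos {ℓ : ℕ} {k : Fin d → ℤ} (hk : k ∈ G.vertices) :
    0 < G.weight ℓ k := by
  obtain ⟨z, hz, h⟩ := G.exists_cell_of_mem_vertices hk
  have := G.H_pos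
  exact lt_of_lt_of_le (by positivity) (G.le_weight hz h)

/-- Jensen's inequality for each functional, summed using that at most `2 ^ d` hats are nonzero at a
point. The lower bound `(H/4) ^ d` for the weights supplies the remaining `4 ^ d`. -/
theorem sum_qoi_sq_le {ℓ : ℕ} {F : Finset (Fin d → ℤ)} (hF : F ⊆ G.vertices)
    (v : Lp ℝ 2 (volume : Measure (RSpace d))) :
    G.H ^ d * ∑ k ∈ F, G.qoi ℓ k v ^ 2 ≤ 8 ^ d * ‖v‖ ^ 2 := by
  classical
  have hH := G.H_pos
  have h1 : ∀ k ∈ F, (G.H / 4) ^ d * G.qoi ℓ k v ^ 2 ≤ ∫ x, G.hat k x * v x ^ 2 := fun k hk => by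
    obtain ⟨z, hz, h⟩ := G.exists_cell_of_mem_vertices (hF hk)
    refine le_trans ?_ (G.qoi_sq_mul_weight_le (ℓ := ℓ) (G.weight_pos (hF hk)) v)
    rw [mul_comm]
    exact mul_le_mul_of_nonneg_left (G.le_weight hz h) (sq_nonneg _)
  have h2 : ∑ k ∈ F, ∫ x, G.hat k x * v x ^ 2 ≤ 2 ^ d * ‖v‖ ^ 2 := by
    rw [← integral_finsetSum _ fun k _ => G.integrable_hat_mul_sq k v, norm_sq_eq_integral,
      ← integral_const_mul]
    refine integral_mono (integrable_finsetSum _ fun k _ => G.integrable_hat_mul_sq k v)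
      ((integrable_norm_sq v).const_mul _) fun x => ?_
    simp only [← Finset.sum_mul, Real.norm_eq_abs, sq_abs]
    refine mul_le_mul_of_nonneg_right ?_ (sq_nonneg _)
    calc ∑ k ∈ F, G.hat k x = ∑ k ∈ F.filter (fun k => G.hat k x ≠ 0), G.hat k x :=
          (Finset.sum_filter_ne_zero F).symm
      _ ≤ ∑ k ∈ F.filter (fun k => G.hat k x ≠ 0), 1 := Finset.sum_le_sum fun k _ => G.hat_le_one k x
      _ ≤ 2 ^ d := by
        rw [Finset.sum_const, nsmul_eq_mul, mul_one]
        exact_mod_cast G.card_filter_lt_le F x _ fun k hk => G.abs_sub_lt_of_hat_ne_zero hk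
  have h3 := (Finset.sum_le_sum h1).trans h2
  rw [← Finset.mul_sum, div_pow, div_mul_eq_mul_div, div_le_iff₀ (by positivity)] at h3
  calc _ ≤ _ := h3
    _ = 8 ^ d * ‖v‖ ^ 2 := by
      rw [mul_right_comm, ← mul_pow]; norm_num

/-- A quantity of interest as a bounded functional. -/
theorem exists_qoiCLM {ℓ : ℕ} {k : Fin d → ℤ} (hk : k ∈ G.vertices) :
    ∃ Q : Lp ℝ 2 (volume : Measure (RSpace d)) →L[ℝ] ℝ, ∀ v, Q v = G.qoi ℓ k v := by
  have hH := G.H_pos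
  refine ⟨LinearMap.mkContinuous ⟨⟨fun v => G.qoi ℓ k v, fun v w => ?_⟩, fun c v => ?_⟩
    (Real.sqrt (8 ^ d / G.H ^ d)) fun v => ?_, fun v => rfl⟩
  · simp only [qoi]
    rw [← add_div, ← integral_add (G.integrable_hat_mul k v).restrict
      (G.integrable_hat_mul k w).restrict]
    congr 1
    refine integral_congr_ae (ae_restrict_of_ae ?_)
    filter_upwards [Lp.coeFn_add v w] with x hx
    rw [hx, Pi.add_apply, mul_add]
  · simp only [qoi, RingHom.id_apply, smul_eq_mul]
    rw [← mul_div_assoc, ← integral_const_mul]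
    congr 1
    refine integral_congr_ae (ae_restrict_of_ae ?_)
    filter_upwards [Lp.coeFn_smul c v] with x hx
    rw [hx, Pi.smul_apply, smul_eq_mul]
    ring
  · simp only [LinearMap.coe_mk, AddHom.coe_mk, Real.norm_eq_abs]
    refine abs_le_of_sq_le_sq ?_ (by positivity)
    rw [mul_pow, Real.sq_sqrt (by positivity), div_mul_eq_mul_div, le_div_iff₀ (by positivity),
      mul_comm]
    simpa using G.sum_qoi_sq_le (Finset.singleton_subset_iff.2 hk) v

theorem qoi_congr {ℓ : ℕ} {k : Fin d → ℤ} {v w : RSpace d → ℝ} (h : v =ᵐ[volume] w) :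
    G.qoi ℓ k v = G.qoi ℓ k w := by
  rw [qoi, qoi]
  congr 1
  refine integral_congr_ae (ae_restrict_of_ae ?_)
  filter_upwards [h] with x hx
  rw [hx]

end CubeMesh

/-! ### Bubble functions dual to the nodal functions -/

/-- The bump is symmetric about its centre, so its first moment about the centre vanishes. -/
theorem ContDiffBump.integral_id_mul_normed {c : ℝ} (f : ContDiffBump c) :
    ∫ t, t * f.normed volume t = c := by
  have hint : Integrable fun t => (t - c) * f.normed volume t :=
    (Continuous.mul (by fun_prop) f.continuous_normed).integrable_of_hasCompactSupport
      f.hasCompactSupport_normed.mul_left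
  have h0 : ∫ t, (t - c) * f.normed volume t = 0 := by
    rw [← integral_add_left_eq_self _ c]
    have h1 := integral_neg_eq_self (fun x : ℝ => (c + x - c) * f.normed volume (c + x)) volume
    have h2 : ∀ x : ℝ, (c + -x - c) * f.normed volume (c + -x) =
        -((c + x - c) * f.normed volume (c + x)) := fun x => by
      rw [← sub_eq_add_neg c x, f.normed_sub]; ring
    simp only [h2, integral_neg] at h1
    linarith
  have e : ∀ t, t * f.normed volume t = (t - c) * f.normed volume t + c * f.normed volume t :=
    fun t => by ring
  simp only [e]
  rw [integral_add hint (f.integrable_normed.const_mul c), h0, integral_const_mul,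
    f.integral_normed]
  ring

/-- A smooth function supported in `(0,1)` with mass one and first moment zero. -/
theorem exists_smooth_dual_function : ∃ β : ℝ → ℝ, ContDiff ℝ (⊤ : ℕ∞) β ∧ HasCompactSupport β ∧
    (∀ t, t ∉ Set.Icc (1 / 6 : ℝ) (5 / 6) → β t = 0) ∧ ∫ t, β t = 1 ∧ ∫ t, t * β t = 0 := by
  -- Unit-mass bumps at `1/3` and `2/3`: the combination `2 f - g` has mass `2 - 1` and first moment
  -- `2/3 - 2/3`.
  let f : ContDiffBump (1 / 3 : ℝ) := ⟨1 / 12, 1 / 6, by norm_num, by norm_num⟩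
  let g : ContDiffBump (2 / 3 : ℝ) := ⟨1 / 12, 1 / 6, by norm_num, by norm_num⟩
  have hf : ∀ t, t ∉ Set.Icc (1 / 6 : ℝ) (5 / 6) → f.normed volume t = 0 := fun t ht => by
    refine image_eq_zero_of_notMem_tsupport fun h => ht ?_
    rw [f.tsupport_normed_eq, Real.closedBall_eq_Icc] at h
    simp only [f, Set.mem_Icc] at h ⊢
    constructor <;> linarith [h.1, h.2]
  have hg : ∀ t, t ∉ Set.Icc (1 / 6 : ℝ) (5 / 6) → g.normed volume t = 0 := fun t ht => by
    refine image_eq_zero_of_notMem_tsupport fun h => ht ?_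
    rw [g.tsupport_normed_eq, Real.closedBall_eq_Icc] at h
    simp only [g, Set.mem_Icc] at h ⊢
    constructor <;> linarith [h.1, h.2]
  have hfi : Integrable fun t => t * f.normed volume t :=
    (continuous_id.mul f.continuous_normed).integrable_of_hasCompactSupport
      f.hasCompactSupport_normed.mul_left
  have hgi : Integrable fun t => t * g.normed volume t :=
    (continuous_id.mul g.continuous_normed).integrable_of_hasCompactSupport
      g.hasCompactSupport_normed.mul_left
  have hz : ∀ t, t ∉ Set.Icc (1 / 6 : ℝ) (5 / 6) →
      2 * f.normed volume t - g.normed volume t = 0 := fun t ht => by simp [hf t ht, hg t ht]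
  refine ⟨fun t => 2 * f.normed volume t - g.normed volume t,
    (contDiff_const.mul f.contDiff_normed).sub g.contDiff_normed,
    HasCompactSupport.intro isCompact_Icc hz, hz, ?_, ?_⟩
  · rw [integral_sub (f.integrable_normed.const_mul 2) g.integrable_normed, integral_const_mul,
      f.integral_normed, g.integral_normed]
    norm_num
  · have e : ∀ t : ℝ, t * (2 * f.normed volume t - g.normed volume t) =
        2 * (t * f.normed volume t) - t * g.normed volume t := fun t => by ring
    simp only [e]
    rw [integral_sub (hfi.const_mul 2) hgi, integral_const_mul, f.integral_id_mul_normed,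
      g.integral_id_mul_normed]
    norm_num

/-- A pair `ψ 0`, `ψ 1` of smooth functions supported in `(0,1)` that is dual to the integer
translates of the hat function, with bounds on the functions and on their slopes. -/
structure DualBumps (ψ : ℤ → ℝ → ℝ) (B K : ℝ) : Prop where
  one_le : 1 ≤ B
  nonneg : 0 ≤ K
  contDiff : ∀ e, ContDiff ℝ (⊤ : ℕ∞) (ψ e)
  eq_zero : ∀ e t, t ∉ Set.Icc (1 / 6 : ℝ) (5 / 6) → ψ e t = 0
  bound : ∀ e t, |ψ e t| ≤ B
  lipschitz : ∀ e t t', |ψ e t - ψ e t'| ≤ K * |t - t'|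
  dual : ∀ e n : ℤ, e = 0 ∨ e = 1 →
    ∫ t : ℝ, max 0 (1 - |t - n|) * ψ e t = if n = e then 1 else 0

/-- On the carrier only the hats at `0` and `1` are nonzero, where they equal `1 - t` and `t`. The
mass and moment conditions thus say exactly that `β` is dual to the hat at `0`. -/
theorem integral_hat_mul_eq {β : ℝ → ℝ} (hβ : Continuous β) (hc : HasCompactSupport β)
    (hs : ∀ t, t ∉ Set.Icc (1 / 6 : ℝ) (5 / 6) → β t = 0) (h1 : ∫ t, β t = 1)
    (h2 : ∫ t, t * β t = 0) (n : ℤ) :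
    ∫ t : ℝ, max 0 (1 - |t - n|) * β t = if n = 0 then 1 else 0 := by
  have hi : Integrable β := hβ.integrable_of_hasCompactSupport hc
  have hi' : Integrable fun t => t * β t :=
    (continuous_id.mul hβ).integrable_of_hasCompactSupport hc.mul_left
  have hcongr : ∀ g : ℝ → ℝ, (∀ t ∈ Set.Icc (1 / 6 : ℝ) (5 / 6), max 0 (1 - |t - n|) = g t) →
      ∫ t : ℝ, max 0 (1 - |t - n|) * β t = ∫ t, g t * β t := fun g hg =>
    integral_congr_ae (ae_of_all _ fun t => by
      by_cases ht : t ∈ Set.Icc (1 / 6 : ℝ) (5 / 6)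
      · simp only [hg t ht]
      · simp only [hs t ht, mul_zero])
  by_cases h0 : n = 0
  · rw [hcongr (fun t => 1 - t) fun t ht => by
      rw [h0, Int.cast_zero, sub_zero, abs_of_nonneg (by linarith [ht.1]),
        max_eq_right (by linarith [ht.2])]]
    simp only [sub_mul, one_mul]
    rw [integral_sub hi hi', h1, h2, if_pos h0, sub_zero]
  · rw [if_neg h0]
    by_cases h1' : n = 1
    · rw [hcongr (fun t => t) fun t ht => by
        rw [h1', Int.cast_one, abs_of_nonpos (by linarith [ht.2]), max_eq_right (by linarith [ht.1])]
        ring, h2]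
    · rw [hcongr (fun _ => 0) fun t ht => ?_]
      · simp
      · refine max_eq_left ?_
        rcases (by omega : n ≤ -1 ∨ 2 ≤ n) with h | h
        · have : (n : ℝ) ≤ -1 := by exact_mod_cast h
          linarith [le_abs_self (t - n), ht.1]
        · have : (2 : ℝ) ≤ n := by exact_mod_cast h
          linarith [neg_le_abs (t - n), ht.2]

theorem exists_dualBumps : ∃ (ψ : ℤ → ℝ → ℝ) (B K : ℝ), DualBumps ψ B K := by
  obtain ⟨β, hβ, hc, hs, h1, h2⟩ := exists_smooth_dual_function
  obtain ⟨B, hB⟩ := hβ.continuous.bounded_above_of_compact_support hc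
  obtain ⟨K, hK⟩ := ContDiff.lipschitzWith_of_hasCompactSupport hc hβ (by simp)
  have hK' : ∀ t t', |β t - β t'| ≤ K * |t - t'| := fun t t' => by
    simpa [Real.dist_eq] using hK.dist_le_mul t t'
  -- The function dual to the hat at `1` is the reflection of `β` in the midpoint of the unit
  -- interval.
  refine ⟨fun e t => if e = 0 then β t else β (1 - t), max 1 B, K, le_max_left _ _, K.2, ?_, ?_,
    ?_, ?_, ?_⟩
  · intro e
    by_cases he : e = 0
    · simpa [he] using hβ
    · simp only [he, if_false]
      exact hβ.comp (contDiff_const.sub contDiff_id)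
  · intro e t ht
    by_cases he : e = 0
    · simpa [he] using hs t ht
    · simp only [he, if_false]
      refine hs _ fun h => ht ?_
      constructor <;> linarith [h.1, h.2]
  · intro e t
    by_cases he : e = 0
    · simpa [he] using Or.inr (hB t)
    · simpa [he] using Or.inr (hB (1 - t))
  · intro e t t'
    by_cases he : e = 0
    · simpa [he] using hK' t t'
    · simp only [he, if_false]
      refine (hK' _ _).trans_eq ?_
      rw [abs_sub_comm t t']
      congr 2
      ring
  · rintro e n (rfl | rfl)
    · simpa using integral_hat_mul_eq hβ.continuous hc hs h1 h2 n
    · have h3 := integral_hat_mul_eq hβ.continuous hc hs h1 h2 (1 - n)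
      rw [← integral_sub_left_eq_self _ volume (1 : ℝ)] at h3
      have e : (1 - n = 0) ↔ (n = 1) := by omega
      simp only [e] at h3
      rw [← h3]
      refine integral_congr_ae (ae_of_all _ fun t => ?_)
      simp only [one_ne_zero, if_false]
      congr 3
      rw [abs_sub_comm]
      congr 1
      push_cast
      ring

namespace CubeMesh

variable {d : ℕ} (G : CubeMesh d) {ψ : ℤ → ℝ → ℝ} {B K : ℝ}

/-- The bubble function in the cube `z` that is dual to the nodal function of its vertex `k`. -/
def bubble (ψ : ℤ → ℝ → ℝ) (z k : Fin d → ℤ) (x : RSpace d) : ℝ :=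
  ∏ s, ψ (k s - z s) ((x s - G.point z s) / G.H)

/-- The one-dimensional carrier of a bubble function. -/
def carrier (z : Fin d → ℤ) (s : Fin d) : Set ℝ :=
  Set.Icc (G.point z s + G.H / 6) (G.point z s + 5 * G.H / 6)

theorem contDiff_bubble (h : DualBumps ψ B K) (z k : Fin d → ℤ) :
    ContDiff ℝ (⊤ : ℕ∞) (G.bubble ψ z k) := by
  unfold bubble
  refine contDiff_prod fun s _ => (h.contDiff _).comp ?_
  refine ContDiff.div_const (ContDiff.sub ?_ contDiff_const) _
  exact (EuclideanSpace.proj s : RSpace d →L[ℝ] ℝ).contDiff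

theorem bubble_factor_eq_zero (h : DualBumps ψ B K) (z : Fin d → ℤ) (s : Fin d) (e : ℤ) {t : ℝ}
    (ht : t ∉ G.carrier z s) : ψ e ((t - G.point z s) / G.H) = 0 := by
  have hH := G.H_pos
  refine h.eq_zero _ _ fun hm => ht ?_
  rw [Set.mem_Icc, le_div_iff₀ hH, div_le_iff₀ hH] at hm
  constructor <;> linarith [hm.1, hm.2]

theorem carrier_subset (z : Fin d → ℤ) : {x : RSpace d | ∀ s, x s ∈ G.carrier z s} ⊆ G.openCell z := by
  intro x hx s
  have hH := G.H_pos
  have := hx s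
  simp only [carrier, Set.mem_Icc] at this
  constructor <;> linarith [this.1, this.2]

theorem tsupport_bubble_subset (h : DualBumps ψ B K) (z k : Fin d → ℤ) :
    tsupport (G.bubble ψ z k) ⊆ {x : RSpace d | ∀ s, x s ∈ G.carrier z s} :=
  tsupport_prod_subset (f := fun s t => ψ (k s - z s) ((t - G.point z s) / G.H))
    (fun _ => isClosed_Icc) fun s _ ht => G.bubble_factor_eq_zero h z s _ ht

theorem hasCompactSupport_bubble (h : DualBumps ψ B K) (z k : Fin d → ℤ) :
    HasCompactSupport (G.bubble ψ z k) := by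
  refine Metric.isCompact_of_isClosed_isBounded (isClosed_tsupport _) ?_
  exact (G.isBounded_cell z).subset ((G.tsupport_bubble_subset h z k).trans
    ((G.carrier_subset z).trans (G.openCell_subset_cell z)))

theorem norm_gradient_bubble_le (h : DualBumps ψ B K) (z k : Fin d → ℤ) (x : RSpace d) :
    ‖gradient (G.bubble ψ z k) x‖ ≤ d * B ^ d * (K / G.H) := by
  have hH := G.H_pos
  refine norm_gradient_prod_le (f := fun s t => ψ (k s - z s) ((t - G.point z s) / G.H)) h.one_le
    (div_nonneg h.nonneg hH.le) (fun s t => h.bound _ _) (fun s t t' => ?_) x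
  refine (h.lipschitz _ _ _).trans_eq ?_
  rw [← sub_div, abs_div, abs_of_pos hH]
  ring_nf

/-- The integral factorizes. After rescaling each factor to the unit interval, the one-dimensional
duality applies with `k s - z s` telling whether `k` is a lower or an upper corner of `z`. -/
theorem integral_hat_mul_bubble (h : DualBumps ψ B K) {z k : Fin d → ℤ}
    (hk : G.point k ∈ G.cell z) (m : Fin d → ℤ) :
    ∫ x, G.hat m x * G.bubble ψ z k x = if m = k then G.H ^ d else 0 := by
  have hH := G.H_pos
  have h1 : ∀ s, ∫ t, G.hat1 (t - G.point m s) * ψ (k s - z s) ((t - G.point z s) / G.H) =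
      if m s = k s then G.H else 0 := fun s => by
    have hkz : k s - z s = 0 ∨ k s - z s = 1 := by
      have h2 := Finset.mem_Icc.1 (G.point_mem_cell_iff.1 hk)
      have h4 : z s ≤ k s := h2.1 s
      have h5 : k s ≤ z s + 1 := h2.2 s
      omega
    have h2 := h.dual (k s - z s) (m s - z s) hkz
    have e1 : ∀ t : ℝ, G.hat1 (t - G.point m s) = max 0 (1 - |(t - G.point z s) / G.H -
        ((m s - z s : ℤ) : ℝ)|) := fun t => by
      rw [hat1]
      congr 2
      rw [← abs_of_pos hH, ← abs_div, abs_of_pos hH]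
      congr 1
      rw [point_apply, point_apply]
      push_cast
      field_simp
      ring
    simp only [e1]
    rw [integral_sub_right_eq_self (fun t => max 0 (1 - |t / G.H - ((m s - z s : ℤ) : ℝ)|) *
      ψ (k s - z s) (t / G.H)), Measure.integral_comp_div (fun t => max 0
        (1 - |t - ((m s - z s : ℤ) : ℝ)|) * ψ (k s - z s) t), h2, abs_of_pos hH]
    simp [sub_left_inj]
  have e : ∀ x : RSpace d, G.hat m x * G.bubble ψ z k x =
      ∏ s, (G.hat1 (x s - G.point m s) * ψ (k s - z s) ((x s - G.point z s) / G.H)) := fun x => by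
    rw [hat, bubble, Finset.prod_mul_distrib]
  simp only [e]
  rw [integral_prod fun s t => G.hat1 (t - G.point m s) * ψ (k s - z s) ((t - G.point z s) / G.H)]
  simp only [h1]
  split_ifs with hm
  · simp [hm]
  · obtain ⟨s, hs⟩ := Function.ne_iff.1 hm
    exact Finset.prod_eq_zero (Finset.mem_univ s) (if_neg hs)

/-- Restricting to the patch loses nothing: where the product is nonzero, `m` is a vertex of the
cube `z`, so the open cube lies in the patch of `m`. -/
theorem setIntegral_hat_mul_bubble (h : DualBumps ψ B K) (ℓ : ℕ) {z k : Fin d → ℤ} (hz : z ∈ G.cells)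
    (hk : G.point k ∈ G.cell z) (m : Fin d → ℤ) :
    ∫ x in G.patch ℓ m, G.hat m x * G.bubble ψ z k x = if m = k then G.H ^ d else 0 := by
  rw [← G.integral_hat_mul_bubble h hk m]
  refine setIntegral_eq_integral_of_forall_compl_eq_zero fun x hx => ?_
  by_contra h0
  have hx1 : x ∈ G.openCell z := G.carrier_subset z (G.tsupport_bubble_subset h z k
    (subset_tsupport _ (right_ne_zero_of_mul h0)))
  exact hx (G.openCell_subset_patch hz (G.point_mem_cell_of_abs_sub_lt hx1
    (G.abs_sub_lt_of_hat_ne_zero (left_ne_zero_of_mul h0))) ℓ hx1)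

/-- A function in `H¹₀(U)` with prescribed quantities of interest and controlled energy. -/
theorem exists_testPair (h : DualBumps ψ B K) (ℓ : ℕ) {U : Set (RSpace d)}
    {F : Finset (Fin d → ℤ)}
    (hF : ∀ k ∈ F, ∃ z ∈ G.cells, G.point k ∈ G.cell z ∧ G.openCell z ⊆ U) (c : (Fin d → ℤ) → ℝ) :
    ∃ p ∈ testPairs U, G.H ^ 2 * ‖p.snd‖ ^ 2 ≤ 2 ^ d * (d * B ^ d * K) ^ 2 * G.H ^ d *
        ∑ k ∈ F, c k ^ 2 ∧
      ∀ m ∈ F, G.qoi ℓ m p.fst = c m * (G.H ^ d / G.weight ℓ m) := by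
  classical
  have hH := G.H_pos
  choose! z hz hkz hzU using hF
  let φ : RSpace d → ℝ := fun x => ∑ k ∈ F, c k * G.bubble ψ (z k) k x
  have hφ : ContDiff ℝ (⊤ : ℕ∞) φ :=
    ContDiff.sum fun k _ => contDiff_const.mul (G.contDiff_bubble h _ _)
  have hts : tsupport φ ⊆ ⋃ k ∈ F, tsupport (G.bubble ψ (z k) k) := by
    refine closure_minimal (fun x hx => ?_)
      (F.finite_toSet.isClosed_biUnion fun k _ => isClosed_tsupport _)
    obtain ⟨k, hk, hne⟩ := Finset.exists_ne_zero_of_sum_ne_zero hx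
    exact Set.mem_biUnion hk (subset_tsupport _ (right_ne_zero_of_mul hne))
  have hsupp : HasCompactSupport φ :=
    (F.finite_toSet.isCompact_biUnion fun k _ => G.hasCompactSupport_bubble h (z k) k)
      |>.of_isClosed_subset (isClosed_tsupport _) hts
  have hU : tsupport φ ⊆ U := hts.trans (Set.iUnion₂_subset fun k hk =>
    (G.tsupport_bubble_subset h _ _).trans ((G.carrier_subset _).trans (hzU k hk)))
  have m1 : MemLp φ 2 (volume : Measure (RSpace d)) :=
    hφ.continuous.memLp_of_hasCompactSupport hsupp
  have m2 : MemLp (gradient φ) 2 (volume : Measure (RSpace d)) :=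
    (continuous_gradient hφ).memLp_of_hasCompactSupport (hasCompactSupport_gradient hsupp)
  refine ⟨WithLp.toLp 2 (m1.toLp φ, m2.toLp _), ⟨φ, hφ, hsupp, hU, m1.coeFn_toLp, m2.coeFn_toLp⟩,
    ?_, fun m hm => ?_⟩
  · have hgrad : ∀ x, gradient φ x = ∑ k ∈ F, c k • gradient (G.bubble ψ (z k) k) x := fun x => by
      have hd : ∀ k, DifferentiableAt ℝ (G.bubble ψ (z k) k) x := fun k =>
        (G.contDiff_bubble h _ _).differentiable (by simp) x
      simp only [gradient, φ, ← map_smul, ← map_sum]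
      congr 1
      rw [fderiv_fun_sum fun k _ => (hd k).const_mul _]
      exact Finset.sum_congr rfl fun k _ => fderiv_const_mul (hd k) _
    set L : ℝ := d * B ^ d * (K / G.H) with hL
    have hptw : ∀ x, ‖gradient φ x‖ ^ 2 ≤
        ∑ k ∈ F, 2 ^ d * L ^ 2 * c k ^ 2 * (G.openCell (z k)).indicator (fun _ => (1 : ℝ)) x :=
        fun x => by
      -- Several vertices may use the same cube, but each active `k` is a vertex of a cube whose
      -- interior contains `x`, so at most `2 ^ d` terms are active at `x`. The clause `k ∈ F` is
      -- repeated because the chosen `z k` is meaningful only there.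
      set P := F.filter fun k => k ∈ F ∧ x ∈ G.openCell (z k) with hP
      have hcard : (P.card : ℝ) ≤ 2 ^ d := by
        exact_mod_cast G.card_filter_lt_le F x (fun k => k ∈ F ∧ x ∈ G.openCell (z k)) fun k hk =>
          G.abs_sub_lt_of_mem_openCell hk.2 (hkz k hk.1)
      have hPF : P ⊆ F := Finset.filter_subset _ F
      have hzero : ∀ k ∈ F, k ∉ P → x ∉ G.openCell (z k) := fun k hk hkP hx =>
        hkP (Finset.mem_filter.2 ⟨hk, hk, hx⟩)
      have h1 : ‖gradient φ x‖ ≤ ∑ k ∈ P, |c k| * L := by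
        rw [hgrad, ← Finset.sum_subset hPF (fun k hk hkP => ?_)]
        · refine (norm_sum_le _ _).trans (Finset.sum_le_sum fun k _ => ?_)
          rw [norm_smul, Real.norm_eq_abs]
          exact mul_le_mul_of_nonneg_left (G.norm_gradient_bubble_le h _ _ _) (abs_nonneg _)
        · rw [gradient_eq_zero_of_notMem_tsupport fun hx => hzero k hk hkP
            (G.carrier_subset _ (G.tsupport_bubble_subset h _ _ hx)), smul_zero]
      calc ‖gradient φ x‖ ^ 2 ≤ (∑ k ∈ P, |c k| * L) ^ 2 := pow_le_pow_left₀ (norm_nonneg _) h1 2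
        _ ≤ P.card * ∑ k ∈ P, (|c k| * L) ^ 2 := sq_sum_le_card_mul_sum_sq
        _ ≤ 2 ^ d * ∑ k ∈ P, (|c k| * L) ^ 2 :=
          mul_le_mul_of_nonneg_right hcard (Finset.sum_nonneg fun _ _ => sq_nonneg _)
        _ = ∑ k ∈ P, 2 ^ d * L ^ 2 * c k ^ 2 * (G.openCell (z k)).indicator (fun _ => (1 : ℝ)) x := by
          rw [Finset.mul_sum]
          refine Finset.sum_congr rfl fun k hk => ?_
          rw [Set.indicator_of_mem (Finset.mem_filter.1 hk).2.2, mul_pow, sq_abs]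
          ring
        _ = _ := Finset.sum_subset hPF fun k hk hkP => by
          rw [Set.indicator_of_notMem (hzero k hk hkP), mul_zero]
    have hind : ∀ k, Integrable ((G.openCell (z k)).indicator fun _ => (1 : ℝ))
        (volume : Measure (RSpace d)) := fun k =>
      (integrable_indicator_iff (G.isOpen_openCell _).measurableSet).2
        (integrableOn_const (by rw [G.volume_openCell]; exact ENNReal.ofReal_ne_top))
    have hindv : ∀ k, ∫ x, (G.openCell (z k)).indicator (fun _ => (1 : ℝ)) x = G.H ^ d := fun k => by
      rw [integral_indicator (G.isOpen_openCell _).measurableSet, setIntegral_const, smul_eq_mul,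
        mul_one, Measure.real, G.volume_openCell, ENNReal.toReal_ofReal (by positivity)]
    have hnorm : ‖(m2.toLp (gradient φ))‖ ^ 2 = ∫ x, ‖gradient φ x‖ ^ 2 := by
      rw [norm_sq_eq_integral]
      refine integral_congr_ae ?_
      filter_upwards [m2.coeFn_toLp] with x hx
      rw [hx]
    have hbound : ∫ x, ‖gradient φ x‖ ^ 2 ≤ 2 ^ d * L ^ 2 * G.H ^ d * ∑ k ∈ F, c k ^ 2 := by
      refine (integral_mono ((memLp_two_iff_integrable_sq_norm m2.1).1 m2)
        (integrable_finsetSum _ fun k _ => (hind k).const_mul _) hptw).trans_eq ?_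
      rw [integral_finsetSum _ fun k _ => (hind k).const_mul _, Finset.mul_sum]
      refine Finset.sum_congr rfl fun k _ => ?_
      rw [integral_const_mul, hindv]
      ring
    calc G.H ^ 2 * ‖(m2.toLp (gradient φ))‖ ^ 2
        ≤ G.H ^ 2 * (2 ^ d * L ^ 2 * G.H ^ d * ∑ k ∈ F, c k ^ 2) := by
          rw [hnorm]; gcongr
      _ = _ := by
          rw [hL]
          field_simp
  · refine (G.qoi_congr (w := φ) m1.coeFn_toLp).trans ?_
    rw [qoi, ← weight, ← mul_div_assoc]
    congr 1
    have hi : ∀ k, IntegrableOn (fun x => c k * (G.hat m x * G.bubble ψ (z k) k x))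
        (G.patch ℓ m) := fun k => by
      refine (Integrable.const_mul ?_ _).integrableOn
      exact ((G.continuous_hat m).mul (G.contDiff_bubble h _ _).continuous)
        |>.integrable_of_hasCompactSupport (G.hasCompactSupport_bubble h _ _).mul_left
    have e : ∀ x, G.hat m x * φ x = ∑ k ∈ F, c k * (G.hat m x * G.bubble ψ (z k) k x) := fun x => by
      simp only [φ, Finset.mul_sum]
      exact Finset.sum_congr rfl fun k _ => by ring
    simp only [e]
    rw [integral_finsetSum _ fun k _ => hi k]
    simp only [integral_const_mul]
    rw [Finset.sum_congr rfl fun k hk => by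
      rw [G.setIntegral_hat_mul_bubble h ℓ (hz k hk) (hkz k hk) m]]
    simp [hm]

end CubeMesh

/-! ### Spectral norms and perturbed linear systems -/

section SpectralNorm

variable {n : Type*} [Fintype n]

/-- The Euclidean norm of a coordinate vector. -/
def euclNorm (v : n → ℝ) : ℝ := ‖(WithLp.toLp 2 v : EuclideanSpace ℝ n)‖

theorem euclNorm_nonneg (v : n → ℝ) : 0 ≤ euclNorm v := norm_nonneg _

theorem euclNorm_sq (v : n → ℝ) : euclNorm v ^ 2 = ∑ i, v i ^ 2 := by
  simp [euclNorm, EuclideanSpace.real_norm_sq_eq]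

theorem euclNorm_add_le (v w : n → ℝ) : euclNorm (v + w) ≤ euclNorm v + euclNorm w := by
  simpa [euclNorm] using norm_add_le (WithLp.toLp 2 v : EuclideanSpace ℝ n) (WithLp.toLp 2 w)

theorem euclNorm_neg (v : n → ℝ) : euclNorm (-v) = euclNorm v := by
  simp [euclNorm]

theorem abs_sum_mul_le_euclNorm (v w : n → ℝ) : |∑ i, v i * w i| ≤ euclNorm v * euclNorm w := by
  have := abs_real_inner_le_norm (WithLp.toLp 2 v : EuclideanSpace ℝ n) (WithLp.toLp 2 w)
  simpa [euclNorm, PiLp.inner_apply, mul_comm] using this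

theorem euclNorm_le_of_sq_le {v : n → ℝ} {C : ℝ} (hC : 0 ≤ C) (h : ∑ i, v i ^ 2 ≤ C ^ 2) :
    euclNorm v ≤ C := by
  rw [← euclNorm_sq] at h
  exact (pow_le_pow_iff_left₀ (euclNorm_nonneg v) hC two_ne_zero).1 h

theorem euclNorm_le_sqrt_card_mul {v : n → ℝ} {E : ℝ} (h : ∀ i, |v i| ≤ E) (hE : 0 ≤ E) :
    euclNorm v ≤ Real.sqrt (Fintype.card n) * E := by
  refine euclNorm_le_of_sq_le (by positivity) ?_
  rw [mul_pow, Real.sq_sqrt (by positivity)]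
  calc ∑ i, v i ^ 2 ≤ ∑ _i : n, E ^ 2 := Finset.sum_le_sum fun i _ => by
        rw [← sq_abs]; exact pow_le_pow_left₀ (abs_nonneg _) (h i) 2
    _ = _ := by simp

variable [DecidableEq n]

theorem specNorm_nonneg (X : Matrix n n ℝ) : 0 ≤ specNorm X := norm_nonneg _

theorem euclNorm_mulVec_le (X : Matrix n n ℝ) (v : n → ℝ) :
    euclNorm (X *ᵥ v) ≤ specNorm X * euclNorm v := by
  have := (Matrix.toEuclideanCLM (n := n) (𝕜 := ℝ) X).le_opNorm (WithLp.toLp 2 v)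
  rwa [Matrix.toEuclideanCLM_toLp] at this

theorem specNorm_le_of_forall {X : Matrix n n ℝ} {C : ℝ} (hC : 0 ≤ C)
    (h : ∀ v, euclNorm (X *ᵥ v) ≤ C * euclNorm v) : specNorm X ≤ C := by
  refine ContinuousLinearMap.opNorm_le_bound _ hC fun v => ?_
  have := h v.ofLp
  rw [euclNorm, ← Matrix.toEuclideanCLM_toLp] at this
  exact this

/-- A lower bound for a square matrix gives injectivity, hence invertibility; applied to `X⁻¹ *ᵥ v`
it bounds the inverse. -/
theorem isUnit_of_euclNorm_le {X : Matrix n n ℝ} {κ : ℝ} (hκ : 0 ≤ κ)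
    (h : ∀ v, euclNorm v ≤ κ * euclNorm (X *ᵥ v)) : IsUnit X ∧ specNorm X⁻¹ ≤ κ := by
  have hu : IsUnit X := by
    rw [← Matrix.mulVec_injective_iff_isUnit]
    intro v w hvw
    have h1 := h (v - w)
    rw [Matrix.mulVec_sub, sub_eq_zero.2 hvw] at h1
    have h2 : euclNorm (0 : n → ℝ) = 0 := by simp [euclNorm]
    rw [h2, mul_zero] at h1
    have h3 : (WithLp.toLp 2 (v - w) : EuclideanSpace ℝ n) = 0 := norm_le_zero_iff.1 h1
    exact sub_eq_zero.1 ((WithLp.toLp_eq_zero 2).1 h3)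
  refine ⟨hu, specNorm_le_of_forall hκ fun v => ?_⟩
  have h1 := h (X⁻¹ *ᵥ v)
  rwa [Matrix.mulVec_mulVec, Matrix.mul_nonsing_inv _ ((Matrix.isUnit_iff_isUnit_det X).1 hu),
    Matrix.one_mulVec] at h1

theorem isUnit_add_of_specNorm_le {X N : Matrix n n ℝ} (hX : IsUnit X) {κ ρ : ℝ}
    (hκ : specNorm X⁻¹ ≤ κ) (hρ : ρ < 1) (h : specNorm X⁻¹ * specNorm N ≤ ρ) :
    IsUnit (X + N) ∧ specNorm (X + N)⁻¹ ≤ κ / (1 - ρ) := by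
  have hκ0 : 0 ≤ κ := (specNorm_nonneg _).trans hκ
  have h1ρ : 0 < 1 - ρ := by linarith
  refine isUnit_of_euclNorm_le (by positivity) fun v => ?_
  -- Taking norms here leaves `ρ` times the norm of `v` on the right, which is absorbed since `ρ <
  -- 1`.
  have e : v = X⁻¹ *ᵥ ((X + N) *ᵥ v) + -(X⁻¹ *ᵥ (N *ᵥ v)) := by
    rw [Matrix.add_mulVec, Matrix.mulVec_add, Matrix.mulVec_mulVec,
      Matrix.nonsing_inv_mul _ ((Matrix.isUnit_iff_isUnit_det X).1 hX), Matrix.one_mulVec,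
      add_neg_cancel_right]
  have h1 : euclNorm v ≤ κ * euclNorm ((X + N) *ᵥ v) + ρ * euclNorm v := by
    calc euclNorm v ≤ euclNorm (X⁻¹ *ᵥ ((X + N) *ᵥ v)) + euclNorm (X⁻¹ *ᵥ (N *ᵥ v)) := by
          conv_lhs => rw [e]
          rw [← euclNorm_neg (X⁻¹ *ᵥ (N *ᵥ v))]
          exact euclNorm_add_le _ _
      _ ≤ κ * euclNorm ((X + N) *ᵥ v) + ρ * euclNorm v := by
        refine add_le_add ((euclNorm_mulVec_le _ _).trans
          (mul_le_mul_of_nonneg_right hκ (euclNorm_nonneg _))) ?_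
        calc _ ≤ specNorm X⁻¹ * euclNorm (N *ᵥ v) := euclNorm_mulVec_le _ _
          _ ≤ specNorm X⁻¹ * (specNorm N * euclNorm v) :=
            mul_le_mul_of_nonneg_left (euclNorm_mulVec_le _ _) (specNorm_nonneg _)
          _ = specNorm X⁻¹ * specNorm N * euclNorm v := by ring
          _ ≤ _ := mul_le_mul_of_nonneg_right h (euclNorm_nonneg _)
  rw [div_mul_eq_mul_div, le_div_iff₀ h1ρ]
  linarith

/-- The resolvent identity, which makes the change of the multiplier linear in the noise up to the
perturbed inverse. -/
theorem inv_add_sub_inv_mulVec {X N : Matrix n n ℝ} (hX : IsUnit X) (hXN : IsUnit (X + N))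
    (v : n → ℝ) : (X + N)⁻¹ *ᵥ v - X⁻¹ *ᵥ v = -((X + N)⁻¹ *ᵥ (N *ᵥ (X⁻¹ *ᵥ v))) := by
  have h1 : (X + N)⁻¹ *ᵥ ((X + N) *ᵥ (X⁻¹ *ᵥ v)) = X⁻¹ *ᵥ v := by
    rw [Matrix.mulVec_mulVec, Matrix.nonsing_inv_mul _ ((Matrix.isUnit_iff_isUnit_det _).1 hXN),
      Matrix.one_mulVec]
  have h2 : X *ᵥ (X⁻¹ *ᵥ v) = v := by
    rw [Matrix.mulVec_mulVec, Matrix.mul_nonsing_inv _ ((Matrix.isUnit_iff_isUnit_det _).1 hX),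
      Matrix.one_mulVec]
  rw [Matrix.add_mulVec, Matrix.mulVec_add, h2] at h1
  rw [sub_eq_iff_eq_add, neg_add_eq_sub, eq_sub_iff_add_eq]
  exact h1

/-- The Schur test for a matrix with at most `L` nonzero entries in every row and column. -/
theorem specNorm_le_of_sparse {X : Matrix n n ℝ} {r : n → n → Prop} [DecidableRel r] {L : ℕ} {E : ℝ}
    (hE : 0 ≤ E) (hX : ∀ i j, |X i j| ≤ E) (hr : ∀ i j, X i j ≠ 0 → r i j)
    (hrow : ∀ i, (Finset.univ.filter fun j => r i j).card ≤ L)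
    (hcol : ∀ j, (Finset.univ.filter fun i => r i j).card ≤ L) : specNorm X ≤ L * E := by
  refine specNorm_le_of_forall (by positivity) fun v => ?_
  refine euclNorm_le_of_sq_le (mul_nonneg (by positivity) (euclNorm_nonneg _)) ?_
  have h1 : ∀ i, (X *ᵥ v) i ^ 2 ≤ L * E ^ 2 * ∑ j, if r i j then v j ^ 2 else 0 := fun i => by
    have e : (X *ᵥ v) i = ∑ j ∈ Finset.univ.filter (fun j => r i j), X i j * v j := by
      rw [Matrix.mulVec, dotProduct]
      symm
      refine Finset.sum_subset (Finset.subset_univ _) fun j _ hj => ?_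
      have : X i j = 0 := by
        by_contra h
        exact hj (Finset.mem_filter.2 ⟨Finset.mem_univ j, hr i j h⟩)
      rw [this, zero_mul]
    rw [e, ← Finset.sum_filter]
    refine (sq_sum_le_card_mul_sum_sq).trans ?_
    rw [mul_assoc, Finset.mul_sum _ _ (E ^ 2)]
    refine mul_le_mul (by exact_mod_cast hrow i) (Finset.sum_le_sum fun j _ => ?_)
      (Finset.sum_nonneg fun _ _ => sq_nonneg _) (by positivity)
    rw [mul_pow, ← sq_abs (X i j)]
    exact mul_le_mul_of_nonneg_right (pow_le_pow_left₀ (abs_nonneg _) (hX i j) 2) (sq_nonneg _)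
  calc ∑ i, (X *ᵥ v) i ^ 2 ≤ ∑ i, L * E ^ 2 * ∑ j, (if r i j then v j ^ 2 else 0) :=
        Finset.sum_le_sum fun i _ => h1 i
    _ = L * E ^ 2 * ∑ j, ∑ i, (if r i j then v j ^ 2 else 0) := by
      rw [← Finset.mul_sum, Finset.sum_comm]
    _ ≤ L * E ^ 2 * ∑ j, L * v j ^ 2 := by
      refine mul_le_mul_of_nonneg_left (Finset.sum_le_sum fun j _ => ?_) (by positivity)
      rw [← Finset.sum_filter, Finset.sum_const, nsmul_eq_mul]
      exact mul_le_mul_of_nonneg_right (by exact_mod_cast hcol j) (sq_nonneg _)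
    _ = (L * E * euclNorm v) ^ 2 := by
      rw [← Finset.mul_sum, mul_pow, euclNorm_sq]; ring

theorem specNorm_le_card_mul {X : Matrix n n ℝ} {E : ℝ} (hE : 0 ≤ E) (hX : ∀ i j, |X i j| ≤ E) :
    specNorm X ≤ Fintype.card n * E :=
  specNorm_le_of_sparse (r := fun _ _ => True) hE hX (fun _ _ _ => trivial) (by simp) (by simp)

end SpectralNorm

/-! ### Largest entries of families of matrices -/

namespace LODData

theorem abs_le_maxEntry {ι : Type*} [Finite ι] {R C : ι → Type*} [∀ j, Finite (R j)]
    [∀ j, Finite (C j)] (X : ∀ j, Matrix (R j) (C j) ℝ) (j : ι) (i : R j) (k : C j) :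
    |X j i k| ≤ maxEntry X :=
  (le_ciSup (f := fun k => |X j i k|) (Set.finite_range _).bddAbove k).trans
    ((le_ciSup (f := fun i => ⨆ k, |X j i k|) (Set.finite_range _).bddAbove i).trans
      (le_ciSup (f := fun j => ⨆ i, ⨆ k, |X j i k|) (Set.finite_range _).bddAbove j))

theorem maxEntry_nonneg {ι : Type*} {R C : ι → Type*} (X : ∀ j, Matrix (R j) (C j) ℝ) :
    0 ≤ maxEntry X :=
  Real.iSup_nonneg fun _ => Real.iSup_nonneg fun _ => Real.iSup_nonneg fun _ => abs_nonneg _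

end LODData

/-! ### Solvability and a priori bounds for an admissible method -/

namespace LODData

variable {d : ℕ}

theorem mem_near {S : LODData d} {K : Finset (Fin d → ℤ)} {j k : Fin d → ℤ} :
    k ∈ S.near K j ↔ k ∈ K ∧ (S.mesh.star k ∩ S.mesh.patch S.ell j).Nonempty := by
  simp [near]

/-- The properties of the input that the error analysis uses: the common part of the method on a
mesh of `Ω` and of the method with domain extension. -/
structure Admissible (S : LODData d) (θ Θ W κ : ℝ) : Prop where
  one_le_ell : 1 ≤ S.ell
  qoiNodes_subset : S.qoiNodes ⊆ S.mesh.vertices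
  cells_nonempty : S.basisNodes.Nonempty → S.mesh.cells.Nonempty
  elliptic : UniformlyElliptic S.mesh.domain S.coeff θ Θ
  one_le : 1 ≤ W
  card_cells : S.mesh.cells.card * S.mesh.H ^ d ≤ W
  nonneg : 0 ≤ κ
  shape_memLp : ∀ i, MemLp (gradient (S.shape i)) 2 volume
  shape_energy : ∀ i, S.mesh.H ^ 2 * ∫ x, ‖gradient (S.shape i) x‖ ^ 2 ≤ κ * S.mesh.H ^ d

namespace Admissible

variable {S : LODData d} {θ Θ W κ : ℝ}

theorem near_subset (hS : S.Admissible θ Θ W κ) (j : Fin d → ℤ) :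
    S.near S.qoiNodes j ⊆ S.mesh.vertices :=
  fun _ hk => hS.qoiNodes_subset (mem_near.1 hk).1

theorem mem_vertices (hS : S.Admissible θ Θ W κ) {j : S.Node} (k : S.Loc j) :
    k.1 ∈ S.mesh.vertices := hS.near_subset _ k.2

theorem patch_slab (j : S.Node) (s : Fin d) : ∀ x ∈ S.mesh.patch S.ell j.1,
    |x s - S.mesh.point j.1 s| ≤ ((S.ell : ℝ) + 1) * S.mesh.H :=
  fun _ hx => S.mesh.patch_subset_box S.ell j.1 hx s

theorem existsUnique_isLocalSolution (hS : S.Admissible θ Θ W κ) (hd : 0 < d) (j : S.Node)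
    (k : S.Loc j) : ∃! u : L2Pair d, S.IsLocalSolution j k u := by
  obtain ⟨Q, hQ⟩ := S.mesh.exists_qoiCLM (ℓ := S.ell) (hS.mem_vertices k)
  have := existsUnique_variational hS.elliptic (S.mesh.patch_subset_domain hS.one_le_ell j.1)
    ⟨0, hd⟩ _ _ (patch_slab j ⟨0, hd⟩) (Q.comp (WithLp.fstL 2 ℝ _ _))
  simpa only [IsLocalSolution, ContinuousLinearMap.comp_apply, WithLp.fstL_apply, hQ] using this

/-- A linear combination of the local solutions. -/
theorem exists_combination (hS : S.Admissible θ Θ W κ)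
    {u : ∀ j : S.Node, S.Loc j → L2Pair d} (hu : ∀ j k, S.IsLocalSolution j k (u j k)) (j : S.Node)
    (c : S.Loc j → ℝ) : ∃ w ∈ H10 (S.mesh.patch S.ell j.1),
      (∀ v ∈ H10 (S.mesh.patch S.ell j.1), energyForm S.mesh.domain S.coeff v.snd w.snd =
        ∑ k, c k * S.mesh.qoi S.ell k.1 v.fst) ∧
      (∀ g : L2Field d, energyForm S.mesh.domain S.coeff g w.snd =
        ∑ k, c k * energyForm S.mesh.domain S.coeff g (u j k).snd) ∧
      ∑ k, c k * (S.measM u j *ᵥ c) k = energyForm S.mesh.domain S.coeff w.snd w.snd := by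
  obtain ⟨B, hB⟩ := hS.elliptic.exists_energyCLM
  choose Q hQ using fun k : S.Loc j => S.mesh.exists_qoiCLM (ℓ := S.ell) (hS.mem_vertices k)
  let w : L2Pair d := ∑ k, c k • u j k
  have hw : w ∈ H10 (S.mesh.patch S.ell j.1) :=
    Submodule.sum_mem _ fun k _ => Submodule.smul_mem _ _ (hu j k).1
  have hsnd : w.snd = ∑ k, c k • (u j k).snd := by
    have := map_sum (WithLp.sndL 2 ℝ (Lp ℝ 2 (volume : Measure (RSpace d))) (L2Field d))
      (fun k => c k • u j k) Finset.univ
    simpa only [map_smul, WithLp.sndL_apply] using this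
  have hfst : w.fst = ∑ k, c k • (u j k).fst := by
    have := map_sum (WithLp.fstL 2 ℝ (Lp ℝ 2 (volume : Measure (RSpace d))) (L2Field d))
      (fun k => c k • u j k) Finset.univ
    simpa only [map_smul, WithLp.fstL_apply] using this
  have h2 : ∀ g : L2Field d, energyForm S.mesh.domain S.coeff g w.snd =
      ∑ k, c k * energyForm S.mesh.domain S.coeff g (u j k).snd := fun g => by
    simp only [← hB, hsnd, map_sum, map_smul, smul_eq_mul]
  have h1 : ∀ v ∈ H10 (S.mesh.patch S.ell j.1), energyForm S.mesh.domain S.coeff v.snd w.snd =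
      ∑ k, c k * S.mesh.qoi S.ell k.1 v.fst := fun v hv => by
    rw [h2]
    exact Finset.sum_congr rfl fun k _ => by rw [(hu j k).2 v hv]
  refine ⟨w, hw, h1, h2, ?_⟩
  -- Testing with `w` itself and expanding `q_k(w)` in the local solutions turns the energy of `w`
  -- into the quadratic form of the matrix.
  rw [h1 w hw]
  refine Finset.sum_congr rfl fun k _ => ?_
  rw [← hQ k, hfst]
  simp only [map_sum, map_smul, smul_eq_mul]
  simp only [hQ, Matrix.mulVec, dotProduct, measM]
  congr 1
  exact Finset.sum_congr rfl fun m _ => mul_comm _ _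

theorem exists_openCell (hS : S.Admissible θ Θ W κ) (j : S.Node) {K : Finset (Fin d → ℤ)} :
    ∀ k ∈ S.near K j.1, ∃ z ∈ S.mesh.cells, S.mesh.point k ∈ S.mesh.cell z ∧
      S.mesh.openCell z ⊆ S.mesh.patch S.ell j.1 := fun _ hk =>
  S.mesh.exists_openCell_subset_patch hS.one_le_ell (mem_near.1 hk).2

/-- The mesh has at least one cube, whose volume is at most `W`. The bound on `H` itself then
follows from `1 ≤ W` if `H ≤ 1`, and from `H ≤ H ^ d` otherwise. -/
theorem H_le (hS : S.Admissible θ Θ W κ) (hd : 2 ≤ d) (j : S.Node) :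
    S.mesh.H ≤ W ∧ S.mesh.H ^ d ≤ W := by
  have hH := S.mesh.H_pos
  have h1 : S.mesh.H ^ d ≤ W := by
    have h : (1 : ℝ) ≤ S.mesh.cells.card := by
      exact_mod_cast (hS.cells_nonempty ⟨j.1, j.2⟩).card_pos
    exact (le_mul_of_one_le_left (by positivity) h).trans hS.card_cells
  refine ⟨?_, h1⟩
  rcases le_total S.mesh.H 1 with h | h
  · exact h.trans hS.one_le
  · exact (le_self_pow₀ h (by omega)).trans h1

/-- The lower bound for the Gram matrix of the quantities of interest. -/
theorem euclNorm_le_measM (hS : S.Admissible θ Θ W κ) (hd : 2 ≤ d) {ψ : ℤ → ℝ → ℝ} {B K : ℝ}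
    (h : DualBumps ψ B K) {u : ∀ j : S.Node, S.Loc j → L2Pair d}
    (hu : ∀ j k, S.IsLocalSolution j k (u j k)) (j : S.Node) (c : S.Loc j → ℝ) :
    euclNorm c ≤ 8 ^ d * (d * B ^ d * K) ^ 2 * W ^ d * Θ * euclNorm (S.measM u j *ᵥ c) := by
  classical
  have hH := S.mesh.H_pos
  have hΘ := hS.elliptic.upper_pos
  obtain ⟨w, hw, hw1, -, hw3⟩ := hS.exists_combination hu j c
  let c' : (Fin d → ℤ) → ℝ := fun k => if hk : k ∈ S.near S.qoiNodes j.1 then c ⟨k, hk⟩ else 0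
  have hc' : ∀ k : S.Loc j, c' k.1 = c k := fun k => by simp [c', k.2]
  obtain ⟨p, hp, hpe, hpq⟩ := S.mesh.exists_testPair h S.ell (hS.exists_openCell j) c'
  have hsum : ∑ k ∈ S.near S.qoiNodes j.1, c' k ^ 2 = euclNorm c ^ 2 := by
    rw [euclNorm_sq, ← Finset.sum_coe_sort]
    exact Finset.sum_congr rfl fun k _ => by rw [hc']
  rw [hsum] at hpe
  have hpw := hw1 p (testPairs_subset_H10 hp)
  have hlow : (1 / 2 : ℝ) ^ d * euclNorm c ^ 2 ≤ energyForm S.mesh.domain S.coeff p.snd w.snd := by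
    rw [hpw, euclNorm_sq, Finset.mul_sum]
    refine Finset.sum_le_sum fun k _ => ?_
    rw [hpq k.1 k.2, hc' k]
    have hwp := S.mesh.weight_pos (ℓ := S.ell) (hS.mem_vertices k)
    have h2 : (1 / 2 : ℝ) ^ d ≤ S.mesh.H ^ d / S.mesh.weight S.ell k.1 := by
      rw [le_div_iff₀ hwp]
      calc _ ≤ (1 / 2 : ℝ) ^ d * (2 * S.mesh.H) ^ d :=
            mul_le_mul_of_nonneg_left (S.mesh.weight_le _ _) (by positivity)
        _ = S.mesh.H ^ d := by rw [← mul_pow]; congr 1; ring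
    calc _ ≤ S.mesh.H ^ d / S.mesh.weight S.ell k.1 * c k ^ 2 :=
          mul_le_mul_of_nonneg_right h2 (sq_nonneg _)
      _ = _ := by ring
  have hCS := hS.elliptic.energyForm_sq_le p.snd w.snd
  have hpp := hS.elliptic.energyForm_self_le p.snd
  set T : ℝ := 2 ^ d * (d * B ^ d * K) ^ 2 with hT
  have hT0 : 0 ≤ T := by positivity
  have hpsnd : ‖p.snd‖ ^ 2 ≤ T * W ^ d * euclNorm c ^ 2 := by
    have h1 : S.mesh.H ^ d = S.mesh.H ^ 2 * S.mesh.H ^ (d - 2) := by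
      rw [← pow_add]; congr 1; omega
    -- The gradient of the bubbles costs `H ^ (-2)` and their volume gains `H ^ d`. Since `d ≥ 2`,
    -- the net power is bounded in terms of the domain, which keeps the constant free of `H`.
    have h2 : S.mesh.H ^ (d - 2) ≤ W ^ d :=
      (pow_le_pow_left₀ hH.le (hS.H_le hd j).1 _).trans (pow_le_pow_right₀ hS.one_le (by omega))
    rw [h1] at hpe
    have h3 : ‖p.snd‖ ^ 2 ≤ T * S.mesh.H ^ (d - 2) * euclNorm c ^ 2 := by
      refine le_of_mul_le_mul_left ?_ (by positivity : (0 : ℝ) < S.mesh.H ^ 2)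
      linarith
    refine h3.trans ?_
    gcongr
  have hww : energyForm S.mesh.domain S.coeff w.snd w.snd ≤
      euclNorm c * euclNorm (S.measM u j *ᵥ c) := by
    rw [← hw3]
    exact (le_abs_self _).trans (abs_sum_mul_le_euclNorm _ _)
  set X := euclNorm c
  set Y := euclNorm (S.measM u j *ᵥ c)
  have hX : 0 ≤ X := euclNorm_nonneg _
  have hY : 0 ≤ Y := euclNorm_nonneg _
  have hW : (0 : ℝ) ≤ W := by linarith [hS.one_le]
  have hmain : ((1 / 2 : ℝ) ^ d * X ^ 2) ^ 2 ≤ Θ * (T * W ^ d * X ^ 2) * (X * Y) := by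
    calc _ ≤ _ := pow_le_pow_left₀ (by positivity) hlow 2
      _ ≤ _ := hCS
      _ ≤ _ := mul_le_mul (hpp.trans (mul_le_mul_of_nonneg_left hpsnd hΘ.le)) hww
        (hS.elliptic.energyForm_self_nonneg _) (by positivity)
  rcases hX.eq_or_lt with h0 | hpos
  · rw [← h0]; positivity
  · have e4 : ((1 / 2 : ℝ) ^ d) ^ 2 * 4 ^ d = 1 := by
      rw [← pow_mul, mul_comm d 2, pow_mul, ← mul_pow]; norm_num
    -- Cancelling the cube of `X` in `hmain`, which is quartic in `X` on the left and cubic on the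
    -- right.
    have h5 : ((1 / 2 : ℝ) ^ d) ^ 2 * X ≤ Θ * T * W ^ d * Y := by
      refine le_of_mul_le_mul_left ?_ (by positivity : 0 < X ^ 3)
      linarith
    have e8 : (8 : ℝ) ^ d = 4 ^ d * 2 ^ d := by rw [← mul_pow]; norm_num
    calc X = ((1 / 2 : ℝ) ^ d) ^ 2 * X * 4 ^ d := by rw [mul_right_comm, e4, one_mul]
      _ ≤ Θ * T * W ^ d * Y * 4 ^ d := mul_le_mul_of_nonneg_right h5 (by positivity)
      _ = _ := by rw [hT, e8]; ring

/-- The bound for a row of the scalars `a(Λ_i, u_k)`. -/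
theorem euclNorm_measA_le (hS : S.Admissible θ Θ W κ) (hd : 0 < d)
    {u : ∀ j : S.Node, S.Loc j → L2Pair d} (hu : ∀ j k, S.IsLocalSolution j k (u j k)) (j : S.Node)
    (i : S.Row j) : euclNorm (S.measA u j i) ≤
      Real.sqrt (4 * κ * 8 ^ d) * ((S.ell : ℝ) + 1) * (Θ / θ) := by
  have hH := S.mesh.H_pos
  have hΘ := hS.elliptic.upper_pos
  have hθ := hS.elliptic.pos
  have hκ := hS.nonneg
  set a := S.measA u j i with ha
  -- The row itself serves as coefficient vector, so that the energy product of the nodal function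
  -- with `w` is the squared norm of the row.
  obtain ⟨w, hw, hw1, hw2, -⟩ := hS.exists_combination hu j a
  let g : L2Field d := (hS.shape_memLp i.1).toLp _
  have hg : g =ᵐ[volume] gradient (S.shape i.1) := (hS.shape_memLp i.1).coeFn_toLp
  have hgn : S.mesh.H ^ 2 * ‖g‖ ^ 2 ≤ κ * S.mesh.H ^ d := by
    rw [norm_sq_eq_integral]
    refine le_of_eq_of_le ?_ (hS.shape_energy i.1)
    congr 1
    refine integral_congr_ae ?_
    filter_upwards [hg] with x hx
    rw [hx]
  have e1 : energyForm S.mesh.domain S.coeff g w.snd = euclNorm a ^ 2 := by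
    rw [hw2, euclNorm_sq]
    refine Finset.sum_congr rfl fun k _ => ?_
    rw [energyForm_congr hg (Filter.EventuallyEq.refl _ _), sq]
    rfl
  set N := euclNorm a
  set q : S.Loc j → ℝ := fun k => S.mesh.qoi S.ell k.1 w.fst with hq
  set Z := energyForm S.mesh.domain S.coeff w.snd w.snd with hZ
  have hZ0 : 0 ≤ Z := hS.elliptic.energyForm_self_nonneg _
  have hN0 : 0 ≤ N := euclNorm_nonneg _
  have hZq : Z ≤ N * euclNorm q := by
    rw [hZ, hw1 w hw]
    exact (le_abs_self _).trans (abs_sum_mul_le_euclNorm a q)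
  have hqb : S.mesh.H ^ d * euclNorm q ^ 2 ≤ 8 ^ d * ‖w.fst‖ ^ 2 := by
    rw [euclNorm_sq]
    have := S.mesh.sum_qoi_sq_le (ℓ := S.ell) (hS.near_subset j.1) w.fst
    rwa [← Finset.sum_coe_sort] at this
  have hF := norm_fst_sq_le_of_mem_H10 ⟨0, hd⟩ _ _ (patch_slab j ⟨0, hd⟩) hw
  have hco := hS.elliptic.coercive (S.mesh.patch_subset_domain hS.one_le_ell j.1) hw
  rw [← hZ] at hco
  set R : ℝ := (2 * (((S.ell : ℝ) + 1) * S.mesh.H)) ^ 2 with hR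
  have hR0 : 0 ≤ R := by positivity
  -- Squaring `Z ≤ N |q|` and chaining the bound on `q`, Friedrichs and coercivity returns a factor
  -- `Z`, which is cancelled.
  have h1 : S.mesh.H ^ d * θ * Z ≤ N ^ 2 * (8 ^ d * R) := by
    rcases hZ0.eq_or_lt with h0 | hpos
    · rw [← h0, mul_zero]; positivity
    · refine le_of_mul_le_mul_right ?_ hpos
      calc S.mesh.H ^ d * θ * Z * Z ≤ S.mesh.H ^ d * θ * (N * euclNorm q) ^ 2 := by
            rw [mul_assoc, ← sq]
            gcongr
        _ = N ^ 2 * θ * (S.mesh.H ^ d * euclNorm q ^ 2) := by ring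
        _ ≤ N ^ 2 * θ * (8 ^ d * (R * ‖w.snd‖ ^ 2)) := by
            refine mul_le_mul_of_nonneg_left (hqb.trans ?_) (by positivity)
            exact mul_le_mul_of_nonneg_left hF (by positivity)
        _ = N ^ 2 * (8 ^ d * R) * (θ * ‖w.snd‖ ^ 2) := by ring
        _ ≤ _ := mul_le_mul_of_nonneg_left hco (by positivity)
  have hCS := hS.elliptic.energyForm_sq_le g w.snd
  rw [e1, ← hZ] at hCS
  have hgg := hS.elliptic.energyForm_self_le g
  have h2 : θ * N ^ 2 ≤ Θ * (4 * κ * 8 ^ d * ((S.ell : ℝ) + 1) ^ 2) := by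
    rcases hN0.eq_or_lt with h0 | hpos
    · rw [← h0]
      simp only [ne_eq, OfNat.ofNat_ne_zero, not_false_eq_true, zero_pow, mul_zero]
      positivity
    · refine le_of_mul_le_mul_left ?_
        (by positivity : 0 < N ^ 2 * (S.mesh.H ^ 2 * S.mesh.H ^ d))
      calc N ^ 2 * (S.mesh.H ^ 2 * S.mesh.H ^ d) * (θ * N ^ 2)
          = S.mesh.H ^ 2 * S.mesh.H ^ d * θ * (N ^ 2) ^ 2 := by ring
        _ ≤ S.mesh.H ^ 2 * S.mesh.H ^ d * θ * (Θ * ‖g‖ ^ 2 * Z) := by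
          refine mul_le_mul_of_nonneg_left (hCS.trans ?_) (by positivity)
          exact mul_le_mul_of_nonneg_right hgg hZ0
        _ = Θ * (S.mesh.H ^ 2 * ‖g‖ ^ 2) * (S.mesh.H ^ d * θ * Z) := by ring
        _ ≤ Θ * (κ * S.mesh.H ^ d) * (N ^ 2 * (8 ^ d * R)) := by gcongr
        _ = _ := by rw [hR]; ring
  have hq1 : 1 ≤ Θ / θ := (one_le_div hθ).2 hS.elliptic.le
  refine euclNorm_le_of_sq_le (by positivity) ?_
  rw [← euclNorm_sq, mul_pow, mul_pow, Real.sq_sqrt (by positivity)]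
  -- The argument gives the square root of `Θ / θ`; since this ratio is at least one, it is weakened
  -- to the form of the claim.
  calc N ^ 2 ≤ (Θ / θ) * (4 * κ * 8 ^ d * ((S.ell : ℝ) + 1) ^ 2) := by
        rw [div_mul_eq_mul_div, le_div_iff₀ hθ]; linarith
    _ ≤ (Θ / θ) ^ 2 * (4 * κ * 8 ^ d * ((S.ell : ℝ) + 1) ^ 2) := by
        refine mul_le_mul_of_nonneg_right ?_ (by positivity)
        nlinarith
    _ = _ := by ring

theorem abs_sub_le_of_mem_near (hS : S.Admissible θ Θ W κ) (K : Finset (Fin d → ℤ)) {i j : Fin d → ℤ}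
    (hi : i ∈ S.near K j) (s : Fin d) : |i s - j s| ≤ (S.ell : ℤ) + 1 :=
  S.mesh.abs_sub_le_of_star_inter_patch hS.one_le_ell (mem_near.1 hi).2 s

end Admissible

end LODData

/-- A cube of integer points of radius `r` has `(2 r + 1) ^ d` elements. -/
theorem card_le_of_forall_abs_sub_le {d r : ℕ} (F : Finset (Fin d → ℤ)) (j : Fin d → ℤ)
    (hF : ∀ i ∈ F, ∀ s, |i s - j s| ≤ (r : ℤ)) : F.card ≤ (2 * r + 1) ^ d := by
  have hsub : F ⊆ Finset.Icc (fun s => j s - (r : ℤ)) (fun s => j s + (r : ℤ)) := fun i hi => by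
    rw [Finset.mem_Icc]
    constructor <;> intro s <;> have := abs_le.1 (hF i hi s) <;> simp only <;> omega
  refine (Finset.card_le_card hsub).trans_eq ?_
  rw [Pi.card_Icc]
  have : ∀ s, (Finset.Icc (j s - (r : ℤ)) (j s + (r : ℤ))).card = 2 * r + 1 := fun s => by
    rw [Int.card_Icc]; omega
  simp [this]

/-! ### The two settings are admissible -/

namespace CubeMesh

variable {d : ℕ} (G : CubeMesh d)

theorem gradient_hat_bounds (i : Fin d → ℤ) : MemLp (gradient (G.hat i)) 2 volume ∧
    G.H ^ 2 * ∫ x, ‖gradient (G.hat i) x‖ ^ 2 ≤ (d * 3 ^ d * 3) ^ 2 * 6 ^ d * G.H ^ d := by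
  have hH := G.H_pos
  -- The constants are generous for a single hat. They are those needed for the three hats of
  -- `hatExt`, so that both variants share one `κ`.
  have h := gradient_prod_memLp (f := fun s t => G.hat1 (t - G.point i s)) (B := 3) (K := 3 / G.H)
    (V := 6 * G.H) (by norm_num) (by positivity) (by positivity)
    (fun s t => by
      rw [abs_of_nonneg (G.hat1_nonneg _)]; linarith [G.hat1_le_one (t - G.point i s)])
    (fun s t t' => by
      refine (G.abs_hat1_sub_le _ _).trans ?_
      rw [sub_sub_sub_cancel_right]
      gcongr
      norm_num)
    (T := fun s => Set.Icc (G.point i s - G.H) (G.point i s + G.H)) (fun _ => isClosed_Icc)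
    (fun s => by
      rw [Real.volume_Icc]
      exact ENNReal.ofReal_le_ofReal (by linarith))
    (fun s t ht => G.hat1_sub_eq_zero ht)
  refine ⟨h.1, (mul_le_mul_of_nonneg_left h.2 (by positivity)).trans_eq ?_⟩
  rw [mul_pow 6 G.H]
  field_simp

theorem gradient_hatExt_bounds (i : Fin d → ℤ) : MemLp (gradient (LODData.hatExt G i)) 2 volume ∧
    G.H ^ 2 * ∫ x, ‖gradient (LODData.hatExt G i) x‖ ^ 2 ≤ (d * 3 ^ d * 3) ^ 2 * 6 ^ d * G.H ^ d := by
  have hH := G.H_pos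
  have h := gradient_prod_memLp (f := fun s t => G.hat1 (t - G.point i s) -
      G.hat1 (t + G.point i s) - G.hat1 (t - (2 - G.point i s))) (B := 3) (K := 3 / G.H)
    (V := 6 * G.H) (by norm_num) (by positivity) (by positivity)
    (fun s t => by
      have h1 := G.hat1_nonneg (t - G.point i s)
      have h2 := G.hat1_nonneg (t + G.point i s)
      have h3 := G.hat1_nonneg (t - (2 - G.point i s))
      have h4 := G.hat1_le_one (t - G.point i s)
      have h5 := G.hat1_le_one (t + G.point i s)
      have h6 := G.hat1_le_one (t - (2 - G.point i s))
      rw [abs_le]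
      constructor <;> linarith)
    (fun s t t' => by
      have h1 := abs_le.1 (G.abs_hat1_sub_le (t - G.point i s) (t' - G.point i s))
      have h2 := abs_le.1 (G.abs_hat1_sub_le (t + G.point i s) (t' + G.point i s))
      have h3 := abs_le.1 (G.abs_hat1_sub_le (t - (2 - G.point i s)) (t' - (2 - G.point i s)))
      rw [sub_sub_sub_cancel_right] at h1 h3
      rw [add_sub_add_right_eq_sub] at h2
      have e : 3 / G.H * |t - t'| = 3 * (1 / G.H * |t - t'|) := by ring
      rw [e, abs_le]
      constructor <;> linarith [h1.1, h1.2, h2.1, h2.2, h3.1, h3.2])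
    (T := fun s => Set.Icc (G.point i s - G.H) (G.point i s + G.H) ∪
      Set.Icc (-G.point i s - G.H) (-G.point i s + G.H) ∪
      Set.Icc (2 - G.point i s - G.H) (2 - G.point i s + G.H))
    (fun _ => (isClosed_Icc.union isClosed_Icc).union isClosed_Icc)
    (fun s => by
      refine (measure_union_le _ _).trans ((add_le_add_left (measure_union_le _ _) _).trans ?_)
      simp only [Real.volume_Icc]
      rw [← ENNReal.ofReal_add (by linarith) (by linarith),
        ← ENNReal.ofReal_add (by linarith) (by linarith)]
      exact ENNReal.ofReal_le_ofReal (by linarith))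
    (fun s t ht => by
      simp only [Set.mem_union, not_or] at ht
      have h2 := G.hat1_sub_eq_zero ht.1.2
      rw [sub_neg_eq_add] at h2
      rw [G.hat1_sub_eq_zero ht.1.1, h2, G.hat1_sub_eq_zero ht.2]
      norm_num)
  refine ⟨h.1, (mul_le_mul_of_nonneg_left h.2 (by positivity)).trans_eq ?_⟩
  rw [mul_pow 6 G.H]
  field_simp

end CubeMesh

namespace LODData

variable {d : ℕ}

theorem admissible_standard {G : CubeMesh d} {Ω : Set (RSpace d)} (hG : G.domain = Ω) {ℓ : ℕ}
    (hℓ : 1 ≤ ℓ) {A : RSpace d → Matrix (Fin d) (Fin d) ℝ} {θ Θ : ℝ}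
    (hA : UniformlyElliptic Ω A θ Θ) :
    (standard G ℓ A).Admissible θ Θ ((volume Ω).toReal + 3 ^ d) ((d * 3 ^ d * 3) ^ 2 * 6 ^ d) where
  one_le_ell := hℓ
  qoiNodes_subset := by
    classical
    simp only [standard, CubeMesh.freeVertices]
    exact fun _ hi => (Finset.mem_filter.1 hi).1
  cells_nonempty := by
    rintro ⟨j, hj⟩
    have hj : j ∈ G.vertices := by
      simp only [standard, CubeMesh.freeVertices, Finset.mem_filter] at hj
      exact hj.1
    obtain ⟨z, hz, -⟩ := G.exists_cell_of_mem_vertices hj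
    exact ⟨z, hz⟩
  elliptic := by
    subst hG
    exact hA
  one_le := by
    have : (1 : ℝ) ≤ 3 ^ d := one_le_pow₀ (by norm_num)
    linarith [ENNReal.toReal_nonneg (a := volume Ω)]
  card_cells := by
    subst hG
    have hH := G.H_pos
    have h := ENNReal.toReal_mono G.volume_domain_lt_top.ne G.card_cells_mul_le_volume
    rw [ENNReal.toReal_mul, ENNReal.toReal_natCast, ENNReal.toReal_ofReal (by positivity)] at h
    have h3 : (0 : ℝ) ≤ 3 ^ d := by positivity
    exact h.trans (by linarith)
  nonneg := by positivity
  shape_memLp i := (G.gradient_hat_bounds i).1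
  shape_energy i := (G.gradient_hat_bounds i).2

/-- The reflection of `ℝ^d` into the unit cube. -/
def foldMap (x : RSpace d) : RSpace d := WithLp.toLp 2 (fun s => fold (x s))

/-- The three affine branches of `fold`. -/
def branch : Fin 3 → ℝ → ℝ := ![fun t => t, fun t => -t, fun t => 2 - t]

theorem measurePreserving_branch (e : Fin 3) : MeasurePreserving (branch e) := by
  fin_cases e
  · exact MeasurePreserving.id _
  · exact Measure.measurePreserving_neg _
  · exact Measure.measurePreserving_sub_left _ _

theorem exists_fold_eq_branch (t : ℝ) : ∃ e, fold t = branch e t := by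
  unfold fold
  split_ifs
  · exact ⟨1, rfl⟩
  · exact ⟨2, rfl⟩
  · exact ⟨0, rfl⟩

theorem measurable_foldMap : Measurable (foldMap : RSpace d → RSpace d) := by
  have h1 : Measurable fold := by
    unfold fold
    exact Measurable.ite measurableSet_Iio measurable_neg
      (Measurable.ite measurableSet_Ioi (measurable_const.sub measurable_id) measurable_id)
  refine (PiLp.volume_preserving_toLp (Fin d)).measurable.comp ?_
  refine measurable_pi_lambda _ fun s => h1.comp ?_
  exact (by fun_prop : Continuous fun x : RSpace d => x s).measurable

theorem volume_setOf_apply_eq (s : Fin d) (c : ℝ) : volume {x : RSpace d | x s = c} = 0 := by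
  classical
  have e : {x : RSpace d | x s = c} = {x | ∀ t, x t ∈ if t = s then {c} else Set.univ} := by
    ext x
    refine ⟨fun h t => ?_, fun h => ?_⟩
    · split_ifs with ht
      · rw [ht]; exact h
      · trivial
    · simpa using h s
  rw [e, volume_setOf_forall_mem _ fun t => by split_ifs <;> simp]
  exact Finset.prod_eq_zero (Finset.mem_univ s) (by simp)

theorem quasiMeasurePreserving_foldMap {D : Set (RSpace d)}
    (hD' : ∀ x ∈ D, ∀ s, -1 ≤ x s ∧ x s ≤ 2) :
    Measure.QuasiMeasurePreserving foldMap (volume.restrict D)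
      (volume.restrict {x : RSpace d | ∀ s, 0 < x s ∧ x s < 1}) := by
  set Q : Set (RSpace d) := {x : RSpace d | ∀ s, 0 < x s ∧ x s < 1} with hQ
  refine ⟨measurable_foldMap, Measure.AbsolutelyContinuous.mk fun N hN h0 => ?_⟩
  rw [Measure.restrict_apply hN] at h0
  rw [Measure.map_apply measurable_foldMap hN, Measure.restrict_apply (measurable_foldMap hN)]
  -- On any point the fold coincides with one of these `3 ^ d` measure-preserving affine maps.
  let R : (Fin d → Fin 3) → RSpace d → RSpace d := fun σ x =>
    WithLp.toLp 2 fun s => branch (σ s) (x s)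
  have hR : ∀ σ, MeasurePreserving (R σ) := fun σ =>
    (PiLp.volume_preserving_toLp (Fin d)).comp
      ((volume_preserving_pi fun s => measurePreserving_branch (σ s)).comp
        (PiLp.volume_preserving_ofLp (Fin d)))
  -- A folded point of `[-1,2] ^ d` that misses the open cube comes from a hyperplane where some
  -- coordinate is `-1`, `0`, `1` or `2`. These hyperplanes are null sets.
  have hsub : foldMap ⁻¹' N ∩ D ⊆ (⋃ σ, R σ ⁻¹' (N ∩ Q)) ∪
      ⋃ s : Fin d, ⋃ c ∈ ({-1, 0, 1, 2} : Finset ℝ), {x : RSpace d | x s = c} := by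
    rintro x ⟨hxN, hxD⟩
    by_cases hx : foldMap x ∈ Q
    · left
      choose σ hσ using fun s => exists_fold_eq_branch (x s)
      have e : foldMap x = R σ x := by
        simp only [foldMap, R, hσ]
      exact Set.mem_iUnion.2 ⟨σ, show R σ x ∈ N ∩ Q from e ▸ ⟨hxN, hx⟩⟩
    · right
      simp only [hQ, Set.mem_ofPred_eq, not_forall] at hx
      obtain ⟨s, hs⟩ := hx
      have hb := hD' x hxD s
      have key : x s = -1 ∨ x s = 0 ∨ x s = 1 ∨ x s = 2 := by
        by_contra hne
        push Not at hne
        refine hs ?_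
        simp only [foldMap, fold]
        have h1 := lt_of_le_of_ne hb.1 (Ne.symm hne.1)
        have h2 := lt_of_le_of_ne hb.2 hne.2.2.2
        split_ifs with h3 h4
        · constructor <;> linarith
        · constructor <;> linarith
        · exact ⟨lt_of_le_of_ne (not_lt.1 h3) (Ne.symm hne.2.1),
            lt_of_le_of_ne (not_lt.1 h4) hne.2.2.1⟩
      refine Set.mem_iUnion.2 ⟨s, ?_⟩
      simpa using key
  refine measure_mono_null hsub (measure_union_null ?_ ?_)
  · exact measure_iUnion_null fun σ => (hR σ).quasiMeasurePreserving.preimage_null h0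
  · refine measure_iUnion_null fun s => ?_
    exact (measure_biUnion_null_iff (Finset.countable_toSet _)).2 fun c _ => volume_setOf_apply_eq s c

/-- This is the role of `ℓ ≤ m`: the extension stays within the range where a single reflection
leads back to the unit interval. -/
theorem unitMesh_domain_bounds {m : ℕ} (hm : 0 < m) {ℓ : ℕ} (hℓ : ℓ ≤ m) :
    ∀ x ∈ (unitMesh d m hm ℓ).domain, ∀ s, -1 ≤ x s ∧ x s ≤ 2 := by
  intro x hx s
  have hx := interior_subset hx
  simp only [Set.mem_iUnion, exists_prop] at hx
  obtain ⟨z, hz, hxz⟩ := hx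
  have hz := Finset.mem_Icc.1 hz
  have h1 : -(ℓ : ℤ) ≤ z s := hz.1 s
  have h2 : z s ≤ (m : ℤ) + (ℓ : ℤ) - 1 := hz.2 s
  have hx := hxz s
  have hm' : (0 : ℝ) < m := by exact_mod_cast hm
  have hpt : (unitMesh d m hm ℓ).point z s = (z s : ℝ) / m := by
    simp [CubeMesh.point_apply, unitMesh]; ring
  have hH : (unitMesh d m hm ℓ).H = 1 / m := rfl
  rw [hpt, hH, ← add_div] at hx
  have h1' : -(m : ℝ) ≤ z s := by
    have : -(m : ℤ) ≤ z s := by omega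
    exact_mod_cast this
  have h2' : (z s : ℝ) + 1 ≤ 2 * m := by
    have : z s + 1 ≤ 2 * (m : ℤ) := by omega
    exact_mod_cast this
  constructor
  · refine le_trans ?_ hx.1
    rw [le_div_iff₀ hm']; linarith
  · refine hx.2.trans ?_
    rw [div_le_iff₀ hm']; linarith

theorem uniformlyElliptic_mirror {D : Set (RSpace d)}
    (hD' : ∀ x ∈ D, ∀ s, -1 ≤ x s ∧ x s ≤ 2) {A : RSpace d → Matrix (Fin d) (Fin d) ℝ} {θ Θ : ℝ}
    (hA : UniformlyElliptic {x : RSpace d | ∀ s, 0 < x s ∧ x s < 1} A θ Θ) :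
    UniformlyElliptic D (mirror A) θ Θ := by
  have hq := quasiMeasurePreserving_foldMap hD'
  exact ⟨hA.pos, hA.le, fun s t => (hA.aemeasurable s t).comp_quasiMeasurePreserving hq,
    hq.ae hA.symm, hq.ae hA.lower, hq.ae hA.upper⟩

theorem admissible_extended {Ω : Set (RSpace d)} (hΩ : Ω = {x | ∀ s, 0 < x s ∧ x s < 1}) {m : ℕ}
    (hm : 0 < m) {ℓ : ℕ} (hℓ : 1 ≤ ℓ) (hℓm : ℓ ≤ m) {A : RSpace d → Matrix (Fin d) (Fin d) ℝ}
    {θ Θ : ℝ} (hA : UniformlyElliptic Ω A θ Θ) :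
    (extended m hm ℓ A).Admissible θ Θ ((volume Ω).toReal + 3 ^ d) ((d * 3 ^ d * 3) ^ 2 * 6 ^ d) where
  one_le_ell := hℓ
  qoiNodes_subset := Finset.Subset.refl _
  cells_nonempty _ := by
    refine Finset.nonempty_Icc.2 fun s => ?_
    simp only
    omega
  elliptic := by
    subst hΩ
    exact uniformlyElliptic_mirror (unitMesh_domain_bounds hm hℓm) hA
  one_le := by
    have : (1 : ℝ) ≤ 3 ^ d := one_le_pow₀ (by norm_num)
    linarith [ENNReal.toReal_nonneg (a := volume Ω)]
  card_cells := by
    have hm' : (0 : ℝ) < m := by exact_mod_cast hm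
    -- At most `m` layers on either side give at most `3 m` cubes per direction; this is why `W`
    -- contains the summand `3 ^ d`.
    have hc : (unitMesh d m hm ℓ).cells.card ≤ (3 * m) ^ d := by
      simp only [unitMesh]
      rw [Pi.card_Icc]
      have : ∀ s : Fin d, (Finset.Icc (-(ℓ : ℤ)) ((m : ℤ) + (ℓ : ℤ) - 1)).card ≤ 3 * m := fun s => by
        rw [Int.card_Icc]; omega
      exact (Finset.prod_le_prod' fun s _ => this s).trans_eq (by simp)
    have hc' : ((unitMesh d m hm ℓ).cells.card : ℝ) ≤ (3 * m) ^ d := by exact_mod_cast hc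
    calc ((unitMesh d m hm ℓ).cells.card : ℝ) * (1 / (m : ℝ)) ^ d
        ≤ (3 * m) ^ d * (1 / (m : ℝ)) ^ d := mul_le_mul_of_nonneg_right hc' (by positivity)
      _ = 3 ^ d := by rw [← mul_pow]; congr 1; field_simp
      _ ≤ _ := by linarith [ENNReal.toReal_nonneg (a := volume Ω)]
  nonneg := by positivity
  shape_memLp i := (CubeMesh.gradient_hatExt_bounds _ i).1
  shape_energy i := (CubeMesh.gradient_hatExt_bounds _ i).2

end LODData

/-! ### Perturbation of the assembled matrix -/

namespace LODData

variable {d : ℕ} {S : LODData d}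

/-- At most one entry is nonzero. An upper bound suffices, so it need not be known that `j` belongs
to its own local index set. -/
theorem euclNorm_indicator_le_one (j : S.Node) :
    euclNorm (fun n : S.Loc j => if n.1 = j.1 then (1 : ℝ) else 0) ≤ 1 := by
  refine euclNorm_le_of_sq_le zero_le_one ?_
  simp only [ite_pow, one_pow, ne_eq, OfNat.ofNat_ne_zero, not_false_eq_true, zero_pow,
    Finset.sum_boole]
  have : (Finset.univ.filter fun n : S.Loc j => n.1 = j.1).card ≤ 1 :=
    Finset.card_le_one.2 fun a ha b hb => Subtype.ext
      ((Finset.mem_filter.1 ha).2.trans (Finset.mem_filter.1 hb).2.symm)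
  exact_mod_cast this

theorem euclNorm_multiplier_le (M : ∀ j : S.Node, Matrix (S.Loc j) (S.Loc j) ℝ) (j : S.Node) :
    euclNorm (S.multiplier M j) ≤ specNorm (M j)⁻¹ := by
  rw [multiplier, euclNorm_neg]
  refine (euclNorm_mulVec_le _ _).trans ?_
  exact mul_le_of_le_one_right (specNorm_nonneg _) (euclNorm_indicator_le_one j)

theorem euclNorm_multiplier_sub_le {M N : ∀ j : S.Node, Matrix (S.Loc j) (S.Loc j) ℝ} {j : S.Node}
    (hM : IsUnit (M j)) (hMN : IsUnit (M j + N j)) :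
    euclNorm (S.multiplier (M + N) j - S.multiplier M j) ≤
      specNorm (M j + N j)⁻¹ * specNorm (N j) * specNorm (M j)⁻¹ := by
  set e : S.Loc j → ℝ := fun n => if n.1 = j.1 then (1 : ℝ) else 0 with he
  have h1 : S.multiplier (M + N) j - S.multiplier M j =
      (M j + N j)⁻¹ *ᵥ (N j *ᵥ ((M j)⁻¹ *ᵥ e)) := by
    have := inv_add_sub_inv_mulVec hM hMN e
    rw [← neg_eq_iff_eq_neg.2 this]
    simp only [multiplier, Pi.add_apply, ← he]
    abel
  rw [h1, mul_assoc]
  refine (euclNorm_mulVec_le _ _).trans (mul_le_mul_of_nonneg_left ?_ (specNorm_nonneg _))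
  refine (euclNorm_mulVec_le _ _).trans (mul_le_mul_of_nonneg_left ?_ (specNorm_nonneg _))
  refine (euclNorm_mulVec_le _ _).trans ?_
  exact mul_le_of_le_one_right (specNorm_nonneg _) (euclNorm_indicator_le_one j)

/-- An exact splitting: the noise of the scalars is weighted with the perturbed multiplier, the
exact scalars with the change of the multiplier. It differs from `firstOrder_apply` only in the
multiplier of the first sum. -/
theorem assemble_sub_apply (M N : ∀ j : S.Node, Matrix (S.Loc j) (S.Loc j) ℝ)
    (a b : ∀ j : S.Node, Matrix (S.Row j) (S.Loc j) ℝ) (i j : S.Node) :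
    (S.assemble (M + N) (a + b) - S.assemble M a) i j =
      if h : i.1 ∈ S.near S.basisNodes j.1 then
        -(∑ k, S.multiplier (M + N) j k * b j ⟨i.1, h⟩ k +
          ∑ k, (S.multiplier (M + N) j - S.multiplier M j) k * a j ⟨i.1, h⟩ k) else 0 := by
  rw [Matrix.sub_apply]
  simp only [assemble]
  split_ifs with h
  · rw [← Finset.sum_add_distrib, ← neg_add', neg_inj, ← neg_neg (∑ k, S.multiplier M j k * _),
      neg_neg, ← sub_eq_zero, ← Finset.sum_neg_distrib, ← Finset.sum_add_distrib,
      ← Finset.sum_sub_distrib]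
    refine Finset.sum_eq_zero fun k _ => ?_
    simp only [Pi.add_apply, Pi.sub_apply, Matrix.add_apply]
    ring
  · simp

theorem firstOrder_apply (M N : ∀ j : S.Node, Matrix (S.Loc j) (S.Loc j) ℝ)
    (a b : ∀ j : S.Node, Matrix (S.Row j) (S.Loc j) ℝ) (i j : S.Node) :
    S.firstOrder M a N b i j =
      if h : i.1 ∈ S.near S.basisNodes j.1 then
        -(∑ k, S.multiplier M j k * b j ⟨i.1, h⟩ k +
          ∑ k, (S.multiplier (M + N) j - S.multiplier M j) k * a j ⟨i.1, h⟩ k) else 0 := by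
  simp only [firstOrder]
  split_ifs with h
  · rw [← Finset.sum_add_distrib]
    rfl
  · rfl

namespace Admissible

variable {θ Θ W κ : ℝ}

theorem card_loc_le (hS : S.Admissible θ Θ W κ) (j : S.Node) :
    (Fintype.card (S.Loc j) : ℝ) ≤ (2 * (S.ell : ℝ) + 3) ^ d := by
  rw [Fintype.card_coe]
  have := card_le_of_forall_abs_sub_le (r := S.ell + 1) (S.near S.qoiNodes j.1) j.1
    fun i hi s => by exact_mod_cast hS.abs_sub_le_of_mem_near _ hi s
  refine (Nat.cast_le.2 this).trans_eq ?_
  push_cast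
  congr 1
  ring

theorem meshSize_rpow_sq (S : LODData d) :
    (S.mesh.H ^ (-(d : ℝ) / 2)) ^ 2 = (S.mesh.H ^ d)⁻¹ := by
  have hH := S.mesh.H_pos
  rw [← Real.rpow_natCast, ← Real.rpow_mul hH.le, ← Real.rpow_natCast S.mesh.H d,
    ← Real.rpow_neg hH.le]
  congr 1
  push_cast
  ring

/-- The local indices are vertices of the mesh, each cube has `2 ^ d` vertices, and the total volume
of the cubes is at most `W`. -/
theorem sqrt_card_loc_le (hS : S.Admissible θ Θ W κ) (j : S.Node) :
    Real.sqrt (Fintype.card (S.Loc j)) ≤ Real.sqrt (2 ^ d * W) * S.mesh.H ^ (-(d : ℝ) / 2) := by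
  have hH := S.mesh.H_pos
  have hW : (0 : ℝ) ≤ W := by linarith [hS.one_le]
  refine Real.sqrt_le_iff.2 ⟨by positivity, ?_⟩
  rw [mul_pow, meshSize_rpow_sq, Real.sq_sqrt (by positivity), ← div_eq_mul_inv,
    le_div_iff₀ (by positivity), Fintype.card_coe]
  have h1 : ((S.near S.qoiNodes j.1).card : ℝ) ≤ 2 ^ d * S.mesh.cells.card := by
    exact_mod_cast (Finset.card_le_card (hS.near_subset j.1)).trans S.mesh.card_vertices_le
  calc _ ≤ 2 ^ d * S.mesh.cells.card * S.mesh.H ^ d :=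
        mul_le_mul_of_nonneg_right h1 (by positivity)
    _ = 2 ^ d * (S.mesh.cells.card * S.mesh.H ^ d) := by ring
    _ ≤ _ := mul_le_mul_of_nonneg_left hS.card_cells (by positivity)

/-- Used to insert the factor `H ^ (-d/2)` into the term with the noise of the matrices, whose bound
does not produce it. -/
theorem one_le_mul_rpow (hS : S.Admissible θ Θ W κ) (hd : 2 ≤ d) (j : S.Node) :
    1 ≤ Real.sqrt (2 ^ d * W) * S.mesh.H ^ (-(d : ℝ) / 2) := by
  have hH := S.mesh.H_pos
  have hW : (0 : ℝ) ≤ W := by linarith [hS.one_le]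
  refine (one_le_sq_iff₀ (by positivity)).1 ?_
  rw [mul_pow, meshSize_rpow_sq, Real.sq_sqrt (by positivity), ← div_eq_mul_inv,
    le_div_iff₀ (by positivity), one_mul]
  exact (hS.H_le hd j).2.trans (le_mul_of_one_le_left hW (one_le_pow₀ (by norm_num)))

/-- A matrix with the sparsity pattern of the assembled matrix. -/
theorem specNorm_le (hS : S.Admissible θ Θ W κ) {X : Matrix S.Node S.Node ℝ} {E : ℝ} (hE : 0 ≤ E)
    (hX : ∀ i j, |X i j| ≤ E) (h0 : ∀ i j, i.1 ∉ S.near S.basisNodes j.1 → X i j = 0) :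
    specNorm X ≤ (2 * (S.ell : ℝ) + 3) ^ d * E := by
  classical
  have hcard : ∀ (P : S.Node → Prop) [DecidablePred P] (j : S.Node),
      (∀ i, P i → ∀ s, |i.1 s - j.1 s| ≤ (S.ell : ℤ) + 1) →
      (Finset.univ.filter P).card ≤ (2 * (S.ell + 1) + 1) ^ d := fun P _ j hP => by
    rw [← Finset.card_map (Function.Embedding.subtype _)]
    refine card_le_of_forall_abs_sub_le _ j.1 fun i hi s => ?_
    obtain ⟨i', hi', rfl⟩ := Finset.mem_map.1 hi
    exact_mod_cast hP i' (Finset.mem_filter.1 hi').2 s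
  have := specNorm_le_of_sparse (X := X) (L := (2 * (S.ell + 1) + 1) ^ d)
    (r := fun i j => ∀ s, |i.1 s - j.1 s| ≤ (S.ell : ℤ) + 1) hE hX
    (fun i j hij => hS.abs_sub_le_of_mem_near S.basisNodes (by
      by_contra h
      exact hij (h0 i j h)))
    (fun i => hcard (fun j => ∀ s, |i.1 s - j.1 s| ≤ (S.ell : ℤ) + 1) i fun j hj s => by
      rw [abs_sub_comm]; exact hj s)
    (fun j => hcard (fun i => ∀ s, |i.1 s - j.1 s| ≤ (S.ell : ℤ) + 1) j fun i hi => hi)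
  refine this.trans_eq ?_
  push_cast
  congr 2
  ring

/-- The bound for an entry `-(∑ μ_k N_k + ∑ δμ_k a_k)` of the perturbation. -/
theorem abs_entry_le {n : Type*} [Fintype n] {μ b δ a : n → ℝ} {E x y z : ℝ} (hE : 0 ≤ E)
    (hb : ∀ k, |b k| ≤ E) (hμ : euclNorm μ ≤ x) (hδ : euclNorm δ ≤ y) (ha : euclNorm a ≤ z) :
    |-(∑ k, μ k * b k + ∑ k, δ k * a k)| ≤ x * (Real.sqrt (Fintype.card n) * E) + y * z := by
  rw [abs_neg]
  refine (abs_add_le _ _).trans (add_le_add ?_ ?_)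
  · refine (abs_sum_mul_le_euclNorm _ _).trans ?_
    exact mul_le_mul hμ (euclNorm_le_sqrt_card_mul hb hE) (euclNorm_nonneg _)
      ((euclNorm_nonneg _).trans hμ)
  · refine (abs_sum_mul_le_euclNorm _ _).trans ?_
    exact mul_le_mul hδ ha (euclNorm_nonneg _) ((euclNorm_nonneg _).trans hδ)

/-- The perturbation bounds, with the norm of the inverse matrices and of the rows of the scalars
as hypotheses. -/
theorem perturbation_bounds (hS : S.Admissible θ Θ W κ) (hd : 2 ≤ d)
    {M N : ∀ j : S.Node, Matrix (S.Loc j) (S.Loc j) ℝ}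
    {a b : ∀ j : S.Node, Matrix (S.Row j) (S.Loc j) ℝ} {p q r : ℝ} (hp : 0 ≤ p) (hq : 0 ≤ q)
    (hr : 0 ≤ r) (hM : ∀ j, IsUnit (M j)) (hMN : ∀ j, IsUnit (M j + N j))
    (hMp : ∀ j, specNorm (M j)⁻¹ ≤ p * Θ) (hMNq : ∀ j, specNorm (M j + N j)⁻¹ ≤ q * Θ)
    (ha : ∀ j i, euclNorm (a j i) ≤ r * ((S.ell : ℝ) + 1) * (Θ / θ)) {C : ℝ}
    (hC : q * p ≤ C ∧ Real.sqrt (2 ^ d * W) * (p + q + q * p * r) ≤ C) :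
    (∀ i j, |(S.assemble (M + N) (a + b) - S.assemble M a) i j - S.firstOrder M a N b i j| ≤
      C * Θ ^ 2 * (2 * (S.ell : ℝ) + 3) ^ (2 * d) * (maxEntry N * maxEntry b)) ∧
    specNorm (S.assemble (M + N) (a + b) - S.assemble M a) ≤
      C * (S.mesh.H ^ (-(d : ℝ) / 2) * (2 * (S.ell : ℝ) + 3) ^ d * Θ *
        (maxEntry b + Θ ^ 2 / θ * (2 * ((S.ell : ℝ) + 1)) * (2 * (S.ell : ℝ) + 3) ^ d *
          maxEntry N)) ∧
    specNorm (S.firstOrder M a N b) ≤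
      C * (S.mesh.H ^ (-(d : ℝ) / 2) * (2 * (S.ell : ℝ) + 3) ^ d * Θ *
        (maxEntry b + Θ ^ 2 / θ * (2 * ((S.ell : ℝ) + 1)) * (2 * (S.ell : ℝ) + 3) ^ d *
          maxEntry N)) := by
  have hΘ := hS.elliptic.upper_pos
  have hθ := hS.elliptic.pos
  have hH := S.mesh.H_pos
  have hW : (0 : ℝ) ≤ W := by linarith [hS.one_le]
  set EM := maxEntry N
  set Ea := maxEntry b
  have hEM : 0 ≤ EM := maxEntry_nonneg N
  have hEa : 0 ≤ Ea := maxEntry_nonneg b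
  set L : ℝ := (2 * (S.ell : ℝ) + 3) ^ d with hL
  have hL1 : 1 ≤ L := one_le_pow₀ (by linarith [(Nat.cast_nonneg S.ell : (0 : ℝ) ≤ S.ell)])
  set t : ℝ := Real.sqrt (2 ^ d * W) with ht
  have ht0 : 0 ≤ t := Real.sqrt_nonneg _
  set η : ℝ := S.mesh.H ^ (-(d : ℝ) / 2) with hη
  have hη0 : 0 ≤ η := by positivity
  have hb : ∀ j i k, |b j i k| ≤ Ea := fun j i k => abs_le_maxEntry b j i k
  have hN : ∀ j, specNorm (N j) ≤ L * EM := fun j =>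
    (specNorm_le_card_mul hEM fun i k => abs_le_maxEntry N j i k).trans
      (mul_le_mul_of_nonneg_right (hS.card_loc_le j) hEM)
  have hδ : ∀ j, euclNorm (S.multiplier (M + N) j - S.multiplier M j) ≤
      q * Θ * (L * EM) * (p * Θ) := fun j => by
    refine (euclNorm_multiplier_sub_le (hM j) (hMN j)).trans ?_
    have h1 := hMNq j
    have h2 := hMp j
    have h3 := hN j
    have := specNorm_nonneg (N j)
    have := specNorm_nonneg (M j)⁻¹
    gcongr
  have hμ : ∀ j, euclNorm (S.multiplier M j) ≤ p * Θ := fun j =>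
    (euclNorm_multiplier_le M j).trans (hMp j)
  have hμ' : ∀ j, euclNorm (S.multiplier (M + N) j) ≤ q * Θ := fun j =>
    (euclNorm_multiplier_le (M + N) j).trans (hMNq j)
  have hC0 : 0 ≤ C := (mul_nonneg hq hp).trans hC.1
  -- One estimate for both matrices: `x` is `q` when the perturbed multiplier weights the noise and
  -- `p` when the exact one does.
  have hentry : ∀ (j : S.Node) (x : ℝ), 0 ≤ x → x ≤ p + q →
      x * Θ * (Real.sqrt (Fintype.card (S.Loc j)) * Ea) +
        q * Θ * (L * EM) * (p * Θ) * (r * ((S.ell : ℝ) + 1) * (Θ / θ)) ≤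
      C * (η * Θ * (Ea + Θ ^ 2 / θ * (2 * ((S.ell : ℝ) + 1)) * L * EM)) := fun j x hx0 hx => by
    have h1 := hS.sqrt_card_loc_le j
    have h2 := hS.one_le_mul_rpow hd j
    have hC1 : t * (p + q) ≤ C := by
      refine le_trans (mul_le_mul_of_nonneg_left ?_ ht0) hC.2
      have : 0 ≤ q * p * r := by positivity
      linarith
    have hC2 : t * (q * p * r) ≤ C := by
      refine le_trans (mul_le_mul_of_nonneg_left ?_ ht0) hC.2
      linarith
    have e1 : x * Θ * (Real.sqrt (Fintype.card (S.Loc j)) * Ea) ≤ C * (η * Θ * Ea) := by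
      calc _ ≤ (p + q) * Θ * (t * η * Ea) := by gcongr
        _ = t * (p + q) * (η * Θ * Ea) := by ring
        _ ≤ _ := by gcongr
    have e2 : q * Θ * (L * EM) * (p * Θ) * (r * ((S.ell : ℝ) + 1) * (Θ / θ)) ≤
        C * (η * Θ * (Θ ^ 2 / θ * (2 * ((S.ell : ℝ) + 1)) * L * EM)) := by
      have hnn : 0 ≤ q * p * r * (Θ * (Θ ^ 2 / θ * ((S.ell : ℝ) + 1) * L * EM)) := by positivity
      calc _ = 1 * (q * p * r * (Θ * (Θ ^ 2 / θ * ((S.ell : ℝ) + 1) * L * EM))) := by ring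
        _ ≤ t * η * (q * p * r * (Θ * (Θ ^ 2 / θ * ((S.ell : ℝ) + 1) * L * EM))) :=
          mul_le_mul_of_nonneg_right h2 hnn
        _ = t * (q * p * r) * (η * Θ * (Θ ^ 2 / θ * (1 * ((S.ell : ℝ) + 1)) * L * EM)) := by ring
        _ ≤ C * (η * Θ * (Θ ^ 2 / θ * (2 * ((S.ell : ℝ) + 1)) * L * EM)) := by
          have h12 : (1 : ℝ) ≤ 2 := by norm_num
          gcongr
    calc _ ≤ _ := add_le_add e1 e2
      _ = _ := by ring
  have hE0 : 0 ≤ C * (η * Θ * (Ea + Θ ^ 2 / θ * (2 * ((S.ell : ℝ) + 1)) * L * EM)) := by positivity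
  refine ⟨fun i j => ?_, ?_, ?_⟩
  · have hrhs : 0 ≤ C * Θ ^ 2 * (2 * (S.ell : ℝ) + 3) ^ (2 * d) * (EM * Ea) := by positivity
    rw [assemble_sub_apply, firstOrder_apply]
    split_ifs with h
    · have e : ∀ x y z : ℝ, -(x + y) - -(z + y) = -(x - z) := fun x y z => by ring
      rw [e, ← Finset.sum_sub_distrib, abs_neg]
      have e2 : ∑ k, (S.multiplier (M + N) j k * b j ⟨i.1, h⟩ k -
          S.multiplier M j k * b j ⟨i.1, h⟩ k) =
          ∑ k, (S.multiplier (M + N) j - S.multiplier M j) k * b j ⟨i.1, h⟩ k :=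
        Finset.sum_congr rfl fun k _ => by rw [Pi.sub_apply, sub_mul]
      rw [e2]
      -- Here the number of local indices is bounded by `L` rather than through `H`, so the
      -- remainder carries no power of `H`; the square root is given away since `L ≥ 1`.
      have hsq : Real.sqrt (Fintype.card (S.Loc j)) ≤ L := by
        refine Real.sqrt_le_iff.2 ⟨by linarith, (hS.card_loc_le j).trans ?_⟩
        nlinarith
      calc _ ≤ _ := abs_sum_mul_le_euclNorm _ _
        _ ≤ q * Θ * (L * EM) * (p * Θ) * (L * Ea) := by
          refine mul_le_mul (hδ j) ?_ (euclNorm_nonneg _) (by positivity)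
          exact (euclNorm_le_sqrt_card_mul (hb j _) hEa).trans
            (mul_le_mul_of_nonneg_right hsq hEa)
        _ = q * p * (Θ ^ 2 * (L * L) * (EM * Ea)) := by ring
        _ ≤ C * (Θ ^ 2 * (L * L) * (EM * Ea)) := mul_le_mul_of_nonneg_right hC.1 (by positivity)
        _ = _ := by rw [hL, two_mul d, pow_add]; ring
    · simpa using hrhs
  · refine (hS.specNorm_le hE0 (fun i j => ?_) fun i j h => ?_).trans_eq (by ring)
    · rw [assemble_sub_apply]
      split_ifs with h
      · exact (abs_entry_le hEa (hb j _) (hμ' j) (hδ j) (ha j _)).trans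
          (hentry j q hq (by linarith))
      · simpa using hE0
    · rw [assemble_sub_apply, dif_neg h]
  · refine (hS.specNorm_le hE0 (fun i j => ?_) fun i j h => ?_).trans_eq (by ring)
    · rw [firstOrder_apply]
      split_ifs with h
      · exact (abs_entry_le hEa (hb j _) (hμ j) (hδ j) (ha j _)).trans
          (hentry j p hp (by linarith))
      · simpa using hE0
    · rw [firstOrder_apply, dif_neg h]

end Admissible

end LODData

/-! ### The main theorem -/

theorem IsLODSetting.admissible {d : ℕ} {Ω : Set (RSpace d)} {θ Θ : ℝ} {S : LODData d}
    (h : IsLODSetting Ω θ Θ S) :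
    S.Admissible θ Θ ((volume Ω).toReal + 3 ^ d) ((d * 3 ^ d * 3) ^ 2 * 6 ^ d) := by
  cases h with
  | standard G hG ℓ hℓ A hA => exact LODData.admissible_standard hG hℓ hA
  | extended hΩ m hm ℓ hℓ hℓm A hA => exact LODData.admissible_extended hΩ hm hℓ hℓm hA

end

theorem mainTheorem2 (d : ℕ) (hd : d = 2 ∨ d = 3) (Ω : Set (RSpace d)) (ρ : ℝ) (hρ : ρ < 1) :
    ∃ C : ℝ, 0 < C ∧
      ∀ (θ Θ : ℝ) (S : LODData d), IsLODSetting Ω θ Θ S →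
        (∀ (j : S.Node) (k : S.Loc j), ∃! u : L2Pair d, S.IsLocalSolution j k u) ∧
        ∀ u : ∀ j : S.Node, S.Loc j → L2Pair d, (∀ j k, S.IsLocalSolution j k (u j k)) →
          (∀ j, IsUnit (S.measM u j)) ∧
          ∀ (noiseM : ∀ j : S.Node, Matrix (S.Loc j) (S.Loc j) ℝ)
            (noiseA : ∀ j : S.Node, Matrix (S.Row j) (S.Loc j) ℝ),
            (∀ j, specNorm (S.measM u j)⁻¹ * specNorm (noiseM j) ≤ ρ) →
            (∀ j, IsUnit (S.measM u j + noiseM j)) ∧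
            ∃ δA : Matrix S.Node S.Node ℝ,
              S.assemble (S.measM u + noiseM) (S.measA u + noiseA) =
                S.assemble (S.measM u) (S.measA u) + δA ∧
              (∀ i j, |δA i j - S.firstOrder (S.measM u) (S.measA u) noiseM noiseA i j| ≤
                C * Θ ^ 2 * (2 * (S.ell : ℝ) + 3) ^ (2 * d) *
                  (LODData.maxEntry noiseM * LODData.maxEntry noiseA)) ∧
              specNorm δA ≤
                C * (S.mesh.H ^ (-(d : ℝ) / 2) * (2 * (S.ell : ℝ) + 3) ^ d * Θ *
                  (LODData.maxEntry noiseA + Θ ^ 2 / θ * (2 * ((S.ell : ℝ) + 1)) *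
                    (2 * (S.ell : ℝ) + 3) ^ d * LODData.maxEntry noiseM)) ∧
              specNorm (S.firstOrder (S.measM u) (S.measA u) noiseM noiseA) ≤
                C * (S.mesh.H ^ (-(d : ℝ) / 2) * (2 * (S.ell : ℝ) + 3) ^ d * Θ *
                  (LODData.maxEntry noiseA + Θ ^ 2 / θ * (2 * ((S.ell : ℝ) + 1)) *
                    (2 * (S.ell : ℝ) + 3) ^ d * LODData.maxEntry noiseM)) := by
  have hd2 : 2 ≤ d := by omega
  obtain ⟨ψ, B, K, hψ⟩ := exists_dualBumps
  obtain ⟨W, hW⟩ : ∃ W : ℝ, W = (volume Ω).toReal + 3 ^ d := ⟨_, rfl⟩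
  obtain ⟨κ, hκ⟩ : ∃ κ : ℝ, κ = (d * 3 ^ d * 3) ^ 2 * 6 ^ d := ⟨_, rfl⟩
  obtain ⟨p, hp⟩ : ∃ p : ℝ, p = 8 ^ d * (d * B ^ d * K) ^ 2 * W ^ d := ⟨_, rfl⟩
  obtain ⟨r, hr⟩ : ∃ r : ℝ, r = Real.sqrt (4 * κ * 8 ^ d) := ⟨_, rfl⟩
  have h1ρ : 0 < 1 - ρ := by linarith
  have hW0 : 0 ≤ W := by rw [hW]; positivity
  have hp0 : 0 ≤ p := by rw [hp]; positivity
  have hr0 : 0 ≤ r := by rw [hr]; positivity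
  have hq0 : 0 ≤ p / (1 - ρ) := by positivity
  -- The bounds on the inverses are `p Θ` and `p Θ / (1 - ρ)`, that on the rows has constant `r`.
  -- The two summands serve the remainder and the spectral bounds, and the final one ensures
  -- positivity.
  refine ⟨p / (1 - ρ) * p + Real.sqrt (2 ^ d * W) * (p + p / (1 - ρ) + p / (1 - ρ) * p * r) + 1,
    by positivity, fun θ Θ S hSet => ?_⟩
  have hS : S.Admissible θ Θ W κ := by rw [hW, hκ]; exact hSet.admissible
  have hΘ := hS.elliptic.upper_pos
  refine ⟨fun j k => hS.existsUnique_isLocalSolution (by omega) j k, fun u hu => ?_⟩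
  have hM : ∀ j, IsUnit (S.measM u j) ∧ specNorm (S.measM u j)⁻¹ ≤ p * Θ := fun j =>
    isUnit_of_euclNorm_le (by positivity) fun c => by
      rw [hp]
      exact hS.euclNorm_le_measM hd2 hψ hu j c
  refine ⟨fun j => (hM j).1, fun noiseM noiseA hnoise => ?_⟩
  have hMN : ∀ j, IsUnit (S.measM u j + noiseM j) ∧
      specNorm (S.measM u j + noiseM j)⁻¹ ≤ p * Θ / (1 - ρ) := fun j =>
    isUnit_add_of_specNorm_le (hM j).1 (hM j).2 hρ (hnoise j)
  refine ⟨fun j => (hMN j).1, _, (add_sub_cancel _ _).symm, ?_⟩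
  refine hS.perturbation_bounds hd2 hp0 hq0 hr0 (fun j => (hM j).1) (fun j => (hMN j).1)
    (fun j => (hM j).2) (fun j => (hMN j).2.trans_eq (by ring))
    (fun j i => by rw [hr]; exact hS.euclNorm_measA_le (by omega) hu j i) ⟨?_, ?_⟩
  · have : 0 ≤ Real.sqrt (2 ^ d * W) * (p + p / (1 - ρ) + p / (1 - ρ) * p * r) := by positivity
    linarith
  · have : 0 ≤ p / (1 - ρ) * p := by positivity
    linarith
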